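/- Consider the viscous St. Venant system in Lagrangian form $$\partial_t\tau-\partial_x u=0,\qquad \partial_t u+\partial_x\Big(\frac{\tau^{-2}}{2F^2}\Big)=1-\tau u^2+\nu\,\partial_x(\tau^{-2}\partial_x u),\qquad \nu>0,$$ with Froude number $F$. Fix $\alpha\ge-2$ and use the scaling $$\tau=F^{\alpha}a,\quad u=F^{-\alpha/2}b,\quad c=c_0F^{-1-3\alpha/2},\quad k=k_0F^{1/2+5\alpha/4},\quad q=q_0F^{-\alpha/2}$$ ($k=1/X$ the wave number, $k_0=1/X_0$, $q=c\tau+u$). In the co-moving coordinate $k(x-ct)$, periodic traveling waves correspond to positive $1$-periodic $C^2$ solutions $a$ of the rescaled profile equation $$a''=-\frac{a^2}{c_0k_0^2\nu}\Big(k_0a'F^{-3/2-3\alpha/4}(c_0^2-a^{-3})-1+a(q_0-c_0F^{-1}a)^2-2c_0k_0^2\nu\,(a')^2a^{-3}\Big),\qquad b=q_0-c_0F^{-1}a. \tag{1}$$ The limiting profile equation is obtained from (1) by replacing $F^{-1}$ by $0$ and $F^{-3/2-3\alpha/4}$ by its limit, which is $1$ if $\alpha=-2$ and $0$ if $\alpha>-2$.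 Suppose that for all sufficiently large $F$ we are given a positive $1$-periodic solution $\bar a_F$ of (1) with parameters $(c_0,k_0,q_0)=(c_0(F),k_0(F),q_0(F))$, that these parameters converge as $F\to\infty$ to $c_\infty\neq0$, $k_\infty>0$, $q_\infty\in\mathbb R$, and that $\bar a_F\to\bar a_\infty$ uniformly, where $\bar a_\infty$ is a positive $1$-periodic solution of the limiting profile equation with parameters $(c_\infty,k_\infty,q_\infty)$. The limiting spectral problem about $\bar a_\infty$ is, for $\alpha=-2$, $$\begin{aligned}\Lambda a-k_\infty c_\infty a'-k_\infty b'&=0,\\ \Lambda b-k_\infty c_\infty b'-k_\infty(\bar a_\infty^{-3}a)'&=-q_\infty^2a+\nu k_\infty^2\big(\bar a_\infty^{-2}b'+2c_\infty\bar a_\infty^{-3}\bar a_\infty'a\big)',\end{aligned}$$ considered on $L^2(\mathbb R)^2$ with domain $H^1\times H^2$, and, for $\alpha>-2$, $$0=-q_\infty^2a+\Lambda\nu k_\infty(\bar a_\infty^{-2}a)'-\nu k_\infty^2c_\infty(\bar a_\infty^{-2}a)'',$$ considered on $L^2(\mathbb R)$ with domain $H^2$. Its $L^2(\mathbb R)$-spectrum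 is the set of $\Lambda\in\mathbb C$ for which the corresponding operator is not a bijection of its domain onto the $L^2$ space with bounded inverse. If this limiting $L^2(\mathbb R)$-spectrum contains a point $\Lambda$ with $\operatorname{Re}\Lambda>0$, then for all sufficiently large $F$ the St. Venant wave $(\bar\tau,\bar u)=\big(F^{\alpha}\bar a_F,\;F^{-\alpha/2}(q_0(F)-c_0(F)F^{-1}\bar a_F)\big)$, with speed $c=c_0(F)F^{-1-3\alpha/2}$ and wave number $k=k_0(F)F^{1/2+5\alpha/4}$, is spectrally unstable: the $L^2(\mathbb R)$-spectrum of the St. Venant system, written in the frame $(x,t)\mapsto(k(x-ct),t)$ and linearized about $(\bar\tau,\bar u)$ (domain $H^1\times H^2$), contains a point with positive real part. -/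

import Mathlib

open MeasureTheory Filter Topology

noncomputable section

/-- The Hilbert space `L²(ℝ; ℂ)`. -/
abbrev L2R : Type := Lp ℂ 2 (volume : Measure ℝ)

/-- `g` is the weak derivative of `f` on the real line. -/
def HasWeakDeriv (f g : ℝ → ℂ) : Prop :=
  LocallyIntegrable f volume ∧ LocallyIntegrable g volume ∧
    ∀ φ : ℝ → ℝ, ContDiff ℝ (⊤ : ℕ∞) φ → HasCompactSupport φ →
      ∫ x, ((deriv φ x : ℝ) : ℂ) * f x = - ∫ x, ((φ x : ℝ) : ℂ) * g x

/-- A (possibly unbounded) linear operator, given by its graph `T w r` ("`w` lies in the domain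
and is mapped to `r`"), is a bijection of its domain onto `X` with bounded inverse. -/
def HasBoundedInverse {X : Type*} [NormedAddCommGroup X] (T : X → X → Prop) : Prop :=
  (∀ r : X, ∃! w : X, T w r) ∧ ∃ C : ℝ, ∀ w r : X, T w r → ‖w‖ ≤ C * ‖r‖

/-- The spectrum of a family `z ↦ T z` of operators given by their graphs; for `T z = z - L`
this is the spectrum of `L`. -/
def pencilSpectrum {X : Type*} [NormedAddCommGroup X] (T : ℂ → X → X → Prop) : Set ℂ :=
  {z | ¬ HasBoundedInverse (T z)}

/-- Graph of `z - L`, where `L` is the linearization about the stationary solution `(T, U)` of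
the viscous St. Venant system in Lagrangian coordinates, in the frame `(x,t) ↦ (k (x - c t), t)`,
`τ_t - k c τ' - k u' = 0`,
`u_t - k c u' + k (τ⁻² / (2F²))' = 1 - τ u² + ν k² (τ⁻² u')'`.
Here `w = (τ, u)` is the perturbation and `r` the right-hand side. The function `s'` is the weak
derivative of the linearized flux; requiring `τ, u ∈ L²` and `τ', u', s' ∈ L²` amounts to
`(τ, u) ∈ H¹ × H²`. -/
def StVenantResolventEq (ν F k c : ℝ) (T U : ℝ → ℝ) (z : ℂ) (w r : L2R × L2R) : Prop :=
  ∃ τ' u' s' : L2R,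
    HasWeakDeriv (fun x => w.1 x) (fun x => τ' x) ∧
    HasWeakDeriv (fun x => w.2 x) (fun x => u' x) ∧
    HasWeakDeriv
      (fun x => ((k / F ^ 2 / T x ^ 3 : ℝ) : ℂ) * w.1 x
        + (ν : ℂ) * (k : ℂ) ^ 2 *
          (((1 / T x ^ 2 : ℝ) : ℂ) * u' x - ((2 * deriv U x / T x ^ 3 : ℝ) : ℂ) * w.1 x))
      (fun x => s' x) ∧
    (∀ᵐ x : ℝ, z * w.1 x - (k : ℂ) * (c : ℂ) * τ' x - (k : ℂ) * u' x = r.1 x) ∧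
    (∀ᵐ x : ℝ, z * w.2 x - (k : ℂ) * (c : ℂ) * u' x - s' x
        + ((U x ^ 2 : ℝ) : ℂ) * w.1 x + ((2 * T x * U x : ℝ) : ℂ) * w.2 x = r.2 x)

/-- The `L²(ℝ)`-spectrum of the St. Venant system linearized about the wave `(T, U)`. -/
def stVenantSpectrum (ν F k c : ℝ) (T U : ℝ → ℝ) : Set ℂ :=
  pencilSpectrum (StVenantResolventEq ν F k c T U)

/-- The wave `(T, U)` is spectrally unstable: the `L²(ℝ)`-spectrum of the linearization about it
meets the open right half plane. -/
def StVenantSpectrallyUnstable (ν F k c : ℝ) (T U : ℝ → ℝ) : Prop :=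
  ∃ z ∈ stVenantSpectrum ν F k c T U, 0 < z.re

/-- Positive `1`-periodic solutions `a` of the profile equation
`a'' = -(a²/(c k² ν)) (ε k a' (c² - 1/a³) - 1 + a (q - c δ a)² - 2 c k² ν (a')²/a³)`.
The rescaled profile equation at Froude number `F` has `ε = F^(-3/2-3α/4)` and `δ = 1/F`. -/
def IsRescaledProfile (ε δ ν c k q : ℝ) (a : ℝ → ℝ) : Prop :=
  ContDiff ℝ 2 a ∧ Function.Periodic a 1 ∧ (∀ x, 0 < a x) ∧
    ∀ x, deriv (deriv a) x =
      -(a x ^ 2 / (c * k ^ 2 * ν)) *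
        (k * deriv a x * ε * (c ^ 2 - 1 / a x ^ 3) - 1 + a x * (q - c * δ * a x) ^ 2
          - 2 * c * k ^ 2 * ν * (deriv a x) ^ 2 / a x ^ 3)

/-- Profiles of the rescaled equation at Froude number `F` and scaling exponent `α`. -/
def IsFroudeProfile (α F ν c k q : ℝ) (a : ℝ → ℝ) : Prop :=
  IsRescaledProfile (F ^ (-(3 / 2) - 3 * α / 4)) F⁻¹ ν c k q a

/-- Profiles of the limiting equation `F → ∞`, where `F^(-3/2-3α/4)` tends to `1` if `α = -2`
and to `0` if `α > -2`. -/
def IsLimitingProfile (α ν c k q : ℝ) (a : ℝ → ℝ) : Prop :=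
  IsRescaledProfile (if α = -2 then 1 else 0) 0 ν c k q a

/-- Limiting spectral problem for `α = -2`, with right-hand side `r`, for `w = (a, b)`:
`Λ a - k c a' - k b' = r₁`,
`Λ b - k c b' - k (A⁻³ a)' = - q² a + ν k² (A⁻² b' + 2 c A⁻³ A' a)' + r₂`. -/
def CriticalLimitEq (ν c k q : ℝ) (A : ℝ → ℝ) (Λ : ℂ) (w r : L2R × L2R) : Prop :=
  ∃ a' b' s' : L2R,
    HasWeakDeriv (fun x => w.1 x) (fun x => a' x) ∧
    HasWeakDeriv (fun x => w.2 x) (fun x => b' x) ∧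
    HasWeakDeriv
      (fun x => ((k / A x ^ 3 : ℝ) : ℂ) * w.1 x
        + (ν : ℂ) * (k : ℂ) ^ 2 *
          (((1 / A x ^ 2 : ℝ) : ℂ) * b' x + ((2 * c * deriv A x / A x ^ 3 : ℝ) : ℂ) * w.1 x))
      (fun x => s' x) ∧
    (∀ᵐ x : ℝ, Λ * w.1 x - (k : ℂ) * (c : ℂ) * a' x - (k : ℂ) * b' x = r.1 x) ∧
    (∀ᵐ x : ℝ, Λ * w.2 x - (k : ℂ) * (c : ℂ) * b' x - s' x + (q : ℂ) ^ 2 * w.1 x = r.2 x)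

/-- Limiting spectral problem for `α > -2`, with right-hand side `r`:
`- q² a + ν k Λ (A⁻² a)' - ν k² c (A⁻² a)'' = r`.
It arises from `Λ a - k c a' - k b' = 0`, `0 = - q² a + ν k² (A⁻² b' + 2 c A⁻³ A' a)'`
by eliminating `b'`. -/
def HamiltonianLimitEq (ν c k q : ℝ) (A : ℝ → ℝ) (Λ : ℂ) (a r : L2R) : Prop :=
  ∃ v' v'' : L2R,
    HasWeakDeriv (fun x => ((1 / A x ^ 2 : ℝ) : ℂ) * a x) (fun x => v' x) ∧
    HasWeakDeriv (fun x => v' x) (fun x => v'' x) ∧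
    ∀ᵐ x : ℝ, -(q : ℂ) ^ 2 * a x + (ν : ℂ) * (k : ℂ) * Λ * v' x
        - (ν : ℂ) * (k : ℂ) ^ 2 * (c : ℂ) * v'' x = r x

/-- The `L²(ℝ)`-spectrum, in `Λ`, of the limiting spectral problem about the limiting
profile `A`. -/
def limitingSpectrum (α ν c k q : ℝ) (A : ℝ → ℝ) : Set ℂ :=
  if α = -2 then pencilSpectrum (CriticalLimitEq ν c k q A)
  else pencilSpectrum (HamiltonianLimitEq ν c k q A)

end

/-!
The spectral problems are compared through Floquet theory.

In rescaled variables the spectral problem about the wave at Froude number `F` depends on `F` only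
through the parameters, the profile `A`, `ε = F^(-3/2-3α/4)` and `δ = 1/F`. Written for `v = a/A²`,
`g = ca + b` and `P`, the linearized flux plus `εkcb`, it is a first order system
`Y' = (B₀ + ΛB₁) Y` whose periodic coefficients contain `A` but not `A'`. Uniform convergence of the
profiles therefore makes the coefficients converge uniformly (`tendsto_fullB`). The property
`HasBloch B ρ` says that `Y' = BY` has a nonzero solution with `Y(x+1) = ρ Y(x)`. Three facts about
it carry the proof.

*A point of the limiting spectrum gives a Floquet multiplier on the unit circle.* If
`Y' = BY` has no such multiplier, then `Y' = BY + f` is boundedly and uniquely solvable in `L²`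
(`exists_memLp_isMild`). Sampling at the integers turns this into the invertibility of `S - M` on
`ℓ²(ℤ)`, with `S` the shift and `M` the monodromy matrix; since `S` and `M` commute, `S - M` divides
`χ(S)`, where `χ` is the characteristic polynomial of `M`, and `χ(S)` is invertible because the
spectrum of `S` lies on the unit circle. Solvability of the first order system is then translated
into the existence of a bounded inverse (`hasBoundedInverse_criticalLimitEq`,
`hasBoundedInverse_hamiltonianLimitEq`).

*Floquet multipliers persist* (`HasBloch.eventually_exists`). The Evans function `det (M - ρ)` is
holomorphic in `Λ` and continuous in the coefficients and in `ρ`, so Hurwitz's theorem applies once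
it is known not to vanish identically in `Λ`. At large real `Λ` it has no zero, since a quadratic
form in the solution is then monotone, whereas Floquet solutions make it periodic
(`exists_not_hasBloch_critical`, `exists_not_hasBloch_reduced`).

*A Floquet multiplier on the unit circle at finite `F` gives a point of the spectrum*
(`mem_stVenantSpectrum_of_hasBloch`): wide cutoffs of the Floquet solution form a Weyl sequence.

For `α = -2` this suffices. For `α > -2` the limit has `ε = δ = 0`, and the system decouples into a
reduced one for `(v, P)`, equivalent to the limiting problem, and `g' = (Λ/k) A² v`. The component
`g` produces the multiplier `1` for every `Λ`, so that Hurwitz's theorem is not available at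
`ρ = 1`. Applied to the reduced system with varying `ρ`, it moves an unstable solution with
multiplier `1` to a nearby multiplier `ρ ≠ 1` (`exists_hasBloch_reduced_ne_one`), where the full
system has the same multipliers as the reduced one.
-/

noncomputable section

namespace StVenant

open scoped BoundedContinuousFunction

/-! ### Linear systems and Floquet solutions -/

/-- Continuous bounded coefficient matrices `B` of the linear system `Y' = B Y` on the line, with
the supremum norm over all entries. -/
abbrev Coeff (n : ℕ) : Type := Fin n → Fin n → (ℝ →ᵇ ℂ)

/-- The vector `B(x) y`. -/
def Coeff.act {n : ℕ} (B : Coeff n) (x : ℝ) (y : Fin n → ℂ) : Fin n → ℂ :=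
  fun i => ∑ j, B i j x * y j

/-- `Y` solves the linear system `Y' = B Y` on the whole line. -/
def IsSolution {n : ℕ} (B : Coeff n) (Y : ℝ → Fin n → ℂ) : Prop :=
  ∀ x, HasDerivAt Y (B.act x (Y x)) x

/-- The system `Y' = B Y` has a nontrivial solution with Floquet multiplier `ρ`. -/
def HasBloch {n : ℕ} (B : Coeff n) (ρ : ℂ) : Prop :=
  ∃ Y : ℝ → Fin n → ℂ, Y ≠ 0 ∧ IsSolution B Y ∧ ∀ x, Y (x + 1) = ρ • Y x

/-- The coefficients are `1`-periodic. -/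
def Coeff.Periodic {n : ℕ} (B : Coeff n) : Prop := ∀ i j x, B i j (x + 1) = B i j x

section Basic

variable {n : ℕ}

theorem Coeff.act_add (B : Coeff n) (x : ℝ) (y z : Fin n → ℂ) :
    B.act x (y + z) = B.act x y + B.act x z := by
  ext i; simp [Coeff.act, mul_add, Finset.sum_add_distrib]

theorem Coeff.act_sub (B : Coeff n) (x : ℝ) (y z : Fin n → ℂ) :
    B.act x (y - z) = B.act x y - B.act x z := by
  ext i; simp [Coeff.act, mul_sub, Finset.sum_sub_distrib]

theorem Coeff.act_smul (B : Coeff n) (x : ℝ) (c : ℂ) (y : Fin n → ℂ) :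
    B.act x (c • y) = c • B.act x y := by
  ext i; simp [Coeff.act, Finset.mul_sum]; congr 1; ext j; ring

theorem Coeff.act_sum_smul {m : ℕ} (B : Coeff n) (x : ℝ) (c : Fin m → ℂ)
    (y : Fin m → Fin n → ℂ) : B.act x (∑ j, c j • y j) = ∑ j, c j • B.act x (y j) := by
  ext i
  simp only [Coeff.act, Finset.sum_apply, Pi.smul_apply, smul_eq_mul, Finset.mul_sum]
  rw [Finset.sum_comm]
  exact Finset.sum_congr rfl fun _ _ => Finset.sum_congr rfl fun _ _ => by ring

theorem Coeff.norm_act_le (B : Coeff n) (x : ℝ) (y : Fin n → ℂ) :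
    ‖B.act x y‖ ≤ n * ‖B‖ * ‖y‖ := by
  refine (pi_norm_le_iff_of_nonneg (by positivity)).2 fun i => ?_
  calc ‖∑ j, B i j x * y j‖ ≤ ∑ j : Fin n, ‖B‖ * ‖y‖ := by
        refine norm_sum_le_of_le _ fun j _ => ?_
        rw [norm_mul]
        gcongr
        · exact ((B i j).norm_coe_le_norm x).trans ((norm_le_pi_norm (B i) j).trans
            (norm_le_pi_norm B i))
        · exact norm_le_pi_norm y j
    _ = n * ‖B‖ * ‖y‖ := by simp [mul_assoc]

theorem Coeff.continuous_act (B : Coeff n) {Y : ℝ → Fin n → ℂ} (hY : Continuous Y) :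
    Continuous fun x => B.act x (Y x) := by
  unfold Coeff.act; fun_prop

theorem IsSolution.eq {B : Coeff n} {Y Z : ℝ → Fin n → ℂ} (hY : IsSolution B Y)
    (hZ : IsSolution B Z) {x₀ : ℝ} (h : Y x₀ = Z x₀) : Y = Z := by
  refine ODE_solution_unique_univ (v := fun x y => B.act x y) (s := fun _ => Set.univ)
    (K := (n * ‖B‖).toNNReal) (fun t => ?_) (fun t => ⟨hY t, trivial⟩)
    (fun t => ⟨hZ t, trivial⟩) h
  refine (LipschitzWith.of_dist_le_mul fun y z => ?_).lipschitzOnWith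
  rw [dist_eq_norm, dist_eq_norm, ← B.act_sub, Real.coe_toNNReal _ (by positivity)]
  exact B.norm_act_le t _

theorem IsSolution.zero (B : Coeff n) : IsSolution B 0 := fun x => by
  have : B.act x ((0 : ℝ → Fin n → ℂ) x) = 0 := by ext i; simp [Coeff.act]
  rw [this]; exact hasDerivAt_const x (0 : Fin n → ℂ)

theorem IsSolution.smul {B : Coeff n} {Y : ℝ → Fin n → ℂ} (hY : IsSolution B Y) (c : ℂ) :
    IsSolution B (c • Y) := fun x => by
  have := (hY x).const_smul c
  rwa [← B.act_smul] at this

theorem IsSolution.sum_smul {m : ℕ} {B : Coeff n} {Y : Fin m → ℝ → Fin n → ℂ}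
    (hY : ∀ j, IsSolution B (Y j)) (c : Fin m → ℂ) :
    IsSolution B fun x => ∑ j, c j • Y j x := fun x => by
  rw [B.act_sum_smul]
  exact HasDerivAt.fun_sum fun j _ => (hY j x).const_smul (c j)

theorem Coeff.Periodic.add_int {B : Coeff n} (hB : B.Periodic) (m : ℤ) (i j : Fin n) (x : ℝ) :
    B i j (x + m) = B i j x := by
  have : Function.Periodic (B i j) 1 := fun x => hB i j x
  simpa using this.int_mul m x

theorem IsSolution.comp_add_int {B : Coeff n} (hB : B.Periodic) {Y : ℝ → Fin n → ℂ}
    (hY : IsSolution B Y) (m : ℤ) : IsSolution B fun x => Y (x + m) := fun x => by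
  have := (hY (x + m)).comp_add_const x (m : ℝ)
  have e : B.act (x + m) (Y (x + m)) = B.act x (Y (x + m)) := by
    ext i; simp [Coeff.act, hB.add_int]
  rwa [e] at this

end Basic

/-! ### The monodromy matrix and the Evans function -/

section Volterra

/-- The weight `1 / cosh (K x)` as a bounded continuous function. -/
def sech (K : ℝ) : ℝ →ᵇ ℂ :=
  BoundedContinuousFunction.ofNormedAddCommGroup (fun x => ((Real.cosh (K * x))⁻¹ : ℝ))
    (Complex.continuous_ofReal.comp
      ((Real.continuous_cosh.comp (continuous_const.mul continuous_id)).inv₀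
        fun x => (Real.cosh_pos _).ne')) 1 (fun x => by
      rw [Complex.norm_real, Real.norm_eq_abs, abs_of_pos (inv_pos.2 (Real.cosh_pos _))]
      exact inv_le_one_of_one_le₀ (Real.one_le_cosh _))

theorem sech_apply (K x : ℝ) : sech K x = ((Real.cosh (K * x))⁻¹ : ℝ) := rfl

theorem norm_integral_cosh_mul_le {K : ℝ} (hK : 0 < K) (z : ℝ →ᵇ ℂ) (x : ℝ) :
    ‖∫ s in (0 : ℝ)..x, (Real.cosh (K * s) : ℂ) * z s‖ ≤ Real.cosh (K * x) / K * ‖z‖ := by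
  have hd : ∀ s : ℝ, HasDerivAt (fun s => Real.sinh (K * s) / K * ‖z‖)
      (Real.cosh (K * s) * ‖z‖) s := fun s => by
    have h1 : HasDerivAt (fun s : ℝ => K * s) K s := by simpa using (hasDerivAt_id s).const_mul K
    exact (((h1.sinh).div_const K).mul_const ‖z‖).congr_deriv (by
      rw [mul_div_assoc, div_self hK.ne', mul_one])
  have hcont : Continuous fun s : ℝ => Real.cosh (K * s) * ‖z‖ := by fun_prop
  have hint : ∀ a b : ℝ, ∫ s in a..b, Real.cosh (K * s) * ‖z‖
      = Real.sinh (K * b) / K * ‖z‖ - Real.sinh (K * a) / K * ‖z‖ := fun a b =>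
    intervalIntegral.integral_eq_sub_of_hasDerivAt (fun s _ => hd s)
      (hcont.intervalIntegrable _ _)
  have hle : ∀ s : ℝ, ‖(Real.cosh (K * s) : ℂ) * z s‖ ≤ Real.cosh (K * s) * ‖z‖ := fun s => by
    rw [norm_mul, Complex.norm_real, Real.norm_eq_abs, abs_of_pos (Real.cosh_pos _)]
    gcongr
    exact z.norm_coe_le_norm s
  have hs : |Real.sinh (K * x)| ≤ Real.cosh (K * x) := by
    rw [abs_le]
    constructor
    · rw [Real.sinh_eq, Real.cosh_eq]; linarith [Real.exp_pos (K * x)]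
    · exact (Real.sinh_lt_cosh _).le
  rcases le_total 0 x with h | h
  · refine (intervalIntegral.norm_integral_le_of_norm_le h (ae_of_all _ fun s _ => hle s)
      (hcont.intervalIntegrable _ _)).trans ?_
    rw [hint]
    simp only [mul_zero, Real.sinh_zero, zero_div, zero_mul, sub_zero]
    gcongr
    exact (le_abs_self _).trans hs
  · rw [intervalIntegral.integral_symm, norm_neg]
    refine (intervalIntegral.norm_integral_le_of_norm_le h (ae_of_all _ fun s _ => hle s)
      (hcont.intervalIntegrable _ _)).trans ?_
    rw [hint]
    simp only [mul_zero, Real.sinh_zero, zero_div, zero_mul, zero_sub]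
    rw [← neg_mul, ← neg_div]
    gcongr
    exact (neg_le_abs _).trans hs

theorem norm_sech_mul_integral_le {K : ℝ} (hK : 0 < K) (z : ℝ →ᵇ ℂ) (x : ℝ) :
    ‖sech K x * ∫ s in (0 : ℝ)..x, (Real.cosh (K * s) : ℂ) * z s‖ ≤ K⁻¹ * ‖z‖ := by
  have hc := Real.cosh_pos (K * x)
  rw [norm_mul, sech_apply, Complex.norm_real, Real.norm_eq_abs, abs_of_pos (inv_pos.2 hc)]
  calc _ ≤ (Real.cosh (K * x))⁻¹ * (Real.cosh (K * x) / K * ‖z‖) := by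
        gcongr; exact norm_integral_cosh_mul_le hK z x
    _ = K⁻¹ * ‖z‖ := by field_simp

/-- The weighted integration operator `z ↦ cosh(Kx)⁻¹ ∫₀ˣ cosh(Ks) z(s) ds` on bounded continuous
functions; its norm is at most `1 / K`. -/
def weightedIntegral (K : ℝ) (hK : 0 < K) : (ℝ →ᵇ ℂ) →L[ℂ] (ℝ →ᵇ ℂ) :=
  LinearMap.mkContinuous
    { toFun := fun z => BoundedContinuousFunction.ofNormedAddCommGroup
        (fun x => sech K x * ∫ s in (0 : ℝ)..x, (Real.cosh (K * s) : ℂ) * z s)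
        ((sech K).continuous.mul (intervalIntegral.continuous_primitive (fun a b =>
          Continuous.intervalIntegrable (by fun_prop) a b) 0)) (K⁻¹ * ‖z‖)
          (norm_sech_mul_integral_le hK z)
      map_add' := fun z w => by
        ext x
        change sech K x * _ = sech K x * _ + sech K x * _
        rw [← mul_add, ← intervalIntegral.integral_add]
        · simp only [BoundedContinuousFunction.coe_add, Pi.add_apply, mul_add]
        all_goals exact Continuous.intervalIntegrable (by fun_prop) _ _
      map_smul' := fun c z => by
        ext x
        change sech K x * _ = c * (sech K x * _)
        rw [mul_left_comm c, ← intervalIntegral.integral_const_mul c]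
        simp only [BoundedContinuousFunction.coe_smul, smul_eq_mul, mul_left_comm c] }
    K⁻¹ fun z => BoundedContinuousFunction.norm_ofNormedAddCommGroup_le _ (by positivity)
      fun x => norm_sech_mul_integral_le hK z x

theorem weightedIntegral_apply {K : ℝ} (hK : 0 < K) (z : ℝ →ᵇ ℂ) (x : ℝ) :
    weightedIntegral K hK z x
      = sech K x * ∫ s in (0 : ℝ)..x, (Real.cosh (K * s) : ℂ) * z s := rfl

theorem norm_weightedIntegral_le {K : ℝ} (hK : 0 < K) : ‖weightedIntegral K hK‖ ≤ K⁻¹ :=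
  LinearMap.mkContinuous_norm_le _ (by positivity) _

variable {n : ℕ}

/-- The Volterra operator of the system `Y' = B Y` in the weighted unknown `Z = Y / cosh(Kx)`,
as a continuous linear function of the coefficients. For `n ‖B‖ < K` it is a contraction, so that
its resolvent, and with it the flow, is holomorphic in `B`. -/
def volterra (n : ℕ) (K : ℝ) (hK : 0 < K) :
    Coeff n →L[ℂ] ((Fin n → (ℝ →ᵇ ℂ)) →L[ℂ] (Fin n → (ℝ →ᵇ ℂ))) :=
  ∑ i, ∑ j,
    ((ContinuousLinearMap.compL ℂ (Fin n → (ℝ →ᵇ ℂ)) (ℝ →ᵇ ℂ) (Fin n → (ℝ →ᵇ ℂ))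
        (ContinuousLinearMap.single ℂ (fun _ : Fin n => (ℝ →ᵇ ℂ)) i ∘L weightedIntegral K hK)) ∘L
      ((ContinuousLinearMap.compL ℂ (Fin n → (ℝ →ᵇ ℂ)) (ℝ →ᵇ ℂ) (ℝ →ᵇ ℂ)).flip
        (ContinuousLinearMap.proj (R := ℂ) (φ := fun _ : Fin n => (ℝ →ᵇ ℂ)) j)) ∘L
      ContinuousLinearMap.mul ℂ (ℝ →ᵇ ℂ)) ∘L
    (ContinuousLinearMap.proj (R := ℂ) (φ := fun _ : Fin n => (ℝ →ᵇ ℂ)) j ∘L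
      ContinuousLinearMap.proj (R := ℂ) (φ := fun _ : Fin n => Fin n → (ℝ →ᵇ ℂ)) i)

theorem volterra_apply {K : ℝ} (hK : 0 < K) (B : Coeff n) (Z : Fin n → (ℝ →ᵇ ℂ)) (i : Fin n) :
    volterra n K hK B Z i = ∑ j, weightedIntegral K hK (B i j * Z j) := by
  simp [volterra, Finset.sum_apply, Pi.single_apply]

theorem norm_volterra_le {K : ℝ} (hK : 0 < K) (B : Coeff n) :
    ‖volterra n K hK B‖ ≤ n * ‖B‖ / K := by
  refine ContinuousLinearMap.opNorm_le_bound _ (by positivity) fun Z => ?_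
  refine (pi_norm_le_iff_of_nonneg (by positivity)).2 fun i => ?_
  rw [volterra_apply]
  calc ‖∑ j, weightedIntegral K hK (B i j * Z j)‖ ≤ ∑ j : Fin n, K⁻¹ * (‖B‖ * ‖Z‖) := by
        refine norm_sum_le_of_le _ fun j _ => ?_
        refine ((weightedIntegral K hK).le_opNorm _).trans ?_
        gcongr
        · exact norm_weightedIntegral_le hK
        · refine (norm_mul_le _ _).trans ?_
          gcongr
          · exact (norm_le_pi_norm (B i) j).trans (norm_le_pi_norm B i)
          · exact norm_le_pi_norm Z j
    _ = n * ‖B‖ / K * ‖Z‖ := by simp; field_simp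

theorem isUnit_one_sub_volterra {K : ℝ} (hK : 0 < K) {B : Coeff n} (hB : n * ‖B‖ < K) :
    IsUnit (1 - volterra n K hK B) :=
  isUnit_one_sub_of_norm_lt_one (R := (Fin n → (ℝ →ᵇ ℂ)) →L[ℂ] (Fin n → (ℝ →ᵇ ℂ))) <|
    (norm_volterra_le hK B).trans_lt ((div_lt_one hK).2 hB)

/-- Solutions `Y = cosh(Kx) Z` of the integral equation `Y = G + ∫₀ˣ B Y` for data
`G = cosh(Kx) γ` of at most exponential growth. -/
theorem exists_integral_solution {K : ℝ} (hK : 0 < K) {B : Coeff n} (hB : n * ‖B‖ < K)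
    (γ : Fin n → (ℝ →ᵇ ℂ)) (Z : Fin n → (ℝ →ᵇ ℂ))
    (hZ : Z = Ring.inverse (1 - volterra n K hK B) γ) (x : ℝ) (i : Fin n) :
    (Real.cosh (K * x) : ℂ) * Z i x = (Real.cosh (K * x) : ℂ) * γ i x +
      ∫ s in (0 : ℝ)..x, B.act s (fun j => (Real.cosh (K * s) : ℂ) * Z j s) i := by
  have h1 : (1 - volterra n K hK B) Z = γ := by
    rw [hZ, ← mul_apply_eq_comp,
      Ring.mul_inverse_cancel _ (isUnit_one_sub_volterra hK hB), one_apply_eq_self]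
  have h2 : Z i x = γ i x + volterra n K hK B Z i x := by
    rw [← h1]; simp
  have hc : (Real.cosh (K * x) : ℂ) ≠ 0 := by exact_mod_cast (Real.cosh_pos _).ne'
  have h3 : volterra n K hK B Z i x = sech K x *
      ∫ s in (0 : ℝ)..x, B.act s (fun j => (Real.cosh (K * s) : ℂ) * Z j s) i := by
    have : volterra n K hK B Z i x = ∑ j, weightedIntegral K hK (B i j * Z j) x := by
      rw [volterra_apply]; simp
    rw [this]
    simp only [weightedIntegral_apply, Coeff.act]
    rw [← Finset.mul_sum, ← intervalIntegral.integral_finsetSum]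
    · simp only [BoundedContinuousFunction.coe_mul, Pi.mul_apply, mul_left_comm]
    · intro j _
      exact Continuous.intervalIntegrable (by fun_prop) _ _
  rw [h2, h3, mul_add, sech_apply, Complex.ofReal_inv, mul_inv_cancel_left₀ hc]

/-- The matrix of `Y 0 ↦ Y 1` for solutions of `Y' = B Y`. It is read off from the resolvent of the
Volterra operator, and has this meaning when `n ‖B‖ < K`; otherwise `Ring.inverse` may be `0`. -/
def monodromy (K : ℝ) (hK : 0 < K) (B : Coeff n) : Matrix (Fin n) (Fin n) ℂ :=
  Matrix.of fun i j =>
    (Real.cosh K : ℂ) * Ring.inverse (1 - volterra n K hK B) (Pi.single j (sech K)) i 1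

theorem exists_isSolution_single {K : ℝ} (hK : 0 < K) {B : Coeff n} (hB : n * ‖B‖ < K)
    (j : Fin n) : ∃ Y, IsSolution B Y ∧ Y 0 = Pi.single j 1 ∧
      ∀ i, Y 1 i = monodromy K hK B i j := by
  set Z := Ring.inverse (1 - volterra n K hK B) (Pi.single j (sech K)) with hZ
  set Y : ℝ → Fin n → ℂ := fun x i => (Real.cosh (K * x) : ℂ) * Z i x with hY
  have hYc : Continuous Y := by
    refine continuous_pi fun i => ?_
    simp only [hY]; fun_prop
  have hc : ∀ x, (Real.cosh (K * x) : ℂ) ≠ 0 := fun x => by exact_mod_cast (Real.cosh_pos _).ne'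
  have key : ∀ x i, Y x i = (Pi.single j 1 : Fin n → ℂ) i
      + ∫ s in (0 : ℝ)..x, B.act s (Y s) i := fun x i => by
    have := exists_integral_solution hK hB (Pi.single j (sech K)) Z hZ x i
    have e : (Real.cosh (K * x) : ℂ) * (Pi.single j (sech K) : Fin n → (ℝ →ᵇ ℂ)) i x
        = (Pi.single j 1 : Fin n → ℂ) i := by
      rcases eq_or_ne i j with rfl | h
      · simp only [Pi.single_eq_same, sech_apply, Complex.ofReal_inv, mul_inv_cancel₀ (hc x)]
      · simp [h]
    rw [e] at this
    exact this
  refine ⟨Y, fun x => ?_, ?_, fun i => ?_⟩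
  · refine hasDerivAt_pi.2 fun i => ?_
    have hcont : Continuous fun s => B.act s (Y s) i :=
      (continuous_apply i).comp (B.continuous_act hYc)
    have := (hcont.integral_hasStrictDerivAt 0 x).hasDerivAt.const_add
      ((Pi.single j 1 : Fin n → ℂ) i)
    exact this.congr_of_eventuallyEq (Eventually.of_forall fun y => key y i)
  · ext i; rw [key]; simp
  · simp [hY, monodromy, hZ]

theorem exists_isSolution_initial (B : Coeff n) (y : Fin n → ℂ) :
    ∃ Y, IsSolution B Y ∧ Y 0 = y := by
  have hK : (0 : ℝ) < n * ‖B‖ + 1 := by positivity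
  choose Y hY h0 _ using exists_isSolution_single hK (B := B) (lt_add_one _)
  refine ⟨fun x => ∑ j, y j • Y j x, IsSolution.sum_smul hY _, ?_⟩
  · ext i; simp [h0, Pi.single_apply]

theorem IsSolution.apply_one {K : ℝ} (hK : 0 < K) {B : Coeff n} (hB : n * ‖B‖ < K)
    {Y : ℝ → Fin n → ℂ} (hY : IsSolution B Y) : Y 1 = (monodromy K hK B).mulVec (Y 0) := by
  choose Z hZ h0 h1 using exists_isSolution_single hK hB
  have hs : IsSolution B fun x => ∑ j, Y 0 j • Z j x := IsSolution.sum_smul hZ _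
  have := hY.eq hs (x₀ := 0) (by ext i; simp [h0, Pi.single_apply])
  rw [this]
  ext i
  simp only [h0, h1, Finset.sum_apply, Pi.smul_apply, smul_eq_mul, Matrix.mulVec, dotProduct,
    Pi.single_apply]
  exact Finset.sum_congr rfl fun j _ => by simp [mul_comm]

/-- The Evans function `det (M(B) - ρ)`, with `M(B)` the monodromy matrix. -/
def evans (K : ℝ) (hK : 0 < K) (B : Coeff n) (ρ : ℂ) : ℂ :=
  (monodromy K hK B - ρ • (1 : Matrix (Fin n) (Fin n) ℂ)).det

/-- Zeros of the Evans function are the Floquet multipliers. -/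
theorem hasBloch_iff_evans {K : ℝ} (hK : 0 < K) {B : Coeff n} (hB : n * ‖B‖ < K)
    (hp : B.Periodic) (ρ : ℂ) :
    HasBloch B ρ ↔ evans K hK B ρ = 0 := by
  rw [evans, ← Matrix.exists_mulVec_eq_zero_iff]
  constructor
  · rintro ⟨Y, hY0, hY, hρ⟩
    refine ⟨Y 0, fun h => hY0 (hY.eq (IsSolution.zero B) (x₀ := 0) (by simpa using h)), ?_⟩
    rw [Matrix.sub_mulVec, ← hY.apply_one hK hB, Matrix.smul_mulVec, Matrix.one_mulVec,
      ← hρ 0, zero_add, sub_self]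
  · rintro ⟨y, hy0, hy⟩
    obtain ⟨Y, hY, rfl⟩ := exists_isSolution_initial B y
    refine ⟨Y, fun h => hy0 (by rw [h]; rfl), hY, ?_⟩
    rw [Matrix.sub_mulVec, ← hY.apply_one hK hB, Matrix.smul_mulVec, Matrix.one_mulVec,
      sub_eq_zero] at hy
    have h1 : IsSolution B fun x => Y (x + 1) := by simpa using hY.comp_add_int hp 1
    have := h1.eq (hY.smul ρ) (x₀ := 0) (by simpa using hy)
    exact fun x => congrFun this x

/-- The Evans function is jointly holomorphic in the coefficients and the multiplier. -/
theorem differentiableAt_evans {K : ℝ} (hK : 0 < K) {B : Coeff n} (hB : n * ‖B‖ < K) (ρ : ℂ) :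
    DifferentiableAt ℂ (fun p : Coeff n × ℂ => evans K hK p.1 p.2) (B, ρ) := by
  have hinv : DifferentiableAt ℂ (fun p : Coeff n × ℂ =>
      Ring.inverse (1 - volterra n K hK p.1)) (B, ρ) := by
    refine DifferentiableAt.comp (B, ρ) (g := Ring.inverse)
      (f := fun p : Coeff n × ℂ => 1 - volterra n K hK p.1)
      (differentiableAt_inverse (𝕜 := ℂ) (R := (Fin n → (ℝ →ᵇ ℂ)) →L[ℂ] (Fin n → (ℝ →ᵇ ℂ)))
        (isUnit_one_sub_volterra hK hB)) ?_
    exact (differentiableAt_const _).sub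
      ((volterra n K hK).differentiableAt.comp (B, ρ) differentiableAt_fst)
  have hentry : ∀ i j, DifferentiableAt ℂ (fun p : Coeff n × ℂ => monodromy K hK p.1 i j)
      (B, ρ) := fun i j => by
    have h1 := hinv.clm_apply (differentiableAt_const (Pi.single j (sech K)))
    have h2 := (BoundedContinuousFunction.evalCLM ℂ (β := ℂ) (1 : ℝ) ∘L
      ContinuousLinearMap.proj (R := ℂ) (φ := fun _ : Fin n => (ℝ →ᵇ ℂ)) i).differentiableAt.comp
      (B, ρ) h1
    exact h2.const_mul (Real.cosh K : ℂ)
  unfold evans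
  simp only [Matrix.det_apply', Matrix.sub_apply, Matrix.smul_apply]
  refine DifferentiableAt.fun_sum fun σ _ => DifferentiableAt.const_mul ?_ _
  exact (HasFDerivAt.finsetProd fun i _ =>
    ((hentry (σ i) i).sub (differentiableAt_snd.smul_const _)).hasFDerivAt).differentiableAt

attribute [irreducible] evans

end Volterra

/-! ### Persistence of Floquet multipliers -/

/-- Hurwitz's theorem: zeros of a holomorphic limit that does not vanish identically attract
zeros of the approximating functions. The proof applies the maximum principle to the reciprocals. -/
theorem eventually_exists_zero {ι : Type*} {l : Filter ι} {D : ι → ℂ → ℂ} {f : ℂ → ℂ} {U : Set ℂ}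
    (hU : IsOpen U) (hpre : IsPreconnected U) (hf : DifferentiableOn ℂ f U)
    (hD : ∀ᶠ i in l, DifferentiableOn ℂ (D i) U)
    (hlim : ∀ S ⊆ U, IsCompact S → TendstoUniformlyOn D f l S)
    {z₀ z₁ : ℂ} (h₀ : z₀ ∈ U) (hz₀ : f z₀ = 0) (h₁ : z₁ ∈ U) (hz₁ : f z₁ ≠ 0)
    {r : ℝ} (hr : 0 < r) : ∀ᶠ i in l, ∃ z ∈ Metric.ball z₀ r, D i z = 0 := by
  have han : AnalyticOnNhd ℂ f U := hf.analyticOnNhd hU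
  have hne : ∀ᶠ z in 𝓝[≠] z₀, f z ≠ 0 := by
    refine ((han z₀ h₀).eventually_eq_zero_or_eventually_ne_zero).resolve_left fun h => hz₁ ?_
    exact han.eqOn_zero_of_preconnected_of_eventuallyEq_zero hpre h₀ h h₁
  rw [eventually_nhdsWithin_iff, Metric.eventually_nhds_iff] at hne
  obtain ⟨δ, hδ, hne⟩ := hne
  obtain ⟨δ', hδ', hsub⟩ := Metric.isOpen_iff.1 hU z₀ h₀
  obtain ⟨s, hs0, hs⟩ : ∃ s > 0, s < min r (min δ δ') :=
    exists_between (lt_min hr (lt_min hδ hδ'))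
  obtain ⟨hsr, hs⟩ := lt_min_iff.1 hs
  obtain ⟨hsδ, hsδ'⟩ := lt_min_iff.1 hs
  have hcl : Metric.closedBall z₀ s ⊆ U := (Metric.closedBall_subset_ball hsδ').trans hsub
  have hsphere : ∀ z ∈ Metric.sphere z₀ s, f z ≠ 0 := fun z hz => by
    rw [Metric.mem_sphere] at hz
    refine hne (by rw [hz]; exact hsδ) fun h => ?_
    rw [h, dist_self] at hz
    exact hs0.ne hz
  obtain ⟨w, hw, hmin⟩ := (isCompact_sphere z₀ s).exists_isMinOn
    (NormedSpace.sphere_nonempty.2 hs0.le)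
    ((hf.continuousOn.mono (Metric.sphere_subset_closedBall.trans hcl)).norm)
  set m := ‖f w‖ with hm
  have hm0 : 0 < m := norm_pos_iff.2 (hsphere w hw)
  have hun := Metric.tendstoUniformlyOn_iff.1
    (hlim _ hcl (isCompact_closedBall z₀ s)) (m / 2) (half_pos hm0)
  filter_upwards [hD, hun] with i hDi hi
  by_contra! hno
  have hno' : ∀ z ∈ Metric.closedBall z₀ s, D i z ≠ 0 := fun z hz =>
    hno z (Metric.closedBall_subset_ball hsr hz)
  have hdiff : DiffContOnCl ℂ (fun z => (D i z)⁻¹) (Metric.ball z₀ s) := by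
    refine DifferentiableOn.diffContOnCl ?_
    rw [closure_ball z₀ hs0.ne']
    exact (hDi.mono hcl).inv hno'
  have hbd := Complex.norm_le_of_forall_mem_frontier_norm_le Metric.isBounded_ball hdiff
    (C := (m / 2)⁻¹) (fun z hz => by
      rw [frontier_ball z₀ hs0.ne'] at hz
      rw [norm_inv]
      gcongr
      have h1 : m ≤ ‖f z‖ := hmin hz
      have h2 := hi z (Metric.sphere_subset_closedBall hz)
      rw [dist_eq_norm] at h2
      have h3 : ‖f z‖ ≤ ‖f z - D i z‖ + ‖D i z‖ := by
        simpa using norm_add_le (f z - D i z) (D i z)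
      linarith) (subset_closure (Metric.mem_ball_self hs0))
  have h4 := hi z₀ (Metric.mem_closedBall_self hs0.le)
  rw [hz₀, dist_eq_norm, zero_sub, norm_neg] at h4
  rw [norm_inv, inv_le_inv₀ (norm_pos_iff.2 (hno' z₀ (Metric.mem_closedBall_self hs0.le)))
    (half_pos hm0)] at hbd
  linarith

theorem Coeff.Periodic.add_smul {n : ℕ} {B₀ B₁ : Coeff n} (h₀ : B₀.Periodic) (h₁ : B₁.Periodic)
    (z : ℂ) : Coeff.Periodic (B₀ + z • B₁) := fun i j x => by
  simp [h₀ i j x, h₁ i j x]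

/-- Continuity in the parameter is uniform over a compact set of the other variable. -/
theorem tendstoUniformlyOn_of_continuousOn {ι α β : Type*} [TopologicalSpace α]
    [TopologicalSpace β] {f : α → β → ℂ} {P : Set α} {S : Set β} (hS : IsCompact S)
    (hP : IsOpen P) (hf : ContinuousOn (Function.uncurry f) (P ×ˢ S)) {p : ι → α} {q : α}
    (hq : q ∈ P) {l : Filter ι} (hp : Tendsto p l (𝓝 q)) :
    TendstoUniformlyOn (fun i => f (p i)) (f q) l S := by
  rw [Metric.tendstoUniformlyOn_iff]
  intro ε hε
  obtain ⟨v, hv, h⟩ := hS.mem_uniformity_of_prod hf hq (Metric.dist_mem_uniformity hε)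
  rw [hP.nhdsWithin_eq hq] at hv
  filter_upwards [hp hv] with i hi z hz
  rw [dist_comm]
  exact h _ hi z hz

theorem norm_add_smul_lt {n : ℕ} {K R : ℝ} {A₀ A₁ : Coeff n} (h : n * (‖A₀‖ + R * ‖A₁‖) < K)
    {z : ℂ} (hz : z ∈ Metric.ball (0 : ℂ) R) : n * ‖A₀ + z • A₁‖ < K := by
  refine lt_of_le_of_lt (mul_le_mul_of_nonneg_left ?_ n.cast_nonneg) h
  refine (norm_add_le _ _).trans (add_le_add_right ?_ _)
  rw [norm_smul]
  exact mul_le_mul_of_nonneg_right (mem_ball_zero_iff.1 hz).le (norm_nonneg _)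

theorem differentiableOn_evans {n : ℕ} {K R : ℝ} (hK : 0 < K) {A₀ A₁ : Coeff n}
    (h : n * (‖A₀‖ + R * ‖A₁‖) < K) (τ : ℂ) :
    DifferentiableOn ℂ (fun z : ℂ => evans K hK (A₀ + z • A₁) τ) (Metric.ball 0 R) :=
  fun z hz => by
    have hg : DifferentiableAt ℂ (fun z : ℂ => (A₀ + z • A₁, τ)) z := by fun_prop
    exact (DifferentiableAt.comp (g := fun p : Coeff n × ℂ => evans K hK p.1 p.2) z
      (differentiableAt_evans hK (norm_add_smul_lt h hz) τ) hg).differentiableWithinAt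

theorem continuousOn_evans {n : ℕ} {K R : ℝ} (hK : 0 < K) {S : Set ℂ}
    (hS : S ⊆ Metric.ball (0 : ℂ) R) :
    ContinuousOn (Function.uncurry fun (p : Coeff n × Coeff n × ℂ) (z : ℂ) =>
      evans K hK (p.1 + z • p.2.1) p.2.2)
      ({p | n * (‖p.1‖ + R * ‖p.2.1‖) < K} ×ˢ S) := by
  rintro ⟨p, z⟩ ⟨hp, hz⟩
  have hg : Continuous fun p : (Coeff n × Coeff n × ℂ) × ℂ =>
    (p.1.1 + p.2 • p.1.2.1, p.1.2.2) := by fun_prop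
  have he : ContinuousAt (fun p : Coeff n × ℂ => evans K hK p.1 p.2)
      (p.1 + z • p.2.1, p.2.2) :=
    (differentiableAt_evans hK (norm_add_smul_lt hp (hS hz)) p.2.2).continuousAt
  exact (ContinuousAt.comp (x := (p, z)) (g := fun p : Coeff n × ℂ => evans K hK p.1 p.2) he
    hg.continuousAt).continuousWithinAt

/-- Persistence of Floquet multipliers for pencils `B₀ + Λ B₁` under perturbation of the
coefficients and of the multiplier: the Evans function is holomorphic in `Λ` and depends
continuously on everything else. -/
theorem HasBloch.eventually_exists {ι : Type*} {l : Filter ι} {n : ℕ} {B₀ B₁ : ι → Coeff n}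
    {C₀ C₁ : Coeff n} {ρ : ι → ℂ} {σ : ℂ} (h₀ : Tendsto B₀ l (𝓝 C₀)) (h₁ : Tendsto B₁ l (𝓝 C₁))
    (hρ : Tendsto ρ l (𝓝 σ)) (hp₀ : ∀ᶠ i in l, (B₀ i).Periodic)
    (hp₁ : ∀ᶠ i in l, (B₁ i).Periodic)
    (hq₀ : C₀.Periodic) (hq₁ : C₁.Periodic) {z₀ z₁ : ℂ} (hz₀ : HasBloch (C₀ + z₀ • C₁) σ)
    (hz₁ : ¬ HasBloch (C₀ + z₁ • C₁) σ) {r : ℝ} (hr : 0 < r) :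
    ∀ᶠ i in l, ∃ z ∈ Metric.ball z₀ r, HasBloch (B₀ i + z • B₁ i) (ρ i) := by
  -- the weight `K` is large enough for all coefficients near the limit and all `Λ` with `‖Λ‖ < R`
  set R : ℝ := ‖z₀‖ + ‖z₁‖ + r with hR
  set K : ℝ := n * (‖C₀‖ + R * ‖C₁‖) + 1 with hKdef
  have hK : 0 < K := by positivity
  have hC : n * (‖C₀‖ + R * ‖C₁‖) < K := lt_add_one _
  set P : Set (Coeff n × Coeff n × ℂ) := {p | n * (‖p.1‖ + R * ‖p.2.1‖) < K} with hP
  have hPo : IsOpen P := isOpen_lt (by fun_prop) continuous_const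
  have hlimP : Tendsto (fun i => (B₀ i, B₁ i, ρ i)) l (𝓝 (C₀, C₁, σ)) :=
    h₀.prodMk_nhds (h₁.prodMk_nhds hρ)
  have hCP : (C₀, C₁, σ) ∈ P := hC
  have hev : ∀ᶠ i in l, (B₀ i, B₁ i, ρ i) ∈ P := hlimP.eventually_mem (hPo.mem_nhds hCP)
  have key := eventually_exists_zero (l := l) (D := fun i z => evans K hK (B₀ i + z • B₁ i) (ρ i))
    (f := fun z => evans K hK (C₀ + z • C₁) σ) (U := Metric.ball 0 R) Metric.isOpen_ball
    (convex_ball _ _).isPreconnected (differentiableOn_evans hK hC σ)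
    (hev.mono fun i hi => differentiableOn_evans hK hi _)
    (fun S hSU hS => ?_) (z₀ := z₀) (z₁ := z₁)
    (mem_ball_zero_iff.2 (by rw [hR]; linarith [norm_nonneg z₁]))
    ((hasBloch_iff_evans hK (norm_add_smul_lt hC
      (mem_ball_zero_iff.2 (by rw [hR]; linarith [norm_nonneg z₁])))
      (hq₀.add_smul hq₁ _) σ).1 hz₀)
    (mem_ball_zero_iff.2 (by rw [hR]; linarith [norm_nonneg z₀]))
    (fun h => hz₁ ((hasBloch_iff_evans hK (norm_add_smul_lt hC
      (mem_ball_zero_iff.2 (by rw [hR]; linarith [norm_nonneg z₀])))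
      (hq₀.add_smul hq₁ _) σ).2 h))
    (r := min r (R - ‖z₀‖)) ?_
  · filter_upwards [key, hev, hp₀, hp₁] with i ⟨z, hz, h⟩ hi hp hp'
    refine ⟨z, Metric.ball_subset_ball (min_le_left _ _) hz, ?_⟩
    refine (hasBloch_iff_evans hK (norm_add_smul_lt hi ?_) (hp.add_smul hp' z) _).2 h
    have h1 := Metric.ball_subset_ball (min_le_right _ _) hz
    rw [mem_ball_iff_norm] at h1
    rw [mem_ball_zero_iff]
    have := norm_add_le (z - z₀) z₀
    rw [sub_add_cancel] at this
    linarith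
  · exact tendstoUniformlyOn_of_continuousOn hS hPo (continuousOn_evans hK hSU) hCP hlimP
  · refine lt_min hr ?_
    rw [hR]; linarith [norm_nonneg z₁]

/-! ### Weak derivatives and primitives -/

/-- `G` is a primitive of the locally integrable function `g`: the absolutely continuous
representative of a weakly differentiable function. -/
def HasIntegralDeriv (G g : ℝ → ℂ) : Prop :=
  LocallyIntegrable g volume ∧ ∀ x, G x = G 0 + ∫ t in (0 : ℝ)..x, g t

section IntegralDeriv

variable {G g f : ℝ → ℂ}

theorem HasIntegralDeriv.intervalIntegrable (h : HasIntegralDeriv G g) (a b : ℝ) :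
    IntervalIntegrable g volume a b :=
  (h.1.integrableOn_isCompact isCompact_uIcc).intervalIntegrable

theorem HasIntegralDeriv.continuous (h : HasIntegralDeriv G g) : Continuous G := by
  rw [funext h.2]
  exact continuous_const.add (intervalIntegral.continuous_primitive h.intervalIntegrable 0)

theorem HasIntegralDeriv.sub_eq (h : HasIntegralDeriv G g) (a b : ℝ) :
    G b - G a = ∫ t in a..b, g t := by
  rw [h.2 b, h.2 a, add_sub_add_left_eq_sub, intervalIntegral.integral_interval_sub_left
    (h.intervalIntegrable _ _) (h.intervalIntegrable _ _)]

theorem HasIntegralDeriv.absolutelyContinuous (h : HasIntegralDeriv G g) (a b : ℝ) :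
    AbsolutelyContinuousOnInterval G a b := by
  have hi := h.intervalIntegrable a b
  have hre : IntervalIntegrable (fun t => (g t).re) volume a b := ⟨hi.1.re, hi.2.re⟩
  have him : IntervalIntegrable (fun t => (g t).im) volume a b := ⟨hi.1.im, hi.2.im⟩
  have hconst : ∀ c : ℂ, AbsolutelyContinuousOnInterval (fun _ : ℝ => c) a b := fun c =>
    (LipschitzWith.const c).lipschitzOnWith.absolutelyContinuousOnInterval
  have h1 := (hre.absolutelyContinuousOnInterval_intervalIntegral (c := a)
    Set.left_mem_uIcc).smul (hconst 1)
  have h2 := (him.absolutelyContinuousOnInterval_intervalIntegral (c := a)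
    Set.left_mem_uIcc).smul (hconst Complex.I)
  have h3 := (hconst (G a)).add (h1.add h2)
  refine (congrArg (fun F => AbsolutelyContinuousOnInterval F a b) ?_).mpr h3
  funext x
  have e := h.sub_eq a x
  have e1 := Complex.reCLM.intervalIntegral_comp_comm (h.intervalIntegrable a x)
  have e2 := Complex.imCLM.intervalIntegral_comp_comm (h.intervalIntegrable a x)
  simp only [Complex.reCLM_apply, Complex.imCLM_apply] at e1 e2
  simp only [Pi.add_apply, Pi.smul_apply', e1, e2, ← e, Complex.real_smul]
  linear_combination - Complex.re_add_im (G x - G a)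

theorem HasIntegralDeriv.ae_hasDerivAt (h : HasIntegralDeriv G g) :
    ∀ᵐ x, HasDerivAt G (g x) x := by
  filter_upwards [_root_.LocallyIntegrable.ae_hasDerivAt_integral h.1] with x hx
  have := (hx 0).const_add (G 0)
  rwa [← funext h.2] at this

/-- A function that is absolutely continuous on bounded intervals is a primitive of its almost
everywhere derivative. -/
theorem HasIntegralDeriv.of_ae_hasDerivAt (hac : ∀ a b, AbsolutelyContinuousOnInterval G a b)
    (hg : LocallyIntegrable g volume) (hd : ∀ᵐ x, HasDerivAt G (g x) x) :
    HasIntegralDeriv G g := by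
  refine ⟨hg, fun x => ?_⟩
  set I : ℝ → ℂ := fun y => ∫ t in (0 : ℝ)..y, g t with hI
  have hI0 : HasIntegralDeriv I g := ⟨hg, fun y => by simp [hI]⟩
  obtain ⟨C, hC⟩ := ((hac 0 x).sub (hI0.absolutelyContinuous 0 x)).const_of_ae_hasDerivAt_zero (by
    filter_upwards [hd, hI0.ae_hasDerivAt] with y h1 h2 _
    simpa using h1.sub h2)
  have h1 := hC 0 (by simp)
  have h2 := hC x (by simp)
  simp only [Pi.sub_apply] at h1 h2
  have h3 : I 0 = 0 := by simp [hI]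
  rw [h3, sub_zero] at h1
  rw [h1, ← h2, sub_add_cancel]

theorem HasIntegralDeriv.of_hasDerivAt (h : ∀ x, HasDerivAt G (g x) x) (hg : Continuous g) :
    HasIntegralDeriv G g :=
  ⟨hg.locallyIntegrable, fun x => by
    rw [intervalIntegral.integral_eq_sub_of_hasDerivAt (fun t _ => h t)
      (hg.intervalIntegrable _ _)]; ring⟩

theorem HasIntegralDeriv.congr (h : HasIntegralDeriv G g) {g' : ℝ → ℂ} (hg : g =ᵐ[volume] g') :
    HasIntegralDeriv G g' :=
  ⟨h.1.congr hg, fun x => by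
    rw [h.2 x, intervalIntegral.integral_congr_ae (hg.mono fun _ h _ => h)]⟩

theorem HasIntegralDeriv.add {H k : ℝ → ℂ} (h : HasIntegralDeriv G g) (h' : HasIntegralDeriv H k) :
    HasIntegralDeriv (fun x => G x + H x) fun x => g x + k x :=
  ⟨h.1.add h'.1, fun x => by
    beta_reduce
    rw [h.2 x, h'.2 x, intervalIntegral.integral_add (h.intervalIntegrable _ _)
      (h'.intervalIntegrable _ _)]; ring⟩

/-- The product rule for a `C¹` factor. -/
theorem HasIntegralDeriv.mul {w w' : ℝ → ℂ} (h : HasIntegralDeriv G g)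
    (hw : ∀ x, HasDerivAt w (w' x) x) (hw' : Continuous w') :
    HasIntegralDeriv (fun x => w x * G x) fun x => w' x * G x + w x * g x := by
  have hwc : Continuous w := continuous_iff_continuousAt.2 fun x => (hw x).continuousAt
  have hwi := HasIntegralDeriv.of_hasDerivAt hw hw'
  refine HasIntegralDeriv.of_ae_hasDerivAt (fun a b => ?_) ?_ ?_
  · exact (hwi.absolutelyContinuous a b).smul (h.absolutelyContinuous a b)
  · refine ((hw'.mul h.continuous).locallyIntegrable).add ?_
    exact (h.1.continuous_smul hwc :)
  · filter_upwards [h.ae_hasDerivAt] with x hx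
    exact (hw x).mul hx

theorem HasIntegralDeriv.const_mul (h : HasIntegralDeriv G g) (c : ℂ) :
    HasIntegralDeriv (fun x => c * G x) fun x => c * g x := by
  simpa using h.mul (w := fun _ => c) (w' := fun _ => 0) (fun x => hasDerivAt_const x c)
    continuous_const

theorem HasIntegralDeriv.sub {H k : ℝ → ℂ} (h : HasIntegralDeriv G g) (h' : HasIntegralDeriv H k) :
    HasIntegralDeriv (fun x => G x - H x) fun x => g x - k x := by
  simpa [sub_eq_add_neg] using h.add (h'.const_mul (-1))

theorem exists_support_subset_Ioc {φ : ℝ → ℝ} (hφ : HasCompactSupport φ) :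
    ∃ R : ℝ, 0 < R ∧ tsupport φ ⊆ Set.Ioo (-R) R := by
  obtain ⟨R, hR⟩ := hφ.isBounded.subset_ball_lt 0 0
  refine ⟨R, hR.1, fun x hx => ?_⟩
  have := hR.2 hx
  rwa [Real.ball_eq_Ioo, zero_sub, zero_add] at this

/-- Integration by parts: a primitive is weakly differentiable. -/
theorem HasIntegralDeriv.hasWeakDeriv (h : HasIntegralDeriv G g) (hf : f =ᵐ[volume] G) :
    HasWeakDeriv f g := by
  refine ⟨h.continuous.locallyIntegrable.congr hf.symm, h.1, fun φ hφ hc => ?_⟩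
  obtain ⟨R, hR, hsub⟩ := exists_support_subset_Ioc hc
  have hφ1 : ContDiff ℝ 1 φ := hφ.of_le (by exact_mod_cast le_top)
  have hφc : Continuous φ := hφ.continuous
  have hφ' : Continuous (deriv φ) := hφ1.continuous_deriv le_rfl
  have hd : ∀ x, HasDerivAt (fun x => (φ x : ℂ)) ((deriv φ x : ℝ) : ℂ) x := fun x =>
    ((hφ1.differentiable (by simp)) x).hasDerivAt.ofReal_comp
  have hp := (h.mul hd (Complex.continuous_ofReal.comp hφ')).sub_eq (-R) R
  have hout : ∀ x, x ∉ Set.Ioo (-R) R → φ x = 0 := fun x hx =>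
    image_eq_zero_of_notMem_tsupport fun h => hx (hsub h)
  rw [hout R (by simp), hout (-R) (by simp)] at hp
  rw [intervalIntegral.integral_add] at hp
  · have e1 : ∫ t in -R..R, ((deriv φ t : ℝ) : ℂ) * G t = ∫ t, ((deriv φ t : ℝ) : ℂ) * f t := by
      rw [intervalIntegral.integral_eq_integral_of_support_subset]
      · exact integral_congr_ae (hf.mono fun x hx => by simp only [hx])
      · intro x hx
        have hx' : deriv φ x ≠ 0 := fun h0 => hx (by simp [h0])
        exact Set.Ioo_subset_Ioc_self (hsub (support_deriv_subset hx'))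
    have e2 : ∫ t in -R..R, ((φ t : ℝ) : ℂ) * g t = ∫ t, ((φ t : ℝ) : ℂ) * g t := by
      rw [intervalIntegral.integral_eq_integral_of_support_subset]
      intro x hx
      have hx' : φ x ≠ 0 := fun h0 => hx (by simp [h0])
      exact Set.Ioo_subset_Ioc_self (hsub (subset_tsupport φ hx'))
    rw [e1, e2] at hp
    simp only [Complex.ofReal_zero, zero_mul, sub_self] at hp
    exact eq_neg_of_add_eq_zero_left hp.symm
  · exact ((Complex.continuous_ofReal.comp hφ').mul h.continuous).intervalIntegrable _ _
  · exact (h.intervalIntegrable _ _).continuousOn_mul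
      (Complex.continuous_ofReal.comp hφc).continuousOn

/-- A smooth compactly supported function of mean zero is the derivative of such a function. -/
theorem exists_deriv_eq_of_integral_eq_zero {ψ : ℝ → ℝ} (hψ : ContDiff ℝ (⊤ : ℕ∞) ψ)
    (hc : HasCompactSupport ψ) (h0 : ∫ x, ψ x = 0) :
    ∃ φ : ℝ → ℝ, ContDiff ℝ (⊤ : ℕ∞) φ ∧ HasCompactSupport φ ∧ deriv φ = ψ := by
  obtain ⟨R, hR, hsub⟩ := exists_support_subset_Ioc hc
  have hout : ∀ x, x ∉ Set.Ioo (-R) R → ψ x = 0 := fun x hx =>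
    image_eq_zero_of_notMem_tsupport fun h => hx (hsub h)
  set φ : ℝ → ℝ := fun x => ∫ t in (-R)..x, ψ t with hφ
  have hd : ∀ x, HasDerivAt φ (ψ x) x := fun x =>
    (hψ.continuous.integral_hasStrictDerivAt (-R) x).hasDerivAt
  have hderiv : deriv φ = ψ := funext fun x => (hd x).deriv
  refine ⟨φ, ?_, ?_, hderiv⟩
  · refine contDiff_infty_iff_deriv.2 ⟨fun x => (hd x).differentiableAt, ?_⟩
    rw [hderiv]; exact hψ
  · refine HasCompactSupport.intro (isCompact_Icc (a := -R) (b := R)) fun x hx => ?_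
    rw [Set.mem_Icc, not_and_or, not_le, not_le] at hx
    rcases hx with hx | hx
    · refine (intervalIntegral.integral_congr fun t ht => hout t fun h => ?_).trans
        intervalIntegral.integral_zero
      rw [Set.uIcc_of_ge hx.le] at ht
      exact absurd ht.2 (not_le.2 h.1)
    · have : ∫ t in (-R)..x, ψ t = ∫ t, ψ t :=
        intervalIntegral.integral_eq_integral_of_support_subset fun t ht => by
          have := hsub (subset_tsupport ψ ht)
          exact ⟨this.1, this.2.le.trans hx.le⟩
      rw [hφ]; simp only; rw [this, h0]

/-- Du Bois-Reymond's lemma: a weakly differentiable function agrees almost everywhere with a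
primitive of its weak derivative. -/
theorem exists_hasIntegralDeriv (h : HasWeakDeriv f g) :
    ∃ G, f =ᵐ[volume] G ∧ HasIntegralDeriv G g := by
  obtain ⟨hf, hg, hfg⟩ := h
  set I : ℝ → ℂ := fun y => ∫ t in (0 : ℝ)..y, g t with hI
  have hI0 : HasIntegralDeriv I g := ⟨hg, fun y => by simp [hI]⟩
  have hIw := hI0.hasWeakDeriv (ae_eq_refl I)
  have mulint : ∀ {u : ℝ → ℂ}, LocallyIntegrable u volume → ∀ {φ : ℝ → ℝ}, Continuous φ →
      HasCompactSupport φ → Integrable fun x => ((φ x : ℝ) : ℂ) * u x := fun hu φ hφ hc => by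
    have := hu.integrable_smul_left_of_hasCompactSupport hφ hc
    simpa using this
  set u : ℝ → ℂ := fun x => f x - I x with hu
  have hul : LocallyIntegrable u volume := hf.sub hI0.continuous.locallyIntegrable
  have hu0 : ∀ φ : ℝ → ℝ, ContDiff ℝ (⊤ : ℕ∞) φ → HasCompactSupport φ →
      ∫ x, ((deriv φ x : ℝ) : ℂ) * u x = 0 := fun φ hφ hc => by
    have hφ' : Continuous (deriv φ) :=
      (hφ.of_le (by exact_mod_cast le_top : (1 : WithTop ℕ∞) ≤ _)).continuous_deriv le_rfl
    simp only [hu, mul_sub]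
    rw [integral_sub (mulint hf hφ' hc.deriv) (mulint hIw.1 hφ' hc.deriv),
      hfg φ hφ hc, hIw.2.2 φ hφ hc, sub_self]
  let η₀ : ContDiffBump (0 : ℝ) := default
  set η : ℝ → ℝ := η₀.normed volume with hη
  have hηs : ContDiff ℝ (⊤ : ℕ∞) η := η₀.contDiff_normed
  have hηc : HasCompactSupport η := η₀.hasCompactSupport_normed
  have hη1 : ∫ x, η x = 1 := η₀.integral_normed
  set c : ℂ := ∫ x, ((η x : ℝ) : ℂ) * u x with hc
  have hae : ∀ᵐ x, u x - c = 0 := by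
    -- subtracting a multiple of `η` gives a test function of mean zero, hence a derivative
    refine ae_eq_zero_of_integral_contDiff_smul_eq_zero
      (hul.sub (continuous_const.locallyIntegrable)) fun ψ hψ hψc => ?_
    set m : ℝ := ∫ x, ψ x with hm
    have hψi : Integrable ψ := hψ.continuous.integrable_of_hasCompactSupport hψc
    have hηi : Integrable η := hηs.continuous.integrable_of_hasCompactSupport hηc
    obtain ⟨φ, hφ, hφc, hφd⟩ := exists_deriv_eq_of_integral_eq_zero
      (ψ := fun x => ψ x - m * η x) (hψ.sub (contDiff_const.mul hηs))
      (hψc.sub (hηc.mul_left (f := fun _ => m))) (by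
        rw [integral_sub hψi (hηi.const_mul m), integral_const_mul, hη1, mul_one, sub_self])
    have h1 := hu0 φ hφ hφc
    rw [hφd] at h1
    have i1 := mulint hul hψ.continuous hψc
    have i2 := mulint hul hηs.continuous hηc
    have e1 : (fun x => (((ψ x - m * η x : ℝ)) : ℂ) * u x)
        = fun x => ((ψ x : ℝ) : ℂ) * u x - (m : ℂ) * (((η x : ℝ) : ℂ) * u x) := by
      funext x; push_cast; ring
    rw [e1, integral_sub i1 (i2.const_mul _), integral_const_mul, ← hc] at h1
    have e2 : (fun x => ψ x • (u x - c)) = fun x => ((ψ x : ℝ) : ℂ) * u x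
        - ((ψ x : ℝ) : ℂ) * c := by
      funext x; rw [Complex.real_smul, mul_sub]
    have i3 : Integrable fun x => ((ψ x : ℝ) : ℂ) * c := (hψi.ofReal (𝕜 := ℂ)).mul_const c
    rw [e2, integral_sub i1 i3, integral_mul_const]
    have e3 : ∫ x, ((ψ x : ℝ) : ℂ) = (m : ℂ) := integral_ofReal
    rw [e3]; exact h1
  refine ⟨fun x => c + I x, ?_, hg, fun x => ?_⟩
  · filter_upwards [hae] with x hx
    have : f x - I x - c = 0 := hx
    rw [← sub_eq_zero, ← this]; ring
  · simp [hI]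

theorem hasWeakDeriv_of_hasDerivAt (h : ∀ x, HasDerivAt G (g x) x) (hg : Continuous g)
    (hf : f =ᵐ[volume] G) {g' : ℝ → ℂ} (hg' : g' =ᵐ[volume] g) : HasWeakDeriv f g' :=
  ((HasIntegralDeriv.of_hasDerivAt h hg).congr hg'.symm).hasWeakDeriv hf

end IntegralDeriv

/-! ### Difference equations in square summable sequences -/

open Polynomial in
/-- If `T` commutes with `S` and `p(T) = 0`, then `S - T` divides `p(S)`; so it is invertible when
no root of `p` lies in the spectrum of `S`. -/
theorem isUnit_sub_of_aeval_eq_zero {R : Type*} [Ring R] [Algebra ℂ R] {S T : R}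
    (hST : Commute S T) {p : ℂ[X]} (hp : p ≠ 0) (hT : aeval T p = 0)
    (hS : ∀ z ∈ spectrum ℂ S, p.eval z ≠ 0) : IsUnit (S - T) := by
  have key : ∀ p : ℂ[X], ∃ Q, Commute (S - T) Q ∧ aeval S p - aeval T p = (S - T) * Q := by
    intro p
    induction p using Polynomial.induction_on' with
    | add p q hp hq =>
      obtain ⟨Q, hQ, hpQ⟩ := hp
      obtain ⟨Q', hQ', hqQ⟩ := hq
      refine ⟨Q + Q', hQ.add_right hQ', ?_⟩
      rw [mul_add, ← hpQ, ← hqQ, map_add, map_add]; abel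
    | monomial k a =>
      refine ⟨a • ∑ i ∈ Finset.range k, S ^ i * T ^ (k - 1 - i), ?_, ?_⟩
      · refine Commute.smul_right (Commute.sum_right _ _ _ fun i _ => ?_) a
        have h1 : Commute (S - T) S := (Commute.refl S).sub_left hST.symm
        have h2 : Commute (S - T) T := hST.sub_left (Commute.refl T)
        exact (h1.pow_right i).mul_right (h2.pow_right _)
      · rw [mul_smul_comm, hST.mul_geom_sum₂]
        simp [aeval_monomial, Algebra.smul_def, mul_sub]
  obtain ⟨Q, hQ, hpQ⟩ := key p
  have hu : IsUnit (aeval S p) := by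
    have h1 := (IsAlgClosed.splits p).eq_prod_roots
    rw [h1, map_mul, aeval_C]
    refine IsUnit.mul ((Ne.isUnit (leadingCoeff_ne_zero.2 hp)).map (algebraMap ℂ R)) ?_
    by_contra hno
    obtain ⟨z, hz, hz'⟩ := spectrum.exists_mem_of_not_isUnit_aeval_prod hno
    exact hS z hz hz'
  rw [hT, sub_zero] at hpQ
  rw [hpQ, hQ.isUnit_mul_iff] at hu
  exact hu.1

/-- An invertible element with `‖u‖ ≤ 1` and `‖u⁻¹‖ ≤ 1` has its spectrum on the unit circle. -/
theorem norm_eq_one_of_mem_spectrum {R : Type*} [NormedRing R] [NormedAlgebra ℂ R]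
    [CompleteSpace R] [NormOneClass R] (u : Rˣ) (h1 : ‖(u : R)‖ ≤ 1) (h2 : ‖(↑u⁻¹ : R)‖ ≤ 1) {z : ℂ}
    (hz : z ∈ spectrum ℂ (u : R)) : ‖z‖ = 1 := by
  refine le_antisymm ((spectrum.norm_le_norm_of_mem hz).trans h1) ?_
  have hz0 : z ≠ 0 := by
    rintro rfl
    exact spectrum.zero_notMem ℂ u.isUnit hz
  have h3 : (Units.mk0 z hz0 : ℂˣ)⁻¹.val ∈ spectrum ℂ (↑u⁻¹ : R) :=
    (spectrum.inv_mem_iff (r := Units.mk0 z hz0)).1 hz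
  have h4 := (spectrum.norm_le_norm_of_mem h3).trans h2
  rw [Units.val_inv_eq_inv_val, Units.val_mk0, norm_inv] at h4
  exact (inv_le_one₀ (norm_pos_iff.2 hz0)).1 h4

theorem norm_toLp_sq {α E : Type*} [MeasurableSpace α] {μ : Measure α} [NormedAddCommGroup E]
    {f : α → E} (hf : MemLp f 2 μ) : ‖hf.toLp f‖ ^ 2 = ∫ x, ‖f x‖ ^ 2 ∂μ := by
  rw [Lp.norm_toLp, hf.eLpNorm_eq_integral_rpow_norm (by simp) (by simp),
    ENNReal.toReal_ofReal (by positivity), ← Real.rpow_natCast, ← Real.rpow_mul (by positivity)]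
  simp

section Sequences

variable {n : ℕ}

theorem memLp_count_iff_summable {e : ℤ → Fin n → ℂ} :
    MemLp e 2 Measure.count ↔ Summable fun m => ‖e m‖ ^ 2 := by
  rw [memLp_two_iff_integrable_sq_norm (by fun_prop), integrable_count_iff]
  simp

theorem integral_count_eq_tsum (u : ℤ → ℝ) (hu : Summable u) (h0 : ∀ m, 0 ≤ u m) :
    ∫ m, u m ∂Measure.count = ∑' m, u m := by
  rw [integral_countable (integrable_count_iff.2 (by simpa [abs_of_nonneg (h0 _)] using hu))]
  simp [measureReal_def]

theorem eq_of_ae_count {β : Type*} {f g : ℤ → β} (h : f =ᵐ[Measure.count] g) : f = g := by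
  have : ∀ᵐ m ∂(Measure.count : Measure ℤ), f m = g m := h
  rw [ae_iff, Measure.count_eq_zero_iff] at this
  funext m
  by_contra hm
  exact Set.notMem_empty m (this ▸ hm)

/-- Square summable vector sequences on `ℤ`. -/
abbrev SeqL2 (n : ℕ) : Type := Lp (Fin n → ℂ) 2 (Measure.count : Measure ℤ)

/-- Translation by `m` on square summable sequences. -/
def shift (n : ℕ) (m : ℤ) : SeqL2 n →L[ℂ] SeqL2 n :=
  (Lp.compMeasurePreservingₗᵢ ℂ (fun i : ℤ => i + m)
    (measurePreserving_add_right Measure.count m)).toContinuousLinearMap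

theorem shift_apply (m : ℤ) (e : SeqL2 n) (i : ℤ) : shift n m e i = e (i + m) :=
  congrFun (eq_of_ae_count (Lp.coeFn_compMeasurePreserving e
    (measurePreserving_add_right Measure.count m))) i

theorem SeqL2.ext {e e' : SeqL2 n} (h : ∀ i, e i = e' i) : e = e' :=
  Lp.ext (ae_of_all _ h)

theorem shift_mul_neg (m : ℤ) : shift n m * shift n (-m) = 1 := by
  ext1 e
  refine SeqL2.ext fun i => ?_
  change shift n m (shift n (-m) e) i = e i
  rw [shift_apply, shift_apply, add_neg_cancel_right]

/-- A matrix acting termwise on square summable sequences. -/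
def seqMul (n : ℕ) : Matrix (Fin n) (Fin n) ℂ →ₐ[ℂ] (SeqL2 n →L[ℂ] SeqL2 n) :=
  AlgHom.ofLinearMap
    ((ContinuousLinearMap.compLpL₂ 2 (Measure.count : Measure ℤ)
      (ContinuousLinearMap.id ℂ ((Fin n → ℂ) →L[ℂ] (Fin n → ℂ)))).toLinearMap ∘ₗ
      LinearMap.toContinuousLinearMap.toLinearMap ∘ₗ Matrix.toLin'.toLinearMap)
    (by
      ext1 e
      refine SeqL2.ext fun i => ?_
      have := congrFun (eq_of_ae_count (ContinuousLinearMap.coeFn_compLp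
        (LinearMap.toContinuousLinearMap (Matrix.toLin' (1 : Matrix (Fin n) (Fin n) ℂ))) e)) i
      refine this.trans ?_
      simp)
    (fun A B => by
      ext1 e
      refine SeqL2.ext fun i => ?_
      have h := fun (A : Matrix (Fin n) (Fin n) ℂ) (e : SeqL2 n) (i : ℤ) =>
        congrFun (eq_of_ae_count (ContinuousLinearMap.coeFn_compLp
        (LinearMap.toContinuousLinearMap (Matrix.toLin' A)) e)) i
      refine (h (A * B) e i).trans ?_
      refine Eq.trans ?_ ((h A _ i).trans (congrArg _ (h B e i))).symm
      simp)

theorem seqMul_apply (A : Matrix (Fin n) (Fin n) ℂ) (e : SeqL2 n) (i : ℤ) :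
    seqMul n A e i = A.mulVec (e i) :=
  congrFun (eq_of_ae_count (ContinuousLinearMap.coeFn_compLp
        (LinearMap.toContinuousLinearMap (Matrix.toLin' A)) e)) i

/-- The shift has its spectrum on the unit circle, where the characteristic polynomial of `M` has
no zero; the Cayley-Hamilton theorem gives the claim. -/
theorem isUnit_shift_sub_seqMul {M : Matrix (Fin n) (Fin n) ℂ}
    (hM : ∀ ρ : ℂ, ‖ρ‖ = 1 → (M - ρ • (1 : Matrix (Fin n) (Fin n) ℂ)).det ≠ 0) :
    IsUnit (shift n 1 - seqMul n M) := by
  rcases subsingleton_or_nontrivial (SeqL2 n) with hs | hs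
  · have : Subsingleton (SeqL2 n →L[ℂ] SeqL2 n) := ⟨fun a b => by ext1 e; exact hs.elim _ _⟩
    exact isUnit_of_subsingleton _
  have hcomm : Commute (shift n 1) (seqMul n M) := by
    ext1 e
    refine SeqL2.ext fun i => ?_
    change shift n 1 (seqMul n M e) i = seqMul n M (shift n 1 e) i
    rw [shift_apply, seqMul_apply, seqMul_apply, shift_apply]
  refine isUnit_sub_of_aeval_eq_zero hcomm (p := M.charpoly) M.charpoly_monic.ne_zero ?_ ?_
  · rw [Polynomial.aeval_algHom_apply, Matrix.aeval_self_charpoly, map_zero]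
  · intro z hz
    let u : (SeqL2 n →L[ℂ] SeqL2 n)ˣ := ⟨shift n 1, shift n (-1), shift_mul_neg 1, by
      simpa using shift_mul_neg (n := n) (-1)⟩
    have hn : ∀ m, ‖shift n m‖ ≤ 1 := fun m => LinearIsometry.norm_toContinuousLinearMap_le _
    have h1 := norm_eq_one_of_mem_spectrum u (hn 1) (hn (-1)) hz
    rw [Matrix.eval_charpoly]
    intro h0
    refine hM z h1 ?_
    rw [Matrix.scalar_apply] at h0
    rw [← neg_sub, Matrix.det_neg, Matrix.smul_one_eq_diagonal, h0, mul_zero]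

/-- Difference equations `e (m + 1) = M e m + h m` are uniquely solvable in square summable
sequences when `M` has no eigenvalue on the unit circle. -/
theorem exists_difference_solution {M : Matrix (Fin n) (Fin n) ℂ}
    (hM : ∀ ρ : ℂ, ‖ρ‖ = 1 → (M - ρ • (1 : Matrix (Fin n) (Fin n) ℂ)).det ≠ 0) :
    (∀ h : ℤ → Fin n → ℂ, (Summable fun m => ‖h m‖ ^ 2) →
      ∃ e : ℤ → Fin n → ℂ, (Summable fun m => ‖e m‖ ^ 2) ∧
        ∀ m, e (m + 1) = M.mulVec (e m) + h m) ∧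
    ∃ C : ℝ, ∀ e h : ℤ → Fin n → ℂ, (Summable fun m => ‖e m‖ ^ 2) →
      (Summable fun m => ‖h m‖ ^ 2) → (∀ m, e (m + 1) = M.mulVec (e m) + h m) →
      ∑' m, ‖e m‖ ^ 2 ≤ C * ∑' m, ‖h m‖ ^ 2 := by
  obtain ⟨u, hu⟩ := isUnit_shift_sub_seqMul hM
  have hnorm : ∀ (e : ℤ → Fin n → ℂ) (he : Summable fun m => ‖e m‖ ^ 2),
      ‖(memLp_count_iff_summable.2 he).toLp e‖ ^ 2 = ∑' m, ‖e m‖ ^ 2 := fun e he => by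
    rw [norm_toLp_sq, integral_count_eq_tsum _ he fun _ => by positivity]
  have happ : ∀ (e : SeqL2 n) (i : ℤ), (u : SeqL2 n →L[ℂ] SeqL2 n) e i
      = e (i + 1) - M.mulVec (e i) := fun e i => by
    rw [hu, _root_.sub_apply]
    rw [congrFun (eq_of_ae_count (Lp.coeFn_sub (shift n 1 e) (seqMul n M e))) i, Pi.sub_apply,
      shift_apply, seqMul_apply]
  refine ⟨fun h hh => ?_, ‖(↑u⁻¹ : SeqL2 n →L[ℂ] SeqL2 n)‖ ^ 2, fun e h he hh heq => ?_⟩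
  · set H := (memLp_count_iff_summable.2 hh).toLp h with hH
    set e := (↑u⁻¹ : SeqL2 n →L[ℂ] SeqL2 n) H with he
    refine ⟨e, memLp_count_iff_summable.1 (Lp.memLp e), fun m => ?_⟩
    have h1 : (u : SeqL2 n →L[ℂ] SeqL2 n) e = H := by
      rw [he]
      exact congrArg (fun A : SeqL2 n →L[ℂ] SeqL2 n => A H) u.mul_inv
    have h2 := happ e m
    rw [h1, hH, congrFun (eq_of_ae_count (MemLp.coeFn_toLp _)) m] at h2
    rw [h2]; abel
  · rw [← hnorm e he, ← hnorm h hh, ← mul_pow]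
    gcongr
    set E := (memLp_count_iff_summable.2 he).toLp e with hE
    set H := (memLp_count_iff_summable.2 hh).toLp h with hH
    have h1 : (u : SeqL2 n →L[ℂ] SeqL2 n) E = H := SeqL2.ext fun i => by
      rw [happ, hE, hH, congrFun (eq_of_ae_count (MemLp.coeFn_toLp _)) _,
        congrFun (eq_of_ae_count (MemLp.coeFn_toLp _)) _,
        congrFun (eq_of_ae_count (MemLp.coeFn_toLp _)) _, heq]
      abel
    have h2 : E = (↑u⁻¹ : SeqL2 n →L[ℂ] SeqL2 n) H := by
      rw [← h1]
      exact (congrArg (fun A : SeqL2 n →L[ℂ] SeqL2 n => A E) u.inv_mul).symm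
    rw [h2]
    exact ContinuousLinearMap.le_opNorm _ _

end Sequences

/-! ### Inhomogeneous linear systems -/

/-- `Y` is a continuous (absolutely continuous) solution of `Y' = B Y + f`, in integral form. -/
def IsMild {n : ℕ} (B : Coeff n) (f Y : ℝ → Fin n → ℂ) : Prop :=
  Continuous Y ∧ ∀ x, Y x = Y 0 + ∫ t in (0 : ℝ)..x, (B.act t (Y t) + f t)

section Mild

variable {n : ℕ} {B : Coeff n} {f Y : ℝ → Fin n → ℂ}

theorem intervalIntegrable_of_locallyIntegrable {E : Type*} [NormedAddCommGroup E] {f : ℝ → E}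
    (hf : LocallyIntegrable f volume) (a b : ℝ) : IntervalIntegrable f volume a b :=
  (hf.integrableOn_isCompact isCompact_uIcc).intervalIntegrable

theorem memLp_two_locallyIntegrable {E : Type*} [NormedAddCommGroup E] {f : ℝ → E}
    (hf : MemLp f 2 volume) : LocallyIntegrable f volume :=
  hf.locallyIntegrable (by norm_num)

theorem IsMild.intervalIntegrable (hf : LocallyIntegrable f volume) (hY : IsMild B f Y) (a b : ℝ) :
    IntervalIntegrable (fun t => B.act t (Y t) + f t) volume a b :=
  ((B.continuous_act hY.1).intervalIntegrable a b).add
    (intervalIntegrable_of_locallyIntegrable hf a b)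

theorem IsMild.sub_eq (hf : LocallyIntegrable f volume) (hY : IsMild B f Y) (a b : ℝ) :
    Y b - Y a = ∫ t in a..b, (B.act t (Y t) + f t) := by
  rw [hY.2 b, hY.2 a, add_sub_add_left_eq_sub, intervalIntegral.integral_interval_sub_left
    (hY.intervalIntegrable hf _ _) (hY.intervalIntegrable hf _ _)]

theorem IsMild.comp_add_int (hB : B.Periodic) (hf : LocallyIntegrable f volume)
    (hY : IsMild B f Y) (m : ℤ) : IsMild B (fun x => f (x + m)) fun x => Y (x + m) := by
  refine ⟨hY.1.comp (continuous_id.add continuous_const), fun x => ?_⟩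
  have h := hY.sub_eq hf (0 + m) (x + m)
  rw [← intervalIntegral.integral_comp_add_right (fun t => B.act t (Y t) + f t) (m : ℝ)] at h
  rw [← sub_eq_iff_eq_add', h]
  refine intervalIntegral.integral_congr fun t _ => ?_
  congr 1
  ext i
  simp only [Coeff.act, hB.add_int]

theorem IsSolution.isMild (hY : IsSolution B Y) : IsMild B 0 Y := by
  have hc : Continuous Y := continuous_iff_continuousAt.2 fun x => (hY x).continuousAt
  refine ⟨hc, fun x => ?_⟩
  simp only [Pi.zero_apply, add_zero]
  rw [intervalIntegral.integral_eq_sub_of_hasDerivAt (fun t _ => hY t)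
    ((B.continuous_act hc).intervalIntegrable _ _)]
  abel

theorem IsMild.add {g Z : ℝ → Fin n → ℂ} (hf : LocallyIntegrable f volume)
    (hg : LocallyIntegrable g volume) (hY : IsMild B f Y) (hZ : IsMild B g Z) :
    IsMild B (f + g) (Y + Z) := by
  refine ⟨hY.1.add hZ.1, fun x => ?_⟩
  have e : ∀ t, B.act t ((Y + Z) t) + (f + g) t
      = (B.act t (Y t) + f t) + (B.act t (Z t) + g t) := fun t => by
    simp only [Pi.add_apply, B.act_add]; abel
  simp only [e]
  rw [intervalIntegral.integral_add (hY.intervalIntegrable hf _ _)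
    (hZ.intervalIntegrable hg _ _), Pi.add_apply, Pi.add_apply, hY.2 x, hZ.2 x]
  abel

theorem IsMild.sub {g Z : ℝ → Fin n → ℂ} (hf : LocallyIntegrable f volume)
    (hg : LocallyIntegrable g volume) (hY : IsMild B f Y) (hZ : IsMild B g Z) :
    IsMild B (f - g) (Y - Z) := by
  refine ⟨hY.1.sub hZ.1, fun x => ?_⟩
  have e : ∀ t, B.act t ((Y - Z) t) + (f - g) t
      = (B.act t (Y t) + f t) - (B.act t (Z t) + g t) := fun t => by
    simp only [Pi.sub_apply, B.act_sub]; abel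
  simp only [e]
  rw [intervalIntegral.integral_sub (hY.intervalIntegrable hf _ _)
    (hZ.intervalIntegrable hg _ _), Pi.sub_apply, Pi.sub_apply, hY.2 x, hZ.2 x]
  abel

/-- Grönwall's inequality in integral form. -/
theorem le_exp_of_le_integral {u : ℝ → ℝ} (hu : Continuous u) {A L b : ℝ} (hL : 0 ≤ L)
    (h : ∀ x ∈ Set.Icc 0 b, u x ≤ A + L * ∫ t in (0 : ℝ)..x, u t) {x : ℝ}
    (hx : x ∈ Set.Icc 0 b) : u x ≤ A * Real.exp (L * x) := by
  set g : ℝ → ℝ := fun x => A + L * ∫ t in (0 : ℝ)..x, u t with hg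
  have hgd : ∀ x, HasDerivAt g (L * u x) x := fun x =>
    ((hu.integral_hasStrictDerivAt 0 x).hasDerivAt.const_mul L).const_add A
  set k : ℝ → ℝ := fun x => g x * Real.exp (-(L * x)) with hk
  have hkd : ∀ x, HasDerivAt k ((L * u x - L * g x) * Real.exp (-(L * x))) x := fun x => by
    have h1 : HasDerivAt (fun x : ℝ => -(L * x)) (-L) x := by
      simpa using ((hasDerivAt_id x).const_mul L).fun_neg
    exact ((hgd x).mul h1.exp).congr_deriv (by ring)
  have hanti : AntitoneOn k (Set.Icc 0 b) := by
    refine antitoneOn_of_deriv_nonpos (convex_Icc _ _)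
      (fun y _ => (hkd y).continuousAt.continuousWithinAt)
      (fun y _ => (hkd y).differentiableAt.differentiableWithinAt) fun y hy => ?_
    rw [(hkd y).deriv]
    rw [interior_Icc] at hy
    have := h y (Set.Ioo_subset_Icc_self hy)
    exact mul_nonpos_of_nonpos_of_nonneg (by
      rw [← mul_sub]; exact mul_nonpos_of_nonneg_of_nonpos hL (sub_nonpos.2 this))
      (Real.exp_pos _).le
  have h0 : (0 : ℝ) ∈ Set.Icc 0 b := ⟨le_rfl, hx.1.trans hx.2⟩
  have h1 : k x ≤ A := by
    have := hanti h0 hx hx.1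
    simpa [hk, hg] using this
  calc u x ≤ g x := h x hx
    _ = k x * Real.exp (L * x) := by
        rw [hk]; simp only; rw [mul_assoc, ← Real.exp_add]; simp
    _ ≤ _ := by gcongr

theorem IsMild.norm_sub_le (hf : LocallyIntegrable f volume) (hY : IsMild B f Y) {a b : ℝ}
    (hab : a ≤ b) : ‖Y b - Y a‖ ≤ (n * ‖B‖) * (∫ t in a..b, ‖Y t‖) + ∫ t in a..b, ‖f t‖ := by
  rw [hY.sub_eq hf]
  have hYi : IntervalIntegrable (fun t => ‖Y t‖) volume a b := hY.1.norm.intervalIntegrable _ _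
  have hfi : IntervalIntegrable (fun t => ‖f t‖) volume a b :=
    (intervalIntegrable_of_locallyIntegrable hf a b).norm
  have hi : IntervalIntegrable (fun t => (n * ‖B‖) * ‖Y t‖ + ‖f t‖) volume a b :=
    (hYi.const_mul _).add hfi
  refine (intervalIntegral.norm_integral_le_of_norm_le hab (ae_of_all _ fun t _ =>
    (norm_add_le _ _).trans (add_le_add_left (B.norm_act_le t (Y t)) _)) hi).trans (le_of_eq ?_)
  rw [intervalIntegral.integral_add (hYi.const_mul _) hfi, intervalIntegral.integral_const_mul]

theorem integral_norm_mono {E : Type*} [NormedAddCommGroup E] {f : ℝ → E}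
    (hf : LocallyIntegrable f volume) {a b c d : ℝ} (hca : c ≤ a) (hab : a ≤ b) (hbd : b ≤ d) :
    ∫ t in a..b, ‖f t‖ ≤ ∫ t in c..d, ‖f t‖ :=
  intervalIntegral.integral_mono_interval hca hab hbd (ae_of_all _ fun _ => norm_nonneg _)
    (intervalIntegrable_of_locallyIntegrable hf _ _).norm

/-- On the unit cell a mild solution is controlled by its value at any point of the cell and the
forcing on the cell. -/
theorem IsMild.norm_le (hf : LocallyIntegrable f volume) (hY : IsMild B f Y) {x y : ℝ}
    (hx : x ∈ Set.Icc (0 : ℝ) 1) (hy : y ∈ Set.Icc (0 : ℝ) 1) :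
    ‖Y x‖ ≤ Real.exp (n * ‖B‖) * (‖Y y‖ + ∫ t in (0 : ℝ)..1, ‖f t‖) := by
  set L : ℝ := n * ‖B‖ with hL
  have hL0 : 0 ≤ L := by positivity
  set A : ℝ := ‖Y y‖ + ∫ t in (0 : ℝ)..1, ‖f t‖ with hA
  have hA0 : 0 ≤ A := add_nonneg (norm_nonneg _)
    (intervalIntegral.integral_nonneg zero_le_one fun _ _ => norm_nonneg _)
  have fin : ∀ s ∈ Set.Icc (0 : ℝ) 1, A * Real.exp (L * s) ≤ Real.exp L * A := fun s hs => by
    rw [mul_comm]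
    gcongr
    exact mul_le_of_le_one_right hL0 hs.2
  rcases le_total y x with hyx | hyx
  · have hs : x - y ∈ Set.Icc 0 (1 - y) := ⟨by linarith, by linarith [hx.2]⟩
    have h := le_exp_of_le_integral (u := fun s => ‖Y (s + y)‖) (A := A) (L := L) (b := 1 - y)
      (by have := hY.1; fun_prop) hL0 (fun s hs => by
        rw [intervalIntegral.integral_comp_add_right (fun t => ‖Y t‖) y, zero_add]
        have h1 := hY.norm_sub_le hf (a := y) (b := s + y) (by linarith [hs.1])
        have h2 := norm_le_norm_add_norm_sub' (Y (s + y)) (Y y)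
        have h3 := integral_norm_mono hf hy.1 (by linarith [hs.1] : y ≤ s + y)
          (by linarith [hs.2] : s + y ≤ 1)
        rw [← hL] at h1
        linarith) hs
    simp only [sub_add_cancel] at h
    exact h.trans (fin _ ⟨hs.1, by linarith [hs.2, hy.1]⟩)
  · have hs : y - x ∈ Set.Icc 0 y := ⟨by linarith, by linarith [hx.1]⟩
    have h := le_exp_of_le_integral (u := fun s => ‖Y (y - s)‖) (A := A) (L := L) (b := y)
      (by have := hY.1; fun_prop) hL0 (fun s hs => by
        rw [intervalIntegral.integral_comp_sub_left (fun t => ‖Y t‖) y, sub_zero]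
        have h1 := hY.norm_sub_le hf (a := y - s) (b := y) (by linarith [hs.1])
        have h2 := norm_le_norm_add_norm_sub (Y y) (Y (y - s))
        have h3 := integral_norm_mono hf (by linarith [hs.2] : (0 : ℝ) ≤ y - s)
          (by linarith [hs.1] : y - s ≤ y) hy.2
        rw [← hL] at h1
        linarith) hs
    simp only [sub_sub_cancel] at h
    exact h.trans (fin _ ⟨hs.1, by linarith [hs.2, hy.2]⟩)

theorem abs_le_cosh (x : ℝ) : |x| ≤ Real.cosh x := by
  rw [← Real.cosh_abs, Real.cosh_eq]
  have h1 := Real.quadratic_le_exp_of_nonneg (abs_nonneg x)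
  have h2 := Real.exp_pos (-|x|)
  nlinarith [sq_nonneg (|x| - 1)]

/-- The bound is crude, but its linear growth in `x` is all that the weight `cosh(Kx)` needs. -/
theorem norm_integral_le_of_memLp_two {f : ℝ → ℂ} (hf : MemLp f 2 volume) (x : ℝ) :
    ‖∫ t in (0 : ℝ)..x, f t‖ ≤ |x| + ∫ t, ‖f t‖ ^ 2 := by
  have hsq : Integrable fun t => ‖f t‖ ^ 2 := hf.integrable_norm_pow (by simp)
  have h1 : ∀ t, ‖f t‖ ≤ 1 + ‖f t‖ ^ 2 := fun t => by nlinarith [sq_nonneg (‖f t‖ - 1)]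
  rw [intervalIntegral.norm_integral_eq_norm_integral_uIoc]
  have hone : IntegrableOn (fun _ : ℝ => (1 : ℝ)) (Set.uIoc 0 x) volume :=
    integrableOn_const (by rw [Set.uIoc]; exact measure_Ioc_lt_top.ne)
  calc ‖∫ t in Set.uIoc 0 x, f t‖ ≤ ∫ t in Set.uIoc 0 x, (1 + ‖f t‖ ^ 2) :=
        norm_integral_le_of_norm_le (Integrable.add hone hsq.integrableOn)
          (ae_of_all _ h1)
    _ = |x| + ∫ t in Set.uIoc 0 x, ‖f t‖ ^ 2 := by
        rw [integral_add hone hsq.integrableOn]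
        simp [measureReal_def, Set.uIoc, max_sub_min_eq_abs]
    _ ≤ _ := by
        refine add_le_add_right ?_ _
        exact setIntegral_le_integral hsq (ae_of_all _ fun _ => by positivity)

/-- Global existence for square integrable forcing: the Volterra operator is inverted on the
primitive of the forcing, divided by the weight `cosh(Kx)`. -/
theorem exists_isMild (B : Coeff n) (hf : MemLp f 2 volume) : ∃ Y, IsMild B f Y := by
  set K : ℝ := n * ‖B‖ + 1 with hKd
  have hK : 0 < K := by positivity
  have hfi : ∀ i, MemLp (fun t => f t i) 2 volume := fun i => hf.eval i
  have hfl : ∀ i, LocallyIntegrable (fun t => f t i) volume := fun i =>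
    memLp_two_locallyIntegrable (hfi i)
  have hc : ∀ x, (Real.cosh (K * x) : ℂ) ≠ 0 := fun x => by exact_mod_cast (Real.cosh_pos _).ne'
  let γ : Fin n → (ℝ →ᵇ ℂ) := fun i => BoundedContinuousFunction.ofNormedAddCommGroup
    (fun x => sech K x * ∫ t in (0 : ℝ)..x, f t i)
    ((sech K).continuous.mul (intervalIntegral.continuous_primitive
      (fun a b => intervalIntegrable_of_locallyIntegrable (hfl i) a b) 0))
    (K⁻¹ + ∫ t, ‖f t i‖ ^ 2) (fun x => by
      have hcp := Real.cosh_pos (K * x)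
      have hI : 0 ≤ ∫ t, ‖f t i‖ ^ 2 := integral_nonneg fun _ => by positivity
      rw [norm_mul, sech_apply, Complex.norm_real, Real.norm_eq_abs, abs_of_pos (inv_pos.2 hcp)]
      rw [inv_mul_le_iff₀ hcp]
      refine (norm_integral_le_of_memLp_two (hfi i) x).trans ?_
      have h1 := abs_le_cosh (K * x)
      have h2 := Real.one_le_cosh (K * x)
      rw [abs_mul, abs_of_pos hK] at h1
      have h3 : |x| ≤ Real.cosh (K * x) * K⁻¹ := by
        rw [← div_eq_mul_inv, le_div_iff₀ hK, mul_comm]; exact h1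
      nlinarith)
  set Z := Ring.inverse (1 - volterra n K hK B) γ with hZ
  set Y : ℝ → Fin n → ℂ := fun x i => (Real.cosh (K * x) : ℂ) * Z i x with hY
  have hYc : Continuous Y := by
    refine continuous_pi fun i => ?_
    simp only [hY]; fun_prop
  have key : ∀ x i, Y x i = (∫ t in (0 : ℝ)..x, f t i)
      + ∫ s in (0 : ℝ)..x, B.act s (Y s) i := fun x i => by
    have h := exists_integral_solution hK (lt_add_one _) γ Z hZ x i
    have e : (Real.cosh (K * x) : ℂ) * γ i x = ∫ t in (0 : ℝ)..x, f t i := by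
      change (Real.cosh (K * x) : ℂ) * (sech K x * _) = _
      rw [sech_apply, Complex.ofReal_inv, mul_inv_cancel_left₀ (hc x)]
    rw [e] at h
    exact h
  refine ⟨Y, hYc, fun x => ?_⟩
  ext i
  have h0 : Y 0 i = 0 := by rw [key]; simp
  have hpi : ∀ {g : ℝ → Fin n → ℂ}, IntervalIntegrable g volume 0 x →
      (∫ t in (0 : ℝ)..x, g t) i = ∫ t in (0 : ℝ)..x, g t i := fun hg =>
    ((ContinuousLinearMap.proj (R := ℂ) (φ := fun _ : Fin n => ℂ) i).intervalIntegral_comp_comm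
      hg).symm
  have hBi := (B.continuous_act hYc).intervalIntegrable (μ := volume) 0 x
  have hfx := intervalIntegrable_of_locallyIntegrable (memLp_two_locallyIntegrable hf) 0 x
  rw [Pi.add_apply, h0, zero_add, hpi (hBi.add hfx), key]
  simp only [Pi.add_apply]
  rw [intervalIntegral.integral_add, add_comm]
  · exact ((continuous_apply i).comp (B.continuous_act hYc)).intervalIntegrable _ _
  · exact intervalIntegrable_of_locallyIntegrable (hfl i) _ _

end Mild

/-! ### Solvability in square integrable functions -/

section Cells

variable {E : Type*} [NormedAddCommGroup E]

/-- The `L¹` norm of `f` on the cell `[m, m + 1]`. -/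
def cellNorm (f : ℝ → E) (m : ℤ) : ℝ := ∫ t in (0 : ℝ)..1, ‖f (t + m)‖

variable {f : ℝ → E}

theorem hasSum_cell_sq (hf : MemLp f 2 volume) :
    HasSum (fun m : ℤ => ∫ t in (0 : ℝ)..1, ‖f (t + m)‖ ^ 2) (∫ t, ‖f t‖ ^ 2) :=
  (hf.integrable_norm_pow (by simp)).hasSum_intervalIntegral_comp_add_int

theorem memLp_comp_add_int (hf : MemLp f 2 volume) (m : ℤ) :
    MemLp (fun t => f (t + m)) 2 volume :=
  hf.comp_measurePreserving (measurePreserving_add_right volume (m : ℝ))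

theorem cellNorm_sq_le (hf : MemLp f 2 volume) (m : ℤ) :
    cellNorm f m ^ 2 ≤ ∫ t in (0 : ℝ)..1, ‖f (t + m)‖ ^ 2 := by
  have hg := memLp_comp_add_int hf m
  set g : ℝ → E := fun t => f (t + m) with hgd
  have h1 : IntervalIntegrable (fun t => ‖g t‖) volume 0 1 :=
    (intervalIntegrable_of_locallyIntegrable (memLp_two_locallyIntegrable hg) 0 1).norm
  have h2 : IntervalIntegrable (fun t => ‖g t‖ ^ 2) volume 0 1 :=
    (hg.integrable_norm_pow (by simp)).intervalIntegrable
  set c := cellNorm f m with hc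
  have hc' : ∫ t in (0 : ℝ)..1, ‖g t‖ = c := rfl
  have h0 : 0 ≤ ∫ t in (0 : ℝ)..1, (‖g t‖ - c) ^ 2 :=
    intervalIntegral.integral_nonneg zero_le_one fun _ _ => sq_nonneg _
  have e : (fun t => (‖g t‖ - c) ^ 2) = fun t => ‖g t‖ ^ 2 - ((2 * c) * ‖g t‖ - c ^ 2) := by
    funext t; ring
  rw [e, intervalIntegral.integral_sub h2 ((h1.const_mul _).sub (by simp)),
    intervalIntegral.integral_sub (h1.const_mul _) (by simp),
    intervalIntegral.integral_const_mul, hc'] at h0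
  simp at h0
  nlinarith

theorem summable_cellNorm_sq (hf : MemLp f 2 volume) : Summable fun m => cellNorm f m ^ 2 :=
  Summable.of_nonneg_of_le (fun _ => sq_nonneg _) (cellNorm_sq_le hf) (hasSum_cell_sq hf).summable

theorem tsum_cellNorm_sq_le (hf : MemLp f 2 volume) :
    ∑' m, cellNorm f m ^ 2 ≤ ∫ t, ‖f t‖ ^ 2 := by
  rw [← (hasSum_cell_sq hf).tsum_eq]
  exact (summable_cellNorm_sq hf).tsum_le_tsum (cellNorm_sq_le hf) (hasSum_cell_sq hf).summable

theorem summable_add_sq {u v : ℤ → ℝ} (hu : Summable fun m => u m ^ 2)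
    (hv : Summable fun m => v m ^ 2) : Summable fun m => (u m + v m) ^ 2 :=
  Summable.of_nonneg_of_le (fun _ => sq_nonneg _)
    (fun m => by nlinarith [sq_nonneg (u m - v m)] : ∀ m, (u m + v m) ^ 2 ≤ 2 * (u m ^ 2 + v m ^ 2))
    ((hu.add hv).mul_left 2)

/-- A continuous function whose cell maxima are square summable is square integrable. -/
theorem memLp_two_of_cell_bound {Y : ℝ → E} (hY : Continuous Y) {u : ℤ → ℝ}
    (hu : Summable fun m => u m ^ 2)
    (hb : ∀ m : ℤ, ∀ t ∈ Set.Icc (0 : ℝ) 1, ‖Y (t + m)‖ ≤ u m) :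
    MemLp Y 2 volume ∧ ∫ t, ‖Y t‖ ^ 2 ≤ ∑' m, u m ^ 2 := by
  have hc : Continuous fun t => ‖Y t‖ ^ 2 := hY.norm.pow 2
  have hcell : ∀ m : ℤ, ∫ t in (0 : ℝ)..1, ‖Y (t + m)‖ ^ 2 ≤ u m ^ 2 := fun m => by
    have h1 := intervalIntegral.integral_mono_on (a := (0 : ℝ)) (b := 1) zero_le_one
      ((hc.comp (continuous_add_const (m : ℝ))).intervalIntegrable (μ := volume) 0 1)
      (intervalIntegrable_const (c := u m ^ 2)) (fun t ht => by
        change ‖Y (t + m)‖ ^ 2 ≤ u m ^ 2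
        gcongr
        exact hb m t ht)
    simpa using h1
  have hmem : MemLp Y 2 volume := by
    rw [memLp_two_iff_integrable_sq_norm hY.aestronglyMeasurable, ← integrableOn_univ,
      ← iUnion_Ioc_intCast ℝ]
    refine integrableOn_iUnion_of_summable_integral_norm (fun m => hc.integrableOn_Ioc) ?_
    refine Summable.of_nonneg_of_le (fun m => integral_nonneg fun _ => norm_nonneg _)
      (fun m => ?_) hu
    refine le_trans (le_of_eq ?_) (hcell m)
    rw [intervalIntegral.integral_comp_add_right (fun t => ‖Y t‖ ^ 2) (m : ℝ), zero_add,
      add_comm (1 : ℝ), intervalIntegral.integral_of_le (by linarith)]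
    simp
  refine ⟨hmem, ?_⟩
  rw [← (hasSum_cell_sq hmem).tsum_eq]
  exact (hasSum_cell_sq hmem).summable.tsum_le_tsum hcell hu

end Cells

section Solvability

variable {n : ℕ} {B : Coeff n}

/-- Over one cell, a mild solution deviates from the homogeneous flow by at most the forcing. -/
theorem IsMild.norm_sub_mulVec_le (hB : B.Periodic) {K : ℝ} (hK : 0 < K) (hBK : n * ‖B‖ < K)
    {f Y : ℝ → Fin n → ℂ} (hf : LocallyIntegrable f volume)
    (hf' : ∀ m : ℤ, LocallyIntegrable (fun t => f (t + m)) volume)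
    (hY : IsMild B f Y) (m : ℤ) :
    ‖Y (m + 1 : ℤ) - (monodromy K hK B).mulVec (Y m)‖
      ≤ Real.exp (n * ‖B‖) * cellNorm f m := by
  obtain ⟨Φ, hΦ, hΦ0⟩ := exists_isSolution_initial B (Y m)
  have h0 : LocallyIntegrable (0 : ℝ → Fin n → ℂ) volume := locallyIntegrable_zero
  have h1 := (hY.comp_add_int hB hf m).sub (hf' m) h0 hΦ.isMild
  rw [sub_zero] at h1
  have h2 := h1.norm_le (hf' m) (x := 1) (y := 0) (by simp) (by simp)
  simp only [Pi.sub_apply, zero_add, hΦ0, sub_self, norm_zero] at h2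
  rw [hΦ.apply_one hK hBK, hΦ0] at h2
  push_cast
  rwa [add_comm (m : ℝ) 1]

/-- The values of a mild solution on a cell are controlled by the left end point. -/
theorem IsMild.norm_cell_le (hB : B.Periodic) {f Y : ℝ → Fin n → ℂ}
    (hf : LocallyIntegrable f volume)
    (hf' : ∀ m : ℤ, LocallyIntegrable (fun t => f (t + m)) volume)
    (hY : IsMild B f Y) (m : ℤ) {t : ℝ} (ht : t ∈ Set.Icc (0 : ℝ) 1) :
    ‖Y (t + m)‖ ≤ Real.exp (n * ‖B‖) * (‖Y m‖ + cellNorm f m) := by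
  simpa [cellNorm] using (hY.comp_add_int hB hf m).norm_le (hf' m) ht (y := 0) (by simp)

/-- The sample at the left end point of a cell is controlled by the `L¹` norm over the cell. -/
theorem IsMild.norm_le_cellNorm (hB : B.Periodic) {f Y : ℝ → Fin n → ℂ}
    (hf : LocallyIntegrable f volume)
    (hf' : ∀ m : ℤ, LocallyIntegrable (fun t => f (t + m)) volume)
    (hY : IsMild B f Y) (m : ℤ) :
    ‖Y m‖ ≤ Real.exp (n * ‖B‖) * (cellNorm Y m + cellNorm f m) := by
  have hc : Continuous fun t : ℝ => ‖Y (t + m)‖ := by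
    have := hY.1; fun_prop
  have h1 := intervalIntegral.integral_mono_on (a := (0 : ℝ)) (b := 1) zero_le_one
    (intervalIntegrable_const (c := ‖Y m‖))
    ((by fun_prop : Continuous fun t : ℝ => Real.exp (n * ‖B‖) *
      (‖Y (t + m)‖ + cellNorm f m)).intervalIntegrable (μ := volume) 0 1) (fun t ht => by
      simpa [cellNorm] using (hY.comp_add_int hB hf m).norm_le (hf' m) (x := 0) (by simp) ht)
  rw [intervalIntegral.integral_const_mul, intervalIntegral.integral_add
    (hc.intervalIntegrable _ _) (by simp)] at h1
  simpa [cellNorm] using h1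

/-- If the periodic system `Y' = B Y` has no Floquet multiplier on the unit circle, then
`Y' = B Y + f` is uniquely and boundedly solvable in `L²(ℝ)`. -/
theorem exists_memLp_isMild (hB : B.Periodic) (hno : ∀ ρ : ℂ, ‖ρ‖ = 1 → ¬ HasBloch B ρ) :
    (∀ f : ℝ → Fin n → ℂ, MemLp f 2 volume → ∃ Y, IsMild B f Y ∧ MemLp Y 2 volume) ∧
    ∃ C : ℝ, 0 ≤ C ∧ ∀ f Y : ℝ → Fin n → ℂ, MemLp f 2 volume → MemLp Y 2 volume → IsMild B f Y →
      ∫ t, ‖Y t‖ ^ 2 ≤ C * ∫ t, ‖f t‖ ^ 2 := by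
  set K : ℝ := n * ‖B‖ + 1 with hKd
  have hK : 0 < K := by positivity
  have hBK : n * ‖B‖ < K := lt_add_one _
  set M := monodromy K hK B with hM
  set A : ℝ := Real.exp (n * ‖B‖) with hA
  have hA0 : 0 < A := Real.exp_pos _
  obtain ⟨hex, C₀, hC₀⟩ := exists_difference_solution (M := M) fun ρ hρ h0 => hno ρ hρ
    ((hasBloch_iff_evans hK hBK hB ρ).2 (by rw [evans]; exact h0))
  have hloc := fun {f : ℝ → Fin n → ℂ} (hf : MemLp f 2 volume) => memLp_two_locallyIntegrable hf
  have hloc' := fun {f : ℝ → Fin n → ℂ} (hf : MemLp f 2 volume) (m : ℤ) =>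
    memLp_two_locallyIntegrable (memLp_comp_add_int hf m)
  -- the defects of the difference equation satisfied by `m ↦ Y m` are square summable
  have hdef : ∀ {f Y : ℝ → Fin n → ℂ}, MemLp f 2 volume → IsMild B f Y → ∀ m : ℤ,
      ‖Y (m + 1 : ℤ) - M.mulVec (Y m)‖ ^ 2 ≤ A ^ 2 * cellNorm f m ^ 2 := fun hf hY m => by
    rw [← mul_pow]
    gcongr
    exact hY.norm_sub_mulVec_le hB hK hBK (hloc hf) (hloc' hf) m
  have hdefs : ∀ {f Y : ℝ → Fin n → ℂ}, MemLp f 2 volume → IsMild B f Y →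
      Summable fun m : ℤ => ‖Y (m + 1 : ℤ) - M.mulVec (Y m)‖ ^ 2 := fun hf hY =>
    Summable.of_nonneg_of_le (fun _ => sq_nonneg _) (hdef hf hY)
      ((summable_cellNorm_sq hf).mul_left _)
  have hcell : ∀ {f Y : ℝ → Fin n → ℂ}, MemLp f 2 volume → IsMild B f Y →
      (Summable fun m : ℤ => ‖Y m‖ ^ 2) → MemLp Y 2 volume ∧
      ∫ t, ‖Y t‖ ^ 2 ≤ 2 * A ^ 2 * (∑' m : ℤ, ‖Y m‖ ^ 2 + ∑' m, cellNorm f m ^ 2) :=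
    fun {f Y} hf hY hs => by
      have hsum := hs.add (summable_cellNorm_sq hf)
      have hsum2 : Summable fun m : ℤ => (A * (‖Y m‖ + cellNorm f m)) ^ 2 := by
        simp only [mul_pow]
        exact (summable_add_sq hs (summable_cellNorm_sq hf)).mul_left _
      obtain ⟨h1, h2⟩ := memLp_two_of_cell_bound hY.1 hsum2
        fun m t ht => hY.norm_cell_le hB (hloc hf) (hloc' hf) m ht
      refine ⟨h1, h2.trans ?_⟩
      rw [← hs.tsum_add (summable_cellNorm_sq hf), ← tsum_mul_left]
      refine hsum2.tsum_le_tsum (fun m => ?_) (hsum.mul_left _)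
      rw [mul_pow]
      have : (‖Y m‖ + cellNorm f m) ^ 2 ≤ 2 * (‖Y m‖ ^ 2 + cellNorm f m ^ 2) := by
        nlinarith [sq_nonneg (‖Y m‖ - cellNorm f m)]
      nlinarith [sq_nonneg A]
  refine ⟨fun f hf => ?_, 2 * A ^ 2 * (|C₀| * A ^ 2 + 1), by positivity,
    fun f Y hf hYm hY => ?_⟩
  · obtain ⟨Y₀, hY₀⟩ := exists_isMild B hf
    obtain ⟨e, he, hrec⟩ := hex _ (hdefs hf hY₀)
    -- correct the initial value of `Y₀` so that the samples at the integers are `e`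
    obtain ⟨Φ, hΦ, hΦ0⟩ := exists_isSolution_initial B (e 0 - Y₀ 0)
    have hΦrec : ∀ m : ℤ, Φ (m + 1 : ℤ) = M.mulVec (Φ m) := fun m => by
      have := (hΦ.comp_add_int hB m).apply_one hK hBK
      simp only [zero_add] at this
      rw [← this]; push_cast; rw [add_comm]
    have hY : IsMild B f (Y₀ + Φ) := by
      have := hY₀.add (hloc hf) (g := 0) locallyIntegrable_zero hΦ.isMild
      rwa [add_zero] at this
    have hMinj : ∀ v, M.mulVec v = 0 → v = 0 := fun v hv => by
      obtain ⟨Ψ, hΨ, rfl⟩ := exists_isSolution_initial B v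
      rw [← hΨ.apply_one hK hBK] at hv
      have := hΨ.eq (IsSolution.zero B) (x₀ := 1) (by simpa using hv)
      rw [this]; rfl
    set d : ℤ → Fin n → ℂ := fun m => (Y₀ + Φ) m - e m with hd
    have hdrec : ∀ m, d (m + 1) = M.mulVec (d m) := fun m => by
      simp only [hd, Pi.add_apply, hrec m, hΦrec, Matrix.mulVec_sub, Matrix.mulVec_add]
      abel
    have hd0 : ∀ m, d m = 0 := fun m => by
      induction m using Int.induction_on with
      | zero => simp [hd, hΦ0]
      | succ i ih => rw [hdrec, ih, Matrix.mulVec_zero]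
      | pred i ih =>
        refine hMinj _ ?_
        rw [← hdrec, sub_add_cancel, ih]
    refine ⟨Y₀ + Φ, hY, (hcell hf hY ?_).1⟩
    have : ∀ m : ℤ, (Y₀ + Φ) m = e m := fun m => sub_eq_zero.1 (hd0 m)
    simpa only [this] using he
  · have hs : Summable fun m : ℤ => ‖Y m‖ ^ 2 := by
      refine Summable.of_nonneg_of_le (fun _ => sq_nonneg _) (fun m => ?_)
        ((summable_add_sq (summable_cellNorm_sq hYm) (summable_cellNorm_sq hf)).mul_left (A ^ 2))
      rw [← mul_pow]
      gcongr
      exact hY.norm_le_cellNorm hB (hloc hf) (hloc' hf) m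
    have h1 := (hcell hf hY hs).2
    have h2 := hC₀ (fun m : ℤ => Y m) _ hs (hdefs hf hY) (fun m => by
      rw [add_sub_cancel])
    have h3 : ∑' m : ℤ, ‖Y (m + 1 : ℤ) - M.mulVec (Y m)‖ ^ 2
        ≤ A ^ 2 * ∑' m, cellNorm f m ^ 2 := by
      rw [← tsum_mul_left]
      exact (hdefs hf hY).tsum_le_tsum (hdef hf hY) ((summable_cellNorm_sq hf).mul_left _)
    have h4 := tsum_cellNorm_sq_le hf
    have h5 : ∑' m : ℤ, ‖Y m‖ ^ 2 ≤ |C₀| * (A ^ 2 * ∫ t, ‖f t‖ ^ 2) := by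
      refine h2.trans ?_
      calc _ ≤ |C₀| * ∑' m : ℤ, ‖Y (m + 1 : ℤ) - M.mulVec (Y m)‖ ^ 2 :=
            mul_le_mul_of_nonneg_right (le_abs_self _) (tsum_nonneg fun _ => sq_nonneg _)
        _ ≤ _ := by
            gcongr
            exact h3.trans (by gcongr)
    refine h1.trans ?_
    rw [mul_assoc (2 * A ^ 2)]
    gcongr
    rw [add_mul, one_mul, mul_assoc]
    exact add_le_add h5 h4

end Solvability

/-! ### Wave profiles -/

section Profiles

open Classical in
/-- A bounded continuous real function regarded as an element of the algebra of bounded continuous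
complex functions; the value is `0` for functions that are not bounded and continuous. -/
def toBCF (A : ℝ → ℝ) : ℝ →ᵇ ℂ :=
  if h : Continuous A ∧ ∃ C, ∀ x, ‖A x‖ ≤ C then
    BoundedContinuousFunction.ofNormedAddCommGroup (fun x => (A x : ℂ))
      (Complex.continuous_ofReal.comp h.1) h.2.choose
      (fun x => by rw [Complex.norm_real]; exact h.2.choose_spec x)
  else 0

theorem exists_norm_le_of_periodic {A : ℝ → ℝ} (hc : Continuous A)
    (hp : Function.Periodic A 1) : ∃ C, ∀ x, ‖A x‖ ≤ C := by
  obtain ⟨C, hC⟩ := (isCompact_Icc (a := (0 : ℝ)) (b := 1)).exists_bound_of_continuousOn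
    hc.continuousOn
  refine ⟨C, fun x => ?_⟩
  obtain ⟨y, hy, hxy⟩ := hp.exists_mem_Ico₀ one_pos x
  rw [hxy]
  exact hC y (Set.Ico_subset_Icc_self hy)

theorem toBCF_apply {A : ℝ → ℝ} (hc : Continuous A) (hp : Function.Periodic A 1) (x : ℝ) :
    toBCF A x = (A x : ℂ) := by
  rw [toBCF, dif_pos ⟨hc, exists_norm_le_of_periodic hc hp⟩]; rfl

theorem tendsto_toBCF {ι : Type*} {l : Filter ι} {A : ι → ℝ → ℝ} {A' : ℝ → ℝ}
    (hA : ∀ᶠ i in l, Continuous (A i) ∧ Function.Periodic (A i) 1)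
    (hA' : Continuous A' ∧ Function.Periodic A' 1) (h : TendstoUniformly A A' l) :
    Tendsto (fun i => toBCF (A i)) l (𝓝 (toBCF A')) := by
  rw [Metric.tendsto_nhds]
  intro ε hε
  filter_upwards [hA, Metric.tendstoUniformly_iff.1 h (ε / 2) (half_pos hε)] with i hi hd
  refine lt_of_le_of_lt ((BoundedContinuousFunction.dist_le (half_pos hε).le).2 fun x => ?_)
    (half_lt_self hε)
  rw [toBCF_apply hi.1 hi.2, toBCF_apply hA'.1 hA'.2, Complex.dist_eq, ← Complex.ofReal_sub,
    Complex.norm_real, ← dist_eq_norm, dist_comm]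
  exact (hd x).le

/-- The regularity, periodicity and positivity of profiles. -/
def IsWaveProfile (A : ℝ → ℝ) : Prop :=
  ContDiff ℝ 2 A ∧ Function.Periodic A 1 ∧ ∀ x, 0 < A x

variable {A : ℝ → ℝ}

theorem IsWaveProfile.continuous (hA : IsWaveProfile A) : Continuous A := hA.1.continuous

theorem IsWaveProfile.toBCF_apply (hA : IsWaveProfile A) (x : ℝ) : toBCF A x = (A x : ℂ) :=
  StVenant.toBCF_apply hA.continuous hA.2.1 x

theorem IsWaveProfile.inv (hA : IsWaveProfile A) :
    Continuous (fun x => (A x)⁻¹) ∧ Function.Periodic (fun x => (A x)⁻¹) 1 :=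
  ⟨hA.continuous.inv₀ fun x => (hA.2.2 x).ne', fun x => by simp only [hA.2.1 x]⟩

theorem IsWaveProfile.mul_inv (hA : IsWaveProfile A) :
    toBCF A * toBCF (fun x => (A x)⁻¹) = 1 := by
  ext x
  have h : (A x : ℂ) ≠ 0 := by exact_mod_cast (hA.2.2 x).ne'
  simp [hA.toBCF_apply, StVenant.toBCF_apply hA.inv.1 hA.inv.2, h]

theorem IsWaveProfile.isUnit (hA : IsWaveProfile A) : IsUnit (toBCF A) :=
  IsUnit.of_mul_eq_one _ hA.mul_inv

theorem IsWaveProfile.inverse_apply (hA : IsWaveProfile A) (x : ℝ) :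
    Ring.inverse (toBCF A) x = (A x : ℂ)⁻¹ := by
  have h : Ring.inverse (toBCF A) = toBCF (fun x => (A x)⁻¹) := by
    rw [← mul_one (Ring.inverse (toBCF A)), ← hA.mul_inv, ← mul_assoc,
      Ring.inverse_mul_cancel _ hA.isUnit, one_mul]
  rw [h, StVenant.toBCF_apply hA.inv.1 hA.inv.2, Complex.ofReal_inv]

theorem IsWaveProfile.hasDerivAt (hA : IsWaveProfile A) (x : ℝ) :
    HasDerivAt A (deriv A x) x :=
  ((hA.1.differentiable (by simp)) x).hasDerivAt

theorem IsWaveProfile.contDiff_deriv (hA : IsWaveProfile A) : ContDiff ℝ 1 (deriv A) :=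
  ((contDiff_succ_iff_deriv (n := 1)).1 hA.1).2.2

theorem IsWaveProfile.continuous_deriv (hA : IsWaveProfile A) : Continuous (deriv A) :=
  hA.contDiff_deriv.continuous

theorem IsWaveProfile.periodic_deriv (hA : IsWaveProfile A) : Function.Periodic (deriv A) 1 :=
  fun x => by
    have := hA.2.1
    rw [← deriv_comp_add_const]; congr 1; funext y; exact this y

theorem IsWaveProfile.exists_bounds (hA : IsWaveProfile A) :
    ∃ m N : ℝ, 0 < m ∧ ∀ x, m ≤ A x ∧ A x ≤ N ∧ |deriv A x| ≤ N := by
  obtain ⟨N₁, h1⟩ := exists_norm_le_of_periodic hA.continuous hA.2.1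
  obtain ⟨N₂, h2⟩ := exists_norm_le_of_periodic hA.continuous_deriv hA.periodic_deriv
  obtain ⟨N₃, h3⟩ := exists_norm_le_of_periodic hA.inv.1 hA.inv.2
  have hp : 0 < N₃ := by
    have := h3 0
    rw [Real.norm_eq_abs, abs_of_pos (inv_pos.2 (hA.2.2 0))] at this
    exact (inv_pos.2 (hA.2.2 0)).trans_le this
  refine ⟨N₃⁻¹, max N₁ N₂, inv_pos.2 hp, fun x => ⟨?_, ?_, ?_⟩⟩
  · have := h3 x
    rw [Real.norm_eq_abs, abs_of_pos (inv_pos.2 (hA.2.2 x))] at this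
    exact inv_le_of_inv_le₀ (hA.2.2 x) this
  · exact ((le_abs_self _).trans (h1 x)).trans (le_max_left _ _)
  · exact (h2 x).trans (le_max_right _ _)

end Profiles

/-! ### The first order systems of the spectral problems -/

section Systems

/-- The part independent of `Λ` of the coefficients of the rescaled spectral problem, written as a
first order system for `(v, g, P)`. Here `v = a / A²`, `g = c a + b`, and `P` is the linearized
flux plus `ε k c b`; the coefficients then involve the profile `A` but not its derivative. -/
def fullB₀ (ε δ ν c k q : ℂ) (a : ℝ →ᵇ ℂ) : Coeff 3 :=
  ![![(ε / (ν * k * c)) • Ring.inverse a - (ε * c / (ν * k)) • a ^ 2, (ε / (ν * k)) • 1,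
      (-(1 / (ν * k ^ 2 * c))) • 1],
    ![0, 0, 0],
    ![q ^ 2 • a ^ 2 - (4 * q * c * δ) • a ^ 3 + (3 * c ^ 2 * δ ^ 2) • a ^ 4,
      (2 * δ * q) • a - (2 * c * δ ^ 2) • a ^ 2, 0]]

/-- The coefficient of `Λ` in the first order system of the rescaled spectral problem. -/
def fullB₁ (ε c k : ℂ) (a : ℝ →ᵇ ℂ) : Coeff 3 :=
  ![![(1 / (k * c)) • 1, 0, 0], ![(1 / k) • a ^ 2, 0, 0], ![(-(ε * c)) • a ^ 2, ε • 1, 0]]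

/-- The part independent of `Λ` of the first order system for `(v, P)` that the rescaled problem
decouples to when `ε = δ = 0`. -/
def reducedB₀ (ν c k q : ℂ) (a : ℝ →ᵇ ℂ) : Coeff 2 :=
  ![![0, (-(1 / (ν * k ^ 2 * c))) • 1], ![q ^ 2 • a ^ 2, 0]]

/-- The coefficient of `Λ` in the reduced first order system. -/
def reducedB₁ (c k : ℂ) : Coeff 2 := ![![(1 / (k * c)) • 1, 0], ![0, 0]]

variable {A : ℝ → ℝ}

theorem full_act (hA : IsWaveProfile A) (ε δ ν c k q Λ : ℂ) (x : ℝ) (y : Fin 3 → ℂ)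
    (hν : ν ≠ 0) (hc : c ≠ 0) (hk : k ≠ 0) :
    (fullB₀ ε δ ν c k q (toBCF A) + Λ • fullB₁ ε c k (toBCF A)).act x y =
      ![(ε * k * (A x : ℂ)⁻¹ * y 0 + ν * k * Λ * y 0 - y 2
          + ε * k * c * (y 1 - c * (A x : ℂ) ^ 2 * y 0)) / (ν * k ^ 2 * c),
        Λ / k * (A x : ℂ) ^ 2 * y 0,
        (q - c * δ * A x) ^ 2 * (A x : ℂ) ^ 2 * y 0
          + (ε * Λ + 2 * δ * A x * (q - c * δ * A x)) * (y 1 - c * (A x : ℂ) ^ 2 * y 0)] := by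
  have hA0 : (A x : ℂ) ≠ 0 := by exact_mod_cast (hA.2.2 x).ne'
  ext i
  fin_cases i
  · simp [Coeff.act, Fin.sum_univ_three, fullB₀, fullB₁, hA.toBCF_apply, hA.inverse_apply]
    field_simp
    ring
  · simp [Coeff.act, Fin.sum_univ_three, fullB₀, fullB₁, hA.toBCF_apply]
    left; ring
  · simp [Coeff.act, Fin.sum_univ_three, fullB₀, fullB₁, hA.toBCF_apply]
    ring

theorem reduced_act (hA : IsWaveProfile A) (ν c k q Λ : ℂ) (x : ℝ) (y : Fin 2 → ℂ)
    (hν : ν ≠ 0) (hc : c ≠ 0) (hk : k ≠ 0) :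
    (reducedB₀ ν c k q (toBCF A) + Λ • reducedB₁ c k).act x y =
      ![(ν * k * Λ * y 0 - y 1) / (ν * k ^ 2 * c), q ^ 2 * (A x : ℂ) ^ 2 * y 0] := by
  ext i
  fin_cases i
  · simp [Coeff.act, Fin.sum_univ_two, reducedB₀, reducedB₁]
    field_simp
    ring
  · simp [Coeff.act, Fin.sum_univ_two, reducedB₀, reducedB₁, hA.toBCF_apply]

theorem fullB₀_periodic (hA : IsWaveProfile A) (ε δ ν c k q : ℂ) :
    (fullB₀ ε δ ν c k q (toBCF A)).Periodic := fun i j x => by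
  have := hA.2.1 x
  fin_cases i <;> fin_cases j <;> simp [fullB₀, hA.toBCF_apply, hA.inverse_apply, this]

theorem fullB₁_periodic (hA : IsWaveProfile A) (ε c k : ℂ) :
    (fullB₁ ε c k (toBCF A)).Periodic := fun i j x => by
  have := hA.2.1 x
  fin_cases i <;> fin_cases j <;> simp [fullB₁, hA.toBCF_apply, this]

theorem reducedB₀_periodic (hA : IsWaveProfile A) (ν c k q : ℂ) :
    (reducedB₀ ν c k q (toBCF A)).Periodic := fun i j x => by
  have := hA.2.1 x
  fin_cases i <;> fin_cases j <;> simp [reducedB₀, hA.toBCF_apply, this]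

theorem reducedB₁_periodic (c k : ℂ) : (reducedB₁ c k).Periodic := fun i j x => by
  fin_cases i <;> fin_cases j <;> simp [reducedB₁]

theorem tendsto_fullB {ι : Type*} {l : Filter ι} {ε δ c k q : ι → ℂ} {ε' δ' c' k' q' : ℂ}
    {a : ι → (ℝ →ᵇ ℂ)} {a' : ℝ →ᵇ ℂ} {ν : ℂ} (hε : Tendsto ε l (𝓝 ε')) (hδ : Tendsto δ l (𝓝 δ'))
    (hc : Tendsto c l (𝓝 c')) (hk : Tendsto k l (𝓝 k')) (hq : Tendsto q l (𝓝 q'))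
    (ha : Tendsto a l (𝓝 a')) (hu : IsUnit a') (hν : ν ≠ 0) (hc' : c' ≠ 0) (hk' : k' ≠ 0) :
    Tendsto (fun i => fullB₀ (ε i) (δ i) ν (c i) (k i) (q i) (a i)) l
        (𝓝 (fullB₀ ε' δ' ν c' k' q' a')) ∧
      Tendsto (fun i => fullB₁ (ε i) (c i) (k i) (a i)) l (𝓝 (fullB₁ ε' c' k' a')) := by
  have hinv : Tendsto (fun i => Ring.inverse (a i)) l (𝓝 (Ring.inverse a')) := by
    obtain ⟨u, rfl⟩ := hu
    exact (NormedRing.inverse_continuousAt u).tendsto.comp ha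
  have h1 : Tendsto (fun _ : ι => (1 : ℝ →ᵇ ℂ)) l (𝓝 1) := tendsto_const_nhds
  have hνt : Tendsto (fun _ : ι => ν) l (𝓝 ν) := tendsto_const_nhds
  constructor
  · refine tendsto_pi_nhds.2 fun i => tendsto_pi_nhds.2 fun j => ?_
    fin_cases i <;> fin_cases j
    · exact ((hε.div ((hνt.mul hk).mul hc) (by simp [*])).smul hinv).sub
        (((hε.mul hc).div (hνt.mul hk) (by simp [*])).smul (ha.pow 2))
    · exact (hε.div (hνt.mul hk) (by simp [*])).smul h1
    · exact ((tendsto_const_nhds.div ((hνt.mul (hk.pow 2)).mul hc) (by simp [*])).neg).smul h1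
    · exact tendsto_const_nhds
    · exact tendsto_const_nhds
    · exact tendsto_const_nhds
    · exact (((hq.pow 2).smul (ha.pow 2)).sub
        ((((hq.const_mul 4).mul hc).mul hδ).smul (ha.pow 3))).add
        ((((hc.pow 2).const_mul 3).mul (hδ.pow 2)).smul (ha.pow 4))
    · exact (((hδ.const_mul 2).mul hq).smul ha).sub
        (((hc.const_mul 2).mul (hδ.pow 2)).smul (ha.pow 2))
    · exact tendsto_const_nhds
  · refine tendsto_pi_nhds.2 fun i => tendsto_pi_nhds.2 fun j => ?_
    fin_cases i <;> fin_cases j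
    · exact (tendsto_const_nhds.div (hk.mul hc) (by simp [*])).smul h1
    · exact tendsto_const_nhds
    · exact tendsto_const_nhds
    · exact (tendsto_const_nhds.div hk hk').smul (ha.pow 2)
    · exact tendsto_const_nhds
    · exact tendsto_const_nhds
    · exact ((hε.mul hc).neg).smul (ha.pow 2)
    · exact hε.smul h1
    · exact tendsto_const_nhds

end Systems

/-! ### Nondegeneracy of the Evans function -/

section Nondegeneracy

variable {A : ℝ → ℝ}

/-- A nondecreasing periodic function has zero derivative. -/
theorem eq_zero_of_periodic_of_deriv_nonneg {E e : ℝ → ℝ} (hE : ∀ x, HasDerivAt E (e x) x)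
    (he : ∀ x, 0 ≤ e x) (hp : Function.Periodic E 1) (x : ℝ) : e x = 0 := by
  have hmono : Monotone E := monotone_of_deriv_nonneg (fun x => (hE x).differentiableAt)
    fun x => by rw [(hE x).deriv]; exact he x
  have hle : ∀ a b, E a ≤ E b := fun a b => by
    obtain ⟨m, hm⟩ := exists_nat_gt (a - b)
    have h1 : E (b + m) = E b := by simpa using hp.nat_mul m b
    rw [← h1]
    exact hmono (by linarith)
  have hconst : E = fun _ => E x := funext fun y => le_antisymm (hle _ _) (hle _ _)
  have h2 := hE x
  rw [hconst] at h2
  exact h2.unique (hasDerivAt_const x (E x))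

theorem hasDerivAt_re {f : ℝ → ℂ} {f' : ℂ} {x : ℝ} (h : HasDerivAt f f' x) :
    HasDerivAt (fun y => (f y).re) f'.re x :=
  (Complex.reCLM.hasFDerivAt.comp_hasDerivAt x h :)

theorem hasDerivAt_im {f : ℝ → ℂ} {f' : ℂ} {x : ℝ} (h : HasDerivAt f f' x) :
    HasDerivAt (fun y => (f y).im) f'.im x :=
  (Complex.imCLM.hasFDerivAt.comp_hasDerivAt x h :)

/-- The real inner product on `ℂ`. -/
def dot (z w : ℂ) : ℝ := z.re * w.re + z.im * w.im

theorem hasDerivAt_dot {f g : ℝ → ℂ} {f' g' : ℂ} {x : ℝ} (hf : HasDerivAt f f' x)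
    (hg : HasDerivAt g g' x) :
    HasDerivAt (fun y => dot (f y) (g y)) (dot f' (g x) + dot (f x) g') x :=
  (((hasDerivAt_re hf).mul (hasDerivAt_re hg)).add
    ((hasDerivAt_im hf).mul (hasDerivAt_im hg))).congr_deriv (by simp only [dot]; ring)

theorem dot_smul_smul {ρ : ℂ} (hρ : ‖ρ‖ = 1) (z w : ℂ) : dot (ρ * z) (ρ * w) = dot z w := by
  have h : ρ.re * ρ.re + ρ.im * ρ.im = 1 := by
    rw [← Complex.normSq_apply, Complex.normSq_eq_norm_sq, hρ, one_pow]
  simp only [dot, Complex.mul_re, Complex.mul_im]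
  linear_combination (z.re * w.re + z.im * w.im) * h

theorem eq_zero_of_dot_self {z : ℂ} (h : dot z z = 0) : z = 0 := by
  have h1 : z.re = 0 := by
    simp only [dot] at h
    nlinarith [mul_self_nonneg z.re, mul_self_nonneg z.im]
  have h2 : z.im = 0 := by
    simp only [dot] at h
    nlinarith [mul_self_nonneg z.re, mul_self_nonneg z.im]
  exact Complex.ext h1 h2

theorem dot_self_nonneg (z : ℂ) : 0 ≤ dot z z :=
  add_nonneg (mul_self_nonneg _) (mul_self_nonneg _)

/-- The equations of the first order system for `(v, g, P)`. -/
theorem full_isSolution_iff (hA : IsWaveProfile A) {ε δ ν c k q Λ : ℂ}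
    (hν : ν ≠ 0) (hc : c ≠ 0) (hk : k ≠ 0) {Y : ℝ → Fin 3 → ℂ} :
    IsSolution (fullB₀ ε δ ν c k q (toBCF A) + Λ • fullB₁ ε c k (toBCF A)) Y ↔ ∀ x,
      HasDerivAt (fun x => Y x 0) ((ε * k * (A x : ℂ)⁻¹ * Y x 0 + ν * k * Λ * Y x 0 - Y x 2
          + ε * k * c * (Y x 1 - c * (A x : ℂ) ^ 2 * Y x 0)) / (ν * k ^ 2 * c)) x ∧
      HasDerivAt (fun x => Y x 1) (Λ / k * (A x : ℂ) ^ 2 * Y x 0) x ∧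
      HasDerivAt (fun x => Y x 2) ((q - c * δ * A x) ^ 2 * (A x : ℂ) ^ 2 * Y x 0
          + (ε * Λ + 2 * δ * A x * (q - c * δ * A x)) * (Y x 1 - c * (A x : ℂ) ^ 2 * Y x 0)) x := by
  refine forall_congr' fun x => ?_
  rw [full_act hA ε δ ν c k q Λ x _ hν hc hk, hasDerivAt_pi, Fin.forall_fin_succ,
    Fin.forall_fin_succ, Fin.forall_fin_one]
  rfl

theorem reduced_isSolution_iff (hA : IsWaveProfile A) {ν c k q Λ : ℂ}
    (hν : ν ≠ 0) (hc : c ≠ 0) (hk : k ≠ 0) {Y : ℝ → Fin 2 → ℂ} :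
    IsSolution (reducedB₀ ν c k q (toBCF A) + Λ • reducedB₁ c k) Y ↔ ∀ x,
      HasDerivAt (fun x => Y x 0) ((ν * k * Λ * Y x 0 - Y x 1) / (ν * k ^ 2 * c)) x ∧
      HasDerivAt (fun x => Y x 1) (q ^ 2 * (A x : ℂ) ^ 2 * Y x 0) x := by
  refine forall_congr' fun x => ?_
  rw [reduced_act hA ν c k q Λ x _ hν hc hk, hasDerivAt_pi, Fin.forall_fin_succ,
    Fin.forall_fin_one]
  rfl

/-- For large real `Λ` the reduced problem has no Floquet multiplier on the unit circle: with
`w = v'`, the quantity `-νk²c v·w + (νkΛ |v|² + νk²c |w|²) / 2` is nondecreasing. -/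
theorem exists_not_hasBloch_reduced (hA : IsWaveProfile A) {ν c k q : ℝ} (hν : 0 < ν) (hc : c ≠ 0)
    (hk : 0 < k) (hq : q ≠ 0) :
    ∃ Λ : ℝ, ∀ ρ : ℂ, ‖ρ‖ = 1 →
      ¬ HasBloch (reducedB₀ ν c k q (toBCF A) + (Λ : ℂ) • reducedB₁ c k) ρ := by
  obtain ⟨m, N, hm, hb⟩ := hA.exists_bounds
  have hNm : m ≤ N := (hb 0).1.trans (hb 0).2.1
  set Λ : ℝ := (ν * k ^ 2 * |c| + q ^ 2 * N ^ 2) / (ν * k) with hΛ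
  have hνk : 0 < ν * k := by positivity
  have hΛ' : ν * k * Λ = ν * k ^ 2 * |c| + q ^ 2 * N ^ 2 := by
    rw [hΛ, mul_div_cancel₀ _ hνk.ne']
  refine ⟨Λ, fun ρ hρ => ?_⟩
  rintro ⟨Y, hY0, hY, hYρ⟩
  have hνc : (ν : ℂ) ≠ 0 := by exact_mod_cast hν.ne'
  have hcc : (c : ℂ) ≠ 0 := by exact_mod_cast hc
  have hkc : (k : ℂ) ≠ 0 := by exact_mod_cast hk.ne'
  rw [reduced_isSolution_iff hA hνc hcc hkc] at hY
  set v : ℝ → ℂ := fun x => Y x 0 with hv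
  set w : ℝ → ℂ := fun x => (ν * k * Λ * Y x 0 - Y x 1) / (ν * k ^ 2 * c) with hw
  have hvd : ∀ x, HasDerivAt v (w x) x := fun x => (hY x).1
  have hwd : ∀ x, HasDerivAt w ((ν * k * Λ * w x - q ^ 2 * (A x : ℂ) ^ 2 * v x)
      / (ν * k ^ 2 * c)) x := fun x =>
    (((hvd x).const_mul ((ν : ℂ) * k * Λ)).sub (hY x).2).div_const _
  set E : ℝ → ℝ := fun x => -(ν * k ^ 2 * c) * dot (v x) (w x) + ν * k * Λ / 2 * dot (v x) (v x)
    + ν * k ^ 2 * c / 2 * dot (w x) (w x) with hE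
  have hEd : ∀ x, HasDerivAt E (q ^ 2 * A x ^ 2 * dot (v x) (v x)
      + (ν * k * Λ - ν * k ^ 2 * c) * dot (w x) (w x) - q ^ 2 * A x ^ 2 * dot (v x) (w x)) x :=
    fun x => by
    have h1 := ((((hasDerivAt_dot (hvd x) (hwd x)).const_mul (-(ν * k ^ 2 * c))).add
      ((hasDerivAt_dot (hvd x) (hvd x)).const_mul (ν * k * Λ / 2))).add
      ((hasDerivAt_dot (hwd x) (hwd x)).const_mul (ν * k ^ 2 * c / 2)))
    refine h1.congr_deriv ?_
    set w' : ℂ := (ν * k * Λ * w x - q ^ 2 * (A x : ℂ) ^ 2 * v x) / (ν * k ^ 2 * c) with hw'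
    have e : ((ν * k ^ 2 * c : ℝ) : ℂ) * w' = ((ν * k * Λ : ℝ) : ℂ) * w x
        - ((q ^ 2 * A x ^ 2 : ℝ) : ℂ) * v x := by
      rw [hw']; push_cast; field_simp
    have er := congrArg Complex.re e
    have ei := congrArg Complex.im e
    simp only [Complex.re_ofReal_mul, Complex.im_ofReal_mul, Complex.sub_re,
      Complex.sub_im] at er ei
    simp only [dot]
    linear_combination (-(v x).re + (w x).re) * er + (-(v x).im + (w x).im) * ei
  have hlow : ∀ x, q ^ 2 * A x ^ 2 / 2 * dot (v x) (v x) ≤ q ^ 2 * A x ^ 2 * dot (v x) (v x)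
      + (ν * k * Λ - ν * k ^ 2 * c) * dot (w x) (w x) - q ^ 2 * A x ^ 2 * dot (v x) (w x) :=
    fun x => by
    have hAN : A x ^ 2 ≤ N ^ 2 := pow_le_pow_left₀ (hA.2.2 x).le (hb x).2.1 2
    have h1 : 0 ≤ dot (v x) (v x) + dot (w x) (w x) - 2 * dot (v x) (w x) := by
      simp only [dot]
      nlinarith [sq_nonneg ((v x).re - (w x).re), sq_nonneg ((v x).im - (w x).im)]
    have h2 := dot_self_nonneg (w x)
    have h3 : 0 ≤ q ^ 2 * A x ^ 2 := by positivity
    have h4 : q ^ 2 * A x ^ 2 ≤ ν * k * Λ - ν * k ^ 2 * c := by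
      have h5 : ν * k ^ 2 * c ≤ ν * k ^ 2 * |c| := by
        gcongr; exact le_abs_self c
      have h6 : q ^ 2 * A x ^ 2 ≤ q ^ 2 * N ^ 2 := by gcongr
      linarith
    nlinarith [mul_nonneg h3 h1, mul_le_mul_of_nonneg_right h4 h2, mul_nonneg h3 h2]
  have hvp : ∀ x, v (x + 1) = ρ * v x := fun x => by simp [hv, hYρ x]
  have hwp : ∀ x, w (x + 1) = ρ * w x := fun x => by simp [hw, hYρ x]; ring
  have hEp : Function.Periodic E 1 := fun x => by
    simp only [hE, hvp, hwp, dot_smul_smul hρ]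
  have hzero := eq_zero_of_periodic_of_deriv_nonneg hEd
    (fun x => le_trans (mul_nonneg (by positivity) (dot_self_nonneg _)) (hlow x)) hEp
  have hv0 : ∀ x, v x = 0 := fun x => by
    have h1 := hlow x
    rw [hzero x] at h1
    have hp : 0 < q ^ 2 * A x ^ 2 / 2 := by
      have := hA.2.2 x; positivity
    exact eq_zero_of_dot_self (le_antisymm (nonpos_of_mul_nonpos_right h1 hp) (dot_self_nonneg _))
  have hw0 : ∀ x, w x = 0 := fun x => by
    have h1 := hvd x
    rw [show v = fun _ => 0 from funext hv0] at h1
    exact h1.unique (hasDerivAt_const x (0 : ℂ))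
  refine hY0 (funext fun x => funext fun i => ?_)
  have h1 : Y x 0 = 0 := hv0 x
  have h2 := hw0 x
  simp only [hw, h1, mul_zero, zero_sub] at h2
  rw [div_eq_zero_iff, neg_eq_zero] at h2
  have h3 := h2.resolve_right (by simp [hνc, hcc, hkc])
  fin_cases i
  · exact h1
  · exact h3

/-- Lower bound for the derivative of the energy in `exists_not_hasBloch_critical`: the mixed terms
in `a d` are absorbed by completing the square. -/
theorem quadratic_form_bound {Λ κ k q m m₀ N a b d : ℝ} (hm₀ : 0 < m₀) (hm : m₀ ≤ m)
    (hκ : |κ - k| ≤ N) (hΛ : Λ = 1 + q ^ 2 + N ^ 2 / m₀) :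
    a * a + b * b ≤ a * (Λ * a - k * d) + b * (q ^ 2 * a + Λ * b) + (κ * a + m * d) * d := by
  have h1 : (κ - k) ^ 2 ≤ N ^ 2 := sq_le_sq' (by linarith [(abs_le.1 hκ).1]) (abs_le.1 hκ).2
  have h2 : N ^ 2 / m₀ * m₀ = N ^ 2 := div_mul_cancel₀ _ hm₀.ne'
  set S := N ^ 2 / m₀ with hS
  have hS0 : 0 ≤ S := by positivity
  have h3 : 0 ≤ S * (a * a) + (κ - k) * a * d + m₀ * d ^ 2 := by
    have : 0 ≤ m₀ * (S * (a * a) + (κ - k) * a * d + m₀ * d ^ 2) := by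
      nlinarith [sq_nonneg (m₀ * d + (κ - k) * a / 2),
        mul_nonneg (sub_nonneg.2 h1) (mul_self_nonneg a),
        mul_nonneg (sq_nonneg N) (mul_self_nonneg a)]
    exact nonneg_of_mul_nonneg_right this hm₀
  rw [hΛ]
  nlinarith [sq_nonneg (a + b), mul_nonneg (sq_nonneg q) (sq_nonneg (a + b)),
    mul_nonneg (sq_nonneg q) (mul_self_nonneg a), mul_nonneg (sq_nonneg q) (mul_self_nonneg b),
    mul_nonneg (sub_nonneg.2 hm) (sq_nonneg d), mul_nonneg hS0 (mul_self_nonneg b)]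

/-- For large real `Λ` the critical problem has no Floquet multiplier on the unit circle: with
`s` the linearized flux, `kc (|a|² + |b|²) / 2 + s·b` is nondecreasing. -/
theorem exists_not_hasBloch_critical (hA : IsWaveProfile A) {ν c k q : ℝ} (hν : 0 < ν) (hc : c ≠ 0)
    (hk : 0 < k) :
    ∃ Λ : ℝ, ∀ ρ : ℂ, ‖ρ‖ = 1 →
      ¬ HasBloch (fullB₀ 1 0 ν c k q (toBCF A) + (Λ : ℂ) • fullB₁ 1 c k (toBCF A)) ρ := by
  obtain ⟨m, N, hm, hb⟩ := hA.exists_bounds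
  have hN0 : 0 < N := hm.trans_le ((hb 0).1.trans (hb 0).2.1)
  set N' : ℝ := (k + 2 * ν * k ^ 2 * |c| * N) / m ^ 3 + k with hN'
  set m₀ : ℝ := ν * k ^ 2 / N ^ 2 with hm₀
  have hm₀' : 0 < m₀ := by positivity
  refine ⟨1 + q ^ 2 + N' ^ 2 / m₀, fun ρ hρ => ?_⟩
  set Λ : ℝ := 1 + q ^ 2 + N' ^ 2 / m₀ with hΛ
  rintro ⟨Y, hY0, hY, hYρ⟩
  have hνc : (ν : ℂ) ≠ 0 := by exact_mod_cast hν.ne'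
  have hcc : (c : ℂ) ≠ 0 := by exact_mod_cast hc
  have hkc : (k : ℂ) ≠ 0 := by exact_mod_cast hk.ne'
  rw [full_isSolution_iff hA hνc hcc hkc] at hY
  set v : ℝ → ℂ := fun x => Y x 0 with hv
  set g : ℝ → ℂ := fun x => Y x 1 with hg
  set a : ℝ → ℂ := fun x => (A x : ℂ) ^ 2 * v x with ha
  set b : ℝ → ℂ := fun x => g x - c * a x with hbd
  set s : ℝ → ℂ := fun x => Y x 2 - k * c * b x with hs
  have hA0 : ∀ x, (A x : ℂ) ≠ 0 := fun x => by exact_mod_cast (hA.2.2 x).ne'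
  have hbx : ∀ x, Y x 1 - c * (A x : ℂ) ^ 2 * Y x 0 = b x := fun x => by
    simp only [hbd, ha, hv, hg]; ring
  set v' : ℝ → ℂ := fun x => (k * (A x : ℂ)⁻¹ * v x + ν * k * Λ * v x - Y x 2
    + k * c * b x) / (ν * k ^ 2 * c) with hv'
  have hvd : ∀ x, HasDerivAt v (v' x) x := fun x => (hY x).1.congr_deriv (by
    rw [hbx]; simp only [hv', one_mul, hv])
  have hgd : ∀ x, HasDerivAt g (Λ / k * a x) x := fun x => (hY x).2.1.congr_deriv (by
    simp only [ha, hv]; ring)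
  have hPd : ∀ x, HasDerivAt (fun x => Y x 2) (q ^ 2 * a x + Λ * b x) x := fun x =>
    (hY x).2.2.congr_deriv (by
      rw [hbx]; simp only [ha, hv]; ring)
  have hAd : ∀ x, HasDerivAt (fun x => (A x : ℂ)) (deriv A x : ℝ) x := fun x =>
    (hA.hasDerivAt x).ofReal_comp
  set a' : ℝ → ℂ := fun x => 2 * A x * (deriv A x : ℝ) * v x + (A x : ℂ) ^ 2 * v' x with ha'
  have had : ∀ x, HasDerivAt a (a' x) x := fun x =>
    (((hAd x).pow 2).mul (hvd x)).congr_deriv (by simp [ha'])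
  set b' : ℝ → ℂ := fun x => Λ / k * a x - c * a' x with hb'
  have hbd' : ∀ x, HasDerivAt b (b' x) x := fun x => (hgd x).sub ((had x).const_mul (c : ℂ))
  set s' : ℝ → ℂ := fun x => q ^ 2 * a x + Λ * b x - k * c * b' x with hs'
  have hsd : ∀ x, HasDerivAt s (s' x) x := fun x =>
    (hPd x).sub ((hbd' x).const_mul ((k : ℂ) * c))
  set κ : ℝ → ℝ := fun x => (k + 2 * ν * k ^ 2 * c * deriv A x) / A x ^ 3 with hκ
  have hsx : ∀ x, s x = (κ x : ℂ) * a x + ((ν * k ^ 2 / A x ^ 2 : ℝ) : ℂ) * b' x := fun x => by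
    have h1 : (ν * k ^ 2 * c : ℂ) * v' x = k * (A x : ℂ)⁻¹ * v x + ν * k * Λ * v x - Y x 2
        + k * c * b x := by
      simp only [hv']; field_simp
    have h2 : s x = k * (A x : ℂ)⁻¹ * v x + ν * k * Λ * v x - (ν * k ^ 2 * c : ℂ) * v' x := by
      rw [h1]; simp only [hs]; ring
    rw [h2]
    simp only [hκ, hb', ha', ha]
    have := hA0 x
    push_cast
    field_simp
    ring
  set E : ℝ → ℝ := fun x => k * c / 2 * dot (a x) (a x) + k * c / 2 * dot (b x) (b x)
    + dot (s x) (b x) with hE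
  have hEd : ∀ x, HasDerivAt E (dot (a x) (Λ * a x - k * b' x)
      + dot (b x) (q ^ 2 * a x + Λ * b x) + dot (s x) (b' x)) x := fun x => by
    have h1 := (((hasDerivAt_dot (had x) (had x)).const_mul (k * c / 2)).add
      ((hasDerivAt_dot (hbd' x) (hbd' x)).const_mul (k * c / 2))).add
      (hasDerivAt_dot (hsd x) (hbd' x))
    refine h1.congr_deriv ?_
    have e1 : ((Λ : ℂ) * a x - k * b' x) = ((k * c : ℝ) : ℂ) * a' x := by
      simp only [hb']; push_cast; field_simp; ring
    have e2 : q ^ 2 * a x + Λ * b x = s' x + ((k * c : ℝ) : ℂ) * b' x := by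
      simp only [hs']; push_cast; ring
    rw [e1, e2]
    simp only [dot, Complex.add_re, Complex.add_im, Complex.re_ofReal_mul, Complex.im_ofReal_mul]
    ring
  have hlow : ∀ x, dot (a x) (a x) + dot (b x) (b x) ≤ dot (a x) (Λ * a x - k * b' x)
      + dot (b x) (q ^ 2 * a x + Λ * b x) + dot (s x) (b' x) := fun x => by
    have hAx := hA.2.2 x
    have hmA : m₀ ≤ ν * k ^ 2 / A x ^ 2 := by
      rw [hm₀]
      gcongr
      exact (hb x).2.1
    have hκb : |κ x - k| ≤ N' := by
      refine (abs_sub _ _).trans ?_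
      rw [abs_of_pos hk, hN']
      gcongr
      simp only [hκ]
      rw [abs_div, abs_of_pos (pow_pos hAx 3)]
      have h1 : |k + 2 * ν * k ^ 2 * c * deriv A x| ≤ k + 2 * ν * k ^ 2 * |c| * N := by
        refine (abs_add_le _ _).trans ?_
        rw [abs_of_pos hk, abs_mul, abs_mul, abs_of_pos (by positivity : 0 < 2 * ν * k ^ 2)]
        gcongr
        exact (hb x).2.2
      gcongr
      exact (hb x).1
    have e2 : (q : ℂ) ^ 2 = ((q ^ 2 : ℝ) : ℂ) := by push_cast; rfl
    rw [hsx, e2]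
    simp only [dot, Complex.add_re, Complex.add_im, Complex.sub_re, Complex.sub_im,
      Complex.re_ofReal_mul, Complex.im_ofReal_mul]
    have h1 := quadratic_form_bound (a := (a x).re) (b := (b x).re) (d := (b' x).re) (q := q)
      hm₀' hmA hκb hΛ
    have h2 := quadratic_form_bound (a := (a x).im) (b := (b x).im) (d := (b' x).im) (q := q)
      hm₀' hmA hκb hΛ
    linarith
  have hap : ∀ x, a (x + 1) = ρ * a x := fun x => by
    simp only [ha, hv, hYρ x, hA.2.1 x, Pi.smul_apply, smul_eq_mul]; ring
  have hbp : ∀ x, b (x + 1) = ρ * b x := fun x => by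
    simp only [hbd, hap, hg, hYρ x, Pi.smul_apply, smul_eq_mul]; ring
  have hsp : ∀ x, s (x + 1) = ρ * s x := fun x => by
    simp only [hs, hbp, hYρ x, Pi.smul_apply, smul_eq_mul]; ring
  have hEp : Function.Periodic E 1 := fun x => by
    simp only [hE, hap, hbp, hsp, dot_smul_smul hρ]
  have hzero := eq_zero_of_periodic_of_deriv_nonneg hEd
    (fun x => le_trans (add_nonneg (dot_self_nonneg _) (dot_self_nonneg _)) (hlow x)) hEp
  have hab : ∀ x, a x = 0 ∧ b x = 0 := fun x => by
    have h1 := hlow x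
    rw [hzero x] at h1
    have h2 := dot_self_nonneg (a x)
    have h3 := dot_self_nonneg (b x)
    exact ⟨eq_zero_of_dot_self (by linarith), eq_zero_of_dot_self (by linarith)⟩
  have hv0 : ∀ x, v x = 0 := fun x => by
    have h1 : (A x : ℂ) ^ 2 * v x = 0 := (hab x).1
    exact (mul_eq_zero.1 h1).resolve_left (pow_ne_zero 2 (hA0 x))
  have hg0 : ∀ x, g x = 0 := fun x => by
    have h1 : g x - c * a x = 0 := (hab x).2
    rw [(hab x).1] at h1
    simpa using h1
  have hv'0 : ∀ x, v' x = 0 := fun x => by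
    have h1 := hvd x
    rw [show v = fun _ => 0 from funext hv0] at h1
    exact h1.unique (hasDerivAt_const x (0 : ℂ))
  refine hY0 (funext fun x => funext fun i => ?_)
  have h2 := hv'0 x
  simp only [hv', hv0, (hab x).2, mul_zero, zero_sub, add_zero] at h2
  rw [div_eq_zero_iff, neg_eq_zero] at h2
  have h3 := h2.resolve_right (by simp [hνc, hcc, hkc])
  fin_cases i
  · exact hv0 x
  · exact hg0 x
  · exact h3

end Nondegeneracy

/-! ### The decoupled system -/

section Decoupling

variable {A : ℝ → ℝ}

/-- A Floquet solution of the reduced problem extends to the decoupled full problem. -/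
theorem HasBloch.full_of_reduced (hA : IsWaveProfile A) {ν c k q Λ ρ : ℂ} (hν : ν ≠ 0) (hc : c ≠ 0)
    (hk : k ≠ 0) (hq : q ≠ 0) (h : HasBloch (reducedB₀ ν c k q (toBCF A) + Λ • reducedB₁ c k) ρ) :
    HasBloch (fullB₀ 0 0 ν c k q (toBCF A) + Λ • fullB₁ 0 c k (toBCF A)) ρ := by
  obtain ⟨Y, hY0, hY, hYρ⟩ := h
  rw [reduced_isSolution_iff hA hν hc hk] at hY
  refine ⟨fun x => ![Y x 0, Λ / (k * q ^ 2) * Y x 1, Y x 1], fun h0 => hY0 ?_, ?_, fun x => ?_⟩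
  · refine funext fun x => funext fun i => ?_
    have h1 := congrFun h0 x
    fin_cases i
    · exact congrFun h1 0
    · exact congrFun h1 2
  · rw [full_isSolution_iff hA hν hc hk]
    refine fun x => ⟨(hY x).1.congr_deriv ?_, ((hY x).2.const_mul _).congr_deriv ?_,
      (hY x).2.congr_deriv ?_⟩
    · simp
    · simp; field_simp
    · simp
  · beta_reduce
    rw [hYρ x]
    ext i
    fin_cases i
    · simp
    · simp; ring
    · simp

/-- The decoupled full problem has no multiplier `ρ ≠ 1` beyond those of the reduced problem. -/
theorem HasBloch.reduced_of_full (hA : IsWaveProfile A) {ν c k q Λ ρ : ℂ} (hν : ν ≠ 0) (hc : c ≠ 0)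
    (hk : k ≠ 0) (hρ : ρ ≠ 1)
    (h : HasBloch (fullB₀ 0 0 ν c k q (toBCF A) + Λ • fullB₁ 0 c k (toBCF A)) ρ) :
    HasBloch (reducedB₀ ν c k q (toBCF A) + Λ • reducedB₁ c k) ρ := by
  obtain ⟨Y, hY0, hY, hYρ⟩ := h
  rw [full_isSolution_iff hA hν hc hk] at hY
  refine ⟨fun x => ![Y x 0, Y x 2], fun h0 => hY0 ?_, ?_, fun x => ?_⟩
  · have h1 : ∀ x, Y x 0 = 0 := fun x => congrFun (congrFun h0 x) 0
    have h2 : ∀ x, Y x 2 = 0 := fun x => congrFun (congrFun h0 x) 1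
    have hd : ∀ x, HasDerivAt (fun x => Y x 1) 0 x := fun x =>
      (hY x).2.1.congr_deriv (by rw [h1]; simp)
    have h3 : ∀ x, Y x 1 = 0 := fun x => by
      have h4 : Y (x + 1) 1 = Y x 1 := is_const_of_deriv_eq_zero
        (fun y => (hd y).differentiableAt) (fun y => (hd y).deriv) (x + 1) x
      rw [hYρ x, Pi.smul_apply, smul_eq_mul] at h4
      have h5 : (ρ - 1) * Y x 1 = 0 := by rw [sub_mul, h4]; ring
      exact (mul_eq_zero.1 h5).resolve_left (sub_ne_zero.2 hρ)
    refine funext fun x => funext fun i => ?_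
    fin_cases i
    · exact h1 x
    · exact h3 x
    · exact h2 x
  · rw [reduced_isSolution_iff hA hν hc hk]
    refine fun x => ⟨(hY x).1.congr_deriv ?_, (hY x).2.2.congr_deriv ?_⟩
    · simp
    · simp
  · beta_reduce
    rw [hYρ x]
    ext i
    fin_cases i <;> simp

end Decoupling

/-! ### Square integrable solutions -/

section SquareIntegrable

theorem memLp_of_forall_eq {f g : ℝ → ℂ} (hf : MemLp f 2 volume) (h : ∀ x, g x = f x) :
    MemLp g 2 volume :=
  (congrArg (fun u => MemLp u 2 volume) (funext h)).mpr hf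

theorem memLp_periodic_mul {w f : ℝ → ℂ} (hw : Continuous w) (hp : Function.Periodic w 1)
    (hf : MemLp f 2 volume) : MemLp (fun x => w x * f x) 2 volume := by
  obtain ⟨C, hC⟩ := exists_norm_le_of_periodic hw.norm fun x => by rw [hp x]
  refine hf.of_le_mul (c := C) (hw.aestronglyMeasurable.mul hf.1) (ae_of_all _ fun x => ?_)
  rw [norm_mul]
  gcongr
  simpa using hC x

theorem norm_sq_eq_integral (w : L2R) : ‖w‖ ^ 2 = ∫ x, ‖w x‖ ^ 2 := by
  rw [← norm_toLp_sq (Lp.memLp w), Lp.toLp_coeFn]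

theorem integrable_norm_sq {E : Type*} [NormedAddCommGroup E] {f : ℝ → E}
    (hf : MemLp f 2 volume) : Integrable fun x => ‖f x‖ ^ 2 := by
  simpa using hf.integrable_norm_pow (by norm_num : (2 : ℕ) ≠ 0)

theorem norm_sq_le_of_ae_le {n : ℕ} {Y : ℝ → Fin n → ℂ} (hY : MemLp Y 2 volume) {w : L2R} {K : ℝ}
    (h : ∀ᵐ x, ‖w x‖ ≤ K * ‖Y x‖) : ‖w‖ ^ 2 ≤ K ^ 2 * ∫ x, ‖Y x‖ ^ 2 := by
  rw [norm_sq_eq_integral, ← integral_const_mul]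
  refine integral_mono_ae (integrable_norm_sq (Lp.memLp w))
    ((integrable_norm_sq hY).const_mul _) ?_
  filter_upwards [h] with x hx
  rw [← mul_pow]
  exact pow_le_pow_left₀ (norm_nonneg _) hx 2

/-- The components of an integral solution are primitives of the components of the equation. -/
theorem isMild_iff {n : ℕ} {B : Coeff n} {f Y : ℝ → Fin n → ℂ} (hf : LocallyIntegrable f volume) :
    IsMild B f Y ↔
      ∀ i, HasIntegralDeriv (fun x => Y x i) fun x => B.act x (Y x) i + f x i := by
  have hfi : ∀ i, LocallyIntegrable (fun x => f x i) volume := fun i => by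
    rw [locallyIntegrable_iff] at hf ⊢
    exact fun K hK => Integrable.eval (hf K hK) i
  have hcomp : ∀ {g : ℝ → Fin n → ℂ}, (∀ a b, IntervalIntegrable g volume a b) → ∀ a b i,
      (∫ t in a..b, g t) i = ∫ t in a..b, g t i := fun {g} hg a b i =>
    ((ContinuousLinearMap.proj (R := ℂ) (φ := fun _ : Fin n => ℂ) i).intervalIntegral_comp_comm
      (hg a b)).symm
  constructor
  · intro h i
    refine ⟨((continuous_apply i).comp (B.continuous_act h.1)).locallyIntegrable.add (hfi i),
      fun x => ?_⟩
    have h1 := congrFun (h.2 x) i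
    rw [Pi.add_apply, hcomp (h.intervalIntegrable hf)] at h1
    exact h1
  · intro h
    have hY : Continuous Y := continuous_pi fun i => (h i).continuous
    refine ⟨hY, fun x => funext fun i => ?_⟩
    rw [Pi.add_apply, hcomp fun a b => ((B.continuous_act hY).intervalIntegrable a b).add
      (intervalIntegrable_of_locallyIntegrable hf a b)]
    exact (h i).2 x

end SquareIntegrable

/-! ### Bounded inverses of the limiting problems -/

section Resolvent

/-- An operator given by its graph has a bounded inverse once its equation is equivalent, with
control of norms, to a periodic first order system without Floquet multipliers on the unit circle.
Here `Φ r` is the forcing of the system that belongs to the right-hand side `r`, and `W w Y` says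
that the solution `Y` of the system represents `w`. -/
theorem hasBoundedInverse_of_not_hasBloch {X : Type*} [NormedAddCommGroup X] {n : ℕ} {B : Coeff n}
    (hB : B.Periodic) (hno : ∀ ρ : ℂ, ‖ρ‖ = 1 → ¬ HasBloch B ρ) {T : X → X → Prop}
    {Φ : X → ℝ → Fin n → ℂ} {W : X → (ℝ → Fin n → ℂ) → Prop} {K K' : ℝ} (hK' : 0 ≤ K')
    (hΦ : ∀ r, MemLp (Φ r) 2 volume) (hΦK : ∀ r, ∫ x, ‖Φ r x‖ ^ 2 ≤ K * ‖r‖ ^ 2)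
    (hTY : ∀ w r, T w r → ∃ Y, IsMild B (Φ r) Y ∧ MemLp Y 2 volume ∧ W w Y)
    (hYT : ∀ r Y, IsMild B (Φ r) Y → MemLp Y 2 volume → ∃ w, T w r)
    (hW : ∀ w w' Y Y', W w Y → W w' Y' → Y =ᵐ[volume] Y' → w = w')
    (hWK : ∀ w Y, MemLp Y 2 volume → W w Y → ‖w‖ ^ 2 ≤ K' * ∫ x, ‖Y x‖ ^ 2) :
    HasBoundedInverse T := by
  obtain ⟨hex, C, hC0, hC⟩ := exists_memLp_isMild hB hno
  refine ⟨fun r => ?_, √(K' * (C * K)), fun w r hwr => ?_⟩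
  · obtain ⟨Y, hY, hYm⟩ := hex _ (hΦ r)
    obtain ⟨w, hw⟩ := hYT r Y hY hYm
    refine ⟨w, hw, fun w' hw' => ?_⟩
    obtain ⟨Y₁, hY₁, hYm₁, hW₁⟩ := hTY w r hw
    obtain ⟨Y₂, hY₂, hYm₂, hW₂⟩ := hTY w' r hw'
    refine hW _ _ _ _ hW₂ hW₁ ?_
    have hloc := memLp_two_locallyIntegrable (hΦ r)
    have h1 := hC _ _ ((hΦ r).sub (hΦ r)) (hYm₂.sub hYm₁) (hY₂.sub hloc hloc hY₁)
    have h2 : ∫ x, ‖(Φ r - Φ r) x‖ ^ 2 = 0 := by simp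
    rw [h2, mul_zero] at h1
    have h3 := (integral_eq_zero_iff_of_nonneg (fun x => by positivity)
      (integrable_norm_sq (hYm₂.sub hYm₁))).1 (le_antisymm h1
        (integral_nonneg fun x => by positivity))
    filter_upwards [h3] with x hx
    have h4 : ‖(Y₂ - Y₁) x‖ ^ 2 = 0 := hx
    exact sub_eq_zero.1 (norm_eq_zero.1 (pow_eq_zero_iff (two_ne_zero)|>.1 h4))
  · obtain ⟨Y, hY, hYm, hWY⟩ := hTY w r hwr
    have h1 : ‖w‖ ^ 2 ≤ K' * (C * K) * ‖r‖ ^ 2 :=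
      calc ‖w‖ ^ 2 ≤ K' * ∫ x, ‖Y x‖ ^ 2 := hWK w Y hYm hWY
        _ ≤ K' * (C * (K * ‖r‖ ^ 2)) := by
          gcongr
          exact (hC _ _ (hΦ r) hYm hY).trans (by gcongr; exact hΦK r)
        _ = K' * (C * K) * ‖r‖ ^ 2 := by ring
    rw [← Real.sqrt_sq (norm_nonneg w), ← Real.sqrt_sq (norm_nonneg r),
      ← Real.sqrt_mul' _ (sq_nonneg _)]
    exact Real.sqrt_le_sqrt h1

variable {A : ℝ → ℝ}

/-- The limiting problem for `α > -2` is the reduced system for `(v, P)`, where `v = a/A²` and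
`P = νkΛv - νk²cv'`, with forcing `(0, r)`. -/
theorem hasBoundedInverse_hamiltonianLimitEq (hA : IsWaveProfile A) {ν c k q : ℝ} (hν : 0 < ν)
    (hc : c ≠ 0) (hk : 0 < k) {Λ : ℂ} (hno : ∀ ρ : ℂ, ‖ρ‖ = 1 →
      ¬ HasBloch (reducedB₀ ν c k q (toBCF A) + Λ • reducedB₁ c k) ρ) :
    HasBoundedInverse (HamiltonianLimitEq ν c k q A Λ) := by
  have hνc : (ν : ℂ) ≠ 0 := by exact_mod_cast hν.ne'
  have hcc : (c : ℂ) ≠ 0 := by exact_mod_cast hc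
  have hkc : (k : ℂ) ≠ 0 := by exact_mod_cast hk.ne'
  have hA0 : ∀ x, (A x : ℂ) ≠ 0 := fun x => by exact_mod_cast (hA.2.2 x).ne'
  obtain ⟨m, N, hm, hb⟩ := hA.exists_bounds
  have hAc : Continuous fun x => (A x : ℂ) := Complex.continuous_ofReal.comp hA.continuous
  have hA2 : Continuous fun x => (A x : ℂ) ^ 2 := hAc.pow 2
  have hA2p : Function.Periodic (fun x => (A x : ℂ) ^ 2) 1 := fun x => by simp only [hA.2.1 x]
  have hAi : Continuous fun x => ((1 / A x ^ 2 : ℝ) : ℂ) :=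
    Complex.continuous_ofReal.comp
      (continuous_const.div (hA.continuous.pow 2) fun x => pow_ne_zero 2 (hA.2.2 x).ne')
  have hAip : Function.Periodic (fun x => ((1 / A x ^ 2 : ℝ) : ℂ)) 1 := fun x => by
    simp only [hA.2.1 x]
  have hΦ : ∀ r : L2R, MemLp (fun x => ![0, r x]) 2 volume := fun r => by
    refine MemLp.of_eval fun i => ?_
    fin_cases i
    · exact MemLp.zero'
    · exact Lp.memLp r
  have hact := fun x y => reduced_act hA (ν : ℂ) c k q Λ x y hνc hcc hkc
  refine hasBoundedInverse_of_not_hasBloch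
    ((reducedB₀_periodic hA ν c k q).add_smul (reducedB₁_periodic c k) Λ) hno
    (Φ := fun r x => ![0, r x]) (W := fun a Y => ∀ᵐ x, a x = (A x : ℂ) ^ 2 * Y x 0)
    (K := 1) (K' := (N ^ 2) ^ 2) (by positivity) hΦ (fun r => ?_) ?_ ?_ ?_ ?_
  · rw [one_mul, norm_sq_eq_integral]
    refine integral_mono_ae (integrable_norm_sq (hΦ r)) (integrable_norm_sq (Lp.memLp r))
      (ae_of_all _ fun x => ?_)
    refine pow_le_pow_left₀ (norm_nonneg _) ((pi_norm_le_iff_of_nonneg (norm_nonneg _)).2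
      fun i => ?_) 2
    fin_cases i <;> simp
  · rintro a r ⟨v', v'', hv, hv', heq⟩
    obtain ⟨V, hV, hVd⟩ := exists_hasIntegralDeriv hv
    obtain ⟨V', hV', hVd'⟩ := exists_hasIntegralDeriv hv'
    have ha : ∀ᵐ x, a x = (A x : ℂ) ^ 2 * V x := by
      filter_upwards [hV] with x hx
      rw [← hx]
      have := hA0 x
      push_cast
      field_simp
    have hVm : MemLp V 2 volume :=
      (memLp_congr_ae hV).1 (memLp_periodic_mul hAi hAip (Lp.memLp a))
    have hVm' : MemLp V' 2 volume := (memLp_congr_ae hV').1 (Lp.memLp v')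
    refine ⟨fun x => ![V x, ν * k * Λ * V x - ν * k ^ 2 * c * V' x], ?_, ?_, ha⟩
    · refine (isMild_iff (memLp_two_locallyIntegrable (hΦ r))).2 fun i => ?_
      simp only [hact]
      fin_cases i
      · refine hVd.congr ?_
        filter_upwards [hV'] with x hx
        simp [hx]
        field_simp
      · refine ((hVd.const_mul (ν * k * Λ)).sub (hVd'.const_mul (ν * k ^ 2 * c))).congr ?_
        filter_upwards [heq, ha] with x hx hax
        simp
        rw [← hx, hax]
        ring
    · refine MemLp.of_eval fun i => ?_
      fin_cases i
      · exact hVm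
      · exact (hVm.const_mul _).sub (hVm'.const_mul _)
  · intro r Y hY hYm
    have hd := (isMild_iff (memLp_two_locallyIntegrable (hΦ r))).1 hY
    simp only [hact] at hd
    have hd0 := hd 0
    have hd1 := hd 1
    simp only [Matrix.cons_val_zero, Matrix.cons_val_one, add_zero] at hd0 hd1
    have hY0 : MemLp (fun x => Y x 0) 2 volume := hYm.eval 0
    have hY1 : MemLp (fun x => Y x 1) 2 volume := hYm.eval 1
    have ha : MemLp (fun x => (A x : ℂ) ^ 2 * Y x 0) 2 volume := memLp_periodic_mul hA2 hA2p hY0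
    set V' : ℝ → ℂ := fun x => (ν * k * Λ * Y x 0 - Y x 1) / (ν * k ^ 2 * c) with hV'
    have hVm' : MemLp V' 2 volume := by
      refine memLp_of_forall_eq (((hY0.const_mul (ν * k * Λ)).sub hY1).const_mul
        (ν * k ^ 2 * c : ℂ)⁻¹) fun x => ?_
      simp [hV', div_eq_inv_mul]
    have hVd' := ((hd0.const_mul (ν * k * Λ)).sub hd1).const_mul (ν * k ^ 2 * c : ℂ)⁻¹
    have hm'' : MemLp (fun x => (ν * k ^ 2 * c : ℂ)⁻¹ * (ν * k * Λ * V' x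
        - (q ^ 2 * (A x : ℂ) ^ 2 * Y x 0 + r x))) 2 volume := by
      refine memLp_of_forall_eq (((hVm'.const_mul (ν * k * Λ)).sub
        ((ha.const_mul ((q : ℂ) ^ 2)).add (Lp.memLp r))).const_mul (ν * k ^ 2 * c : ℂ)⁻¹)
        fun x => ?_
      simp only [Pi.sub_apply, Pi.add_apply]
      ring
    refine ⟨ha.toLp _, hVm'.toLp _, hm''.toLp _, ?_, ?_, ?_⟩
    · refine (hd0.congr hVm'.coeFn_toLp.symm).hasWeakDeriv ?_
      filter_upwards [ha.coeFn_toLp] with x hx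
      rw [hx]
      have := hA0 x
      push_cast
      field_simp
    · refine (hVd'.congr hm''.coeFn_toLp.symm).hasWeakDeriv ?_
      filter_upwards [hVm'.coeFn_toLp] with x hx
      rw [hx]
      simp [hV', div_eq_inv_mul]
    · filter_upwards [ha.coeFn_toLp, hVm'.coeFn_toLp, hm''.coeFn_toLp] with x h1 h2 h3
      rw [h1, h2, h3]
      field_simp
      ring
  · intro w w' Y Y' hw hw' hYY
    refine Lp.ext ?_
    filter_upwards [hw, hw', hYY] with x h1 h2 h3
    rw [h1, h2, h3]
  · intro w Y hYm hw
    refine norm_sq_le_of_ae_le hYm ?_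
    filter_upwards [hw] with x hx
    rw [hx, norm_mul, norm_pow, Complex.norm_real, Real.norm_of_nonneg (hA.2.2 x).le]
    have := (hb x).2.1
    have h2 := (hA.2.2 x).le
    gcongr
    exact norm_le_pi_norm (Y x) 0

end Resolvent

section Critical

variable {A : ℝ → ℝ}

/-- The limiting problem for `α = -2` is the full system with `ε = 1`, `δ = 0` for `(v, g, P)`, with
forcing `(-A⁻²r₁/(kc), -r₁/k, -r₂)`. -/
theorem hasBoundedInverse_criticalLimitEq (hA : IsWaveProfile A) {ν c k q : ℝ} (hν : 0 < ν)
    (hc : c ≠ 0) (hk : 0 < k) {Λ : ℂ} (hno : ∀ ρ : ℂ, ‖ρ‖ = 1 →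
      ¬ HasBloch (fullB₀ 1 0 ν c k q (toBCF A) + Λ • fullB₁ 1 c k (toBCF A)) ρ) :
    HasBoundedInverse (CriticalLimitEq ν c k q A Λ) := by
  have hνc : (ν : ℂ) ≠ 0 := by exact_mod_cast hν.ne'
  have hcc : (c : ℂ) ≠ 0 := by exact_mod_cast hc
  have hkc : (k : ℂ) ≠ 0 := by exact_mod_cast hk.ne'
  have hA0 : ∀ x, (A x : ℂ) ≠ 0 := fun x => by exact_mod_cast (hA.2.2 x).ne'
  obtain ⟨m, N, hm, hb⟩ := hA.exists_bounds
  have hN0 : 0 < N := hm.trans_le ((hb 0).1.trans (hb 0).2.1)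
  have hAc : Continuous fun x => (A x : ℂ) := Complex.continuous_ofReal.comp hA.continuous
  have hdc : Continuous fun x => ((deriv A x : ℝ) : ℂ) :=
    Complex.continuous_ofReal.comp hA.continuous_deriv
  have hdp : Function.Periodic (deriv A) 1 := hA.periodic_deriv
  have hAd : ∀ x, HasDerivAt (fun x => (A x : ℂ)) (deriv A x : ℝ) x := fun x =>
    (hA.hasDerivAt x).ofReal_comp
  have hmulA : ∀ {f : ℝ → ℂ}, MemLp f 2 volume → MemLp (fun x => (A x : ℂ) * f x) 2 volume :=
    memLp_periodic_mul hAc fun x => by simp only [hA.2.1 x]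
  have hmulI : ∀ {f : ℝ → ℂ}, MemLp f 2 volume → MemLp (fun x => (A x : ℂ)⁻¹ * f x) 2 volume :=
    memLp_periodic_mul (hAc.inv₀ hA0) fun x => by simp only [hA.2.1 x]
  have hmulD : ∀ {f : ℝ → ℂ}, MemLp f 2 volume →
      MemLp (fun x => ((deriv A x : ℝ) : ℂ) * f x) 2 volume :=
    memLp_periodic_mul hdc fun x => by simp only [hdp x]
  set Φ : L2R × L2R → ℝ → Fin 3 → ℂ := fun r x =>
    ![-(1 / (k * c)) * ((A x : ℂ)⁻¹ * ((A x : ℂ)⁻¹ * r.1 x)), -(1 / k) * r.1 x, -1 * r.2 x]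
    with hΦdef
  have hΦ : ∀ r, MemLp (Φ r) 2 volume := fun r => by
    refine MemLp.of_eval fun i => ?_
    fin_cases i
    · exact (hmulI (hmulI (Lp.memLp r.1))).const_mul _
    · exact (Lp.memLp r.1).const_mul _
    · exact (Lp.memLp r.2).const_mul _
  have hact := fun x y => full_act hA 1 0 (ν : ℂ) c k q Λ x y hνc hcc hkc
  -- a pointwise bound for the forcing, with `m` a lower bound for the profile
  set M : ℝ := 1 / (k * |c|) * (m⁻¹ * m⁻¹) + 1 / k + 1 with hM
  have hcp : 0 < |c| := abs_pos.2 hc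
  refine hasBoundedInverse_of_not_hasBloch
    ((fullB₀_periodic hA 1 0 ν c k q).add_smul (fullB₁_periodic hA 1 c k) Λ) hno
    (Φ := Φ) (W := fun w Y => (∀ᵐ x, w.1 x = (A x : ℂ) ^ 2 * Y x 0) ∧
      ∀ᵐ x, w.2 x = Y x 1 - c * (A x : ℂ) ^ 2 * Y x 0)
    (K := 4 * M ^ 2) (K' := (1 + (1 + |c|) * N ^ 2) ^ 2) (by positivity) hΦ
    (fun r => ?_) ?_ ?_ ?_ ?_
  · have h1 : ∫ x, ‖Φ r x‖ ^ 2 ≤ ∫ x, 2 * M ^ 2 * (‖r.1 x‖ ^ 2 + ‖r.2 x‖ ^ 2) := by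
      refine integral_mono_ae (integrable_norm_sq (hΦ r)) (((integrable_norm_sq (Lp.memLp r.1)).add
        (integrable_norm_sq (Lp.memLp r.2))).const_mul _) (ae_of_all _ fun x => ?_)
      have h2 : ‖Φ r x‖ ≤ M * (‖r.1 x‖ + ‖r.2 x‖) := by
        have hM1 : 1 / (k * |c|) * (m⁻¹ * m⁻¹) ≤ M := by
          have : 0 < 1 / k := by positivity
          linarith
        have hM2 : 1 / k ≤ M := by
          have : 0 < 1 / (k * |c|) * (m⁻¹ * m⁻¹) := by positivity
          linarith
        have hM3 : 1 ≤ M := by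
          have h1 : 0 < 1 / k := by positivity
          have h2 : 0 < 1 / (k * |c|) * (m⁻¹ * m⁻¹) := by positivity
          linarith
        have hr1 := norm_nonneg (r.1 x)
        have hr2 := norm_nonneg (r.2 x)
        refine (pi_norm_le_iff_of_nonneg (by positivity)).2 fun i => ?_
        fin_cases i
        · have hAi : (A x)⁻¹ ≤ m⁻¹ := inv_anti₀ hm (hb x).1
          have hAp := inv_pos.2 (hA.2.2 x)
          calc ‖-(1 / ((k : ℂ) * c)) * ((A x : ℂ)⁻¹ * ((A x : ℂ)⁻¹ * r.1 x))‖
              = 1 / (k * |c|) * ((A x)⁻¹ * (A x)⁻¹) * ‖r.1 x‖ := by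
                rw [norm_mul, norm_mul, norm_mul, norm_neg, norm_div, norm_mul, norm_inv,
                  Complex.norm_real, Complex.norm_real, Complex.norm_real, norm_one,
                  Real.norm_of_nonneg hk.le, Real.norm_of_nonneg (hA.2.2 x).le, Real.norm_eq_abs]
                ring
            _ ≤ M * ‖r.1 x‖ := by
                gcongr
                refine le_trans ?_ hM1
                gcongr
            _ ≤ M * (‖r.1 x‖ + ‖r.2 x‖) := by gcongr; linarith
        · calc ‖-(1 / (k : ℂ)) * r.1 x‖ = 1 / k * ‖r.1 x‖ := by
                rw [norm_mul, norm_neg, norm_div, norm_one, Complex.norm_real,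
                  Real.norm_of_nonneg hk.le]
            _ ≤ M * (‖r.1 x‖ + ‖r.2 x‖) := by gcongr; linarith
        · calc ‖-1 * r.2 x‖ = 1 * ‖r.2 x‖ := by simp
            _ ≤ M * (‖r.1 x‖ + ‖r.2 x‖) := by gcongr; linarith
      calc ‖Φ r x‖ ^ 2 ≤ (M * (‖r.1 x‖ + ‖r.2 x‖)) ^ 2 := by gcongr
        _ ≤ 2 * M ^ 2 * (‖r.1 x‖ ^ 2 + ‖r.2 x‖ ^ 2) := by
          nlinarith [mul_nonneg (sq_nonneg M) (sq_nonneg (‖r.1 x‖ - ‖r.2 x‖))]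
    rw [integral_const_mul, integral_add (integrable_norm_sq (Lp.memLp r.1))
      (integrable_norm_sq (Lp.memLp r.2)), ← norm_sq_eq_integral, ← norm_sq_eq_integral] at h1
    refine h1.trans ?_
    have h3 : ‖r.1‖ ^ 2 ≤ ‖r‖ ^ 2 := by gcongr; exact norm_fst_le r
    have h4 : ‖r.2‖ ^ 2 ≤ ‖r‖ ^ 2 := by gcongr; exact norm_snd_le r
    nlinarith [sq_nonneg M]
  · rintro w r ⟨a', b', s', ha, hb, hs, heq1, heq2⟩
    obtain ⟨a₀, ha₀, had⟩ := exists_hasIntegralDeriv ha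
    obtain ⟨b₀, hb₀, hbd⟩ := exists_hasIntegralDeriv hb
    obtain ⟨s₀, hs₀, hsd⟩ := exists_hasIntegralDeriv hs
    have ham : MemLp a₀ 2 volume := (memLp_congr_ae ha₀).1 (Lp.memLp w.1)
    have hbm : MemLp b₀ 2 volume := (memLp_congr_ae hb₀).1 (Lp.memLp w.2)
    have hfm : MemLp (fun x => ((k / A x ^ 3 : ℝ) : ℂ) * w.1 x
        + (ν : ℂ) * (k : ℂ) ^ 2 *
          (((1 / A x ^ 2 : ℝ) : ℂ) * b' x + ((2 * c * deriv A x / A x ^ 3 : ℝ) : ℂ) * w.1 x))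
        2 volume := by
      refine memLp_of_forall_eq (((hmulI (hmulI (hmulI (Lp.memLp w.1)))).const_mul (k : ℂ)).add
        (((hmulI (hmulI (Lp.memLp b'))).add
        ((hmulD (hmulI (hmulI (hmulI (Lp.memLp w.1))))).const_mul (2 * c : ℂ))).const_mul
          (ν * k ^ 2 : ℂ))) fun x => ?_
      have := hA0 x
      simp only [Pi.add_apply]
      push_cast
      field_simp
    have hsm : MemLp s₀ 2 volume := (memLp_congr_ae hs₀).1 hfm
    refine ⟨fun x => ![((A x : ℂ) ^ 2)⁻¹ * a₀ x, c * a₀ x + b₀ x, s₀ x + k * c * b₀ x], ?_, ?_,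
      ?_, ?_⟩
    · refine (isMild_iff (memLp_two_locallyIntegrable (hΦ r))).2 fun i => ?_
      simp only [hact, hΦdef]
      have hinv : ∀ x, HasDerivAt (fun x => ((A x : ℂ) ^ 2)⁻¹)
          (-(2 * A x * (deriv A x : ℝ)) / ((A x : ℂ) ^ 2) ^ 2) x := fun x =>
        (((hAd x).pow 2).inv (pow_ne_zero 2 (hA0 x))).congr_deriv (by simp)
      have hinvc : Continuous fun x => -(2 * (A x : ℂ) * (deriv A x : ℝ)) / ((A x : ℂ) ^ 2) ^ 2 :=
        (((hAc.const_mul 2).mul hdc).neg).div ((hAc.pow 2).pow 2)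
          fun x => pow_ne_zero 2 (pow_ne_zero 2 (hA0 x))
      fin_cases i
      · refine (had.mul hinv hinvc).congr ?_
        filter_upwards [ha₀, hb₀, hs₀, heq1] with x h1 h2 h3 h4
        have hAx := hA0 x
        rw [h1] at h3 h4
        have h5 : (b' x : ℂ) = (Λ * a₀ x - k * c * a' x - r.1 x) / k := by
          field_simp; linear_combination -h4
        simp only [Fin.zero_eta, Matrix.cons_val_zero, Matrix.cons_val_one, Matrix.cons_val,
          ← h3, h5]
        push_cast
        field_simp
        ring
      · refine ((had.const_mul (c : ℂ)).add hbd).congr ?_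
        filter_upwards [ha₀, heq1] with x h1 h4
        have hAx := hA0 x
        rw [h1] at h4
        simp
        field_simp
        linear_combination -h4
      · refine (hsd.add (hbd.const_mul (k * c : ℂ))).congr ?_
        filter_upwards [ha₀, hb₀, heq2] with x h1 h2 h4
        have hAx := hA0 x
        rw [h1, h2] at h4
        simp
        field_simp
        linear_combination -h4
    · refine MemLp.of_eval fun i => ?_
      fin_cases i
      · refine memLp_of_forall_eq (hmulI (hmulI ham)) fun x => ?_
        simp
        ring
      · exact (ham.const_mul _).add hbm
      · exact hsm.add (hbm.const_mul _)
    · filter_upwards [ha₀] with x h1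
      have := hA0 x
      simp [h1]
      field_simp
    · filter_upwards [hb₀] with x h1
      have := hA0 x
      simp [h1]
      field_simp
      ring
  · intro r Y hY hYm
    have hd := (isMild_iff (memLp_two_locallyIntegrable (hΦ r))).1 hY
    simp only [hact, hΦdef] at hd
    have hd0 := hd 0
    have hd1 := hd 1
    have hd2 := hd 2
    simp only [Matrix.cons_val_zero, Matrix.cons_val_one, Matrix.cons_val, one_mul, mul_zero,
      zero_mul, sub_zero, add_zero] at hd0 hd1 hd2
    have hY0 : MemLp (fun x => Y x 0) 2 volume := hYm.eval 0
    have hY1 : MemLp (fun x => Y x 1) 2 volume := hYm.eval 1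
    have hY2 : MemLp (fun x => Y x 2) 2 volume := hYm.eval 2
    set a : ℝ → ℂ := fun x => (A x : ℂ) ^ 2 * Y x 0 with ha
    have ham : MemLp a 2 volume := memLp_of_forall_eq (hmulA (hmulA hY0)) fun x => by
      simp only [ha]; ring
    set b : ℝ → ℂ := fun x => Y x 1 - c * a x with hbdef
    have hbm : MemLp b 2 volume := hY1.sub (ham.const_mul _)
    set V' : ℝ → ℂ := fun x => (k * (A x : ℂ)⁻¹ * Y x 0 + ν * k * Λ * Y x 0 - Y x 2
      + k * c * (Y x 1 - c * (A x : ℂ) ^ 2 * Y x 0)) / (ν * k ^ 2 * c)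
      + -(1 / (k * c)) * ((A x : ℂ)⁻¹ * ((A x : ℂ)⁻¹ * r.1 x)) with hV'
    have hVm : MemLp V' 2 volume := by
      refine memLp_of_forall_eq ((((((hmulI hY0).const_mul (k : ℂ)).add
        (hY0.const_mul (ν * k * Λ))).sub hY2).add
        (hbm.const_mul (k * c : ℂ))).const_mul (ν * k ^ 2 * c : ℂ)⁻¹ |>.add
        ((hmulI (hmulI (Lp.memLp r.1))).const_mul (-(1 / (k * c)) : ℂ))) fun x => ?_
      simp only [Pi.add_apply, Pi.sub_apply, hV', hbdef, ha]
      ring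
    have hAdd : ∀ x, HasDerivAt (fun x => (A x : ℂ) ^ 2) (2 * A x * (deriv A x : ℝ)) x := fun x =>
      ((hAd x).pow 2).congr_deriv (by simp)
    have had := hd0.mul hAdd ((hAc.const_mul 2).mul hdc)
    set a' : ℝ → ℂ := fun x => 2 * A x * (deriv A x : ℝ) * Y x 0 + (A x : ℂ) ^ 2 * V' x with ha'
    have ham' : MemLp a' 2 volume := by
      refine memLp_of_forall_eq (((hmulA (hmulD hY0)).const_mul 2).add (hmulA (hmulA hVm)))
        fun x => ?_
      simp only [Pi.add_apply, ha']
      ring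
    have hbd := hd1.sub (had.const_mul (c : ℂ))
    set b' : ℝ → ℂ := fun x => Λ / k * (A x : ℂ) ^ 2 * Y x 0 + -(1 / k) * r.1 x - c * a' x
      with hb'
    have hbm' : MemLp b' 2 volume := by
      refine memLp_of_forall_eq (((ham.const_mul (Λ / k)).add ((Lp.memLp r.1).const_mul
        (-(1 / k) : ℂ))).sub (ham'.const_mul (c : ℂ))) fun x => ?_
      simp only [Pi.add_apply, Pi.sub_apply, hb', ha]
      ring
    have hsd := hd2.sub (hbd.const_mul (k * c : ℂ))
    have hsm' : MemLp (fun x => q ^ 2 * (A x : ℂ) ^ 2 * Y x 0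
        + Λ * (Y x 1 - c * (A x : ℂ) ^ 2 * Y x 0) + -1 * r.2 x - k * c * b' x) 2 volume := by
      refine memLp_of_forall_eq ((((ham.const_mul (q ^ 2 : ℂ)).add (hbm.const_mul Λ)).add
        ((Lp.memLp r.2).const_mul (-1))).sub (hbm'.const_mul (k * c : ℂ))) fun x => ?_
      simp only [Pi.add_apply, Pi.sub_apply, hbdef, ha]
      ring
    refine ⟨(ham.toLp _, hbm.toLp _), ham'.toLp _, hbm'.toLp _, hsm'.toLp _, ?_, ?_, ?_, ?_, ?_⟩
    · exact (had.congr ham'.coeFn_toLp.symm).hasWeakDeriv ham.coeFn_toLp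
    · exact (hbd.congr hbm'.coeFn_toLp.symm).hasWeakDeriv hbm.coeFn_toLp
    · refine (hsd.congr hsm'.coeFn_toLp.symm).hasWeakDeriv ?_
      filter_upwards [ham.coeFn_toLp, hbm'.coeFn_toLp] with x h1 h2
      have := hA0 x
      rw [h1, h2]
      simp only [hb', ha', hV', ha]
      push_cast
      field_simp
      ring
    · filter_upwards [ham.coeFn_toLp, ham'.coeFn_toLp, hbm'.coeFn_toLp] with x h1 h2 h3
      rw [h1, h2, h3]
      simp only [hb', ha]
      field_simp
      ring
    · filter_upwards [ham.coeFn_toLp, hbm.coeFn_toLp, hbm'.coeFn_toLp, hsm'.coeFn_toLp]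
        with x h1 h2 h3 h4
      rw [h1, h2, h3, h4]
      simp only [hbdef, ha]
      ring
  · intro w w' Y Y' hw hw' hYY
    refine Prod.ext (Lp.ext ?_) (Lp.ext ?_)
    · filter_upwards [hw.1, hw'.1, hYY] with x h1 h2 h3
      rw [h1, h2, h3]
    · filter_upwards [hw.2, hw'.2, hYY] with x h1 h2 h3
      rw [h1, h2, h3]
  · intro w Y hYm hw
    have hAN : ∀ x, ‖(A x : ℂ) ^ 2‖ ≤ N ^ 2 := fun x => by
      rw [norm_pow, Complex.norm_real, Real.norm_of_nonneg (hA.2.2 x).le]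
      exact pow_le_pow_left₀ (hA.2.2 x).le (hb x).2.1 2
    have h1 : ‖w.1‖ ^ 2 ≤ (1 + (1 + |c|) * N ^ 2) ^ 2 * ∫ x, ‖Y x‖ ^ 2 := by
      refine norm_sq_le_of_ae_le hYm ?_
      filter_upwards [hw.1] with x hx
      rw [hx, norm_mul]
      refine mul_le_mul ((hAN x).trans ?_) (norm_le_pi_norm (Y x) 0) (norm_nonneg _)
        (by positivity)
      nlinarith [sq_nonneg N, mul_nonneg hcp.le (sq_nonneg N)]
    have h2 : ‖w.2‖ ^ 2 ≤ (1 + (1 + |c|) * N ^ 2) ^ 2 * ∫ x, ‖Y x‖ ^ 2 := by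
      refine norm_sq_le_of_ae_le hYm ?_
      filter_upwards [hw.2] with x hx
      rw [hx]
      have h3 := norm_le_pi_norm (Y x) 0
      have h4 := norm_le_pi_norm (Y x) 1
      calc ‖Y x 1 - c * (A x : ℂ) ^ 2 * Y x 0‖
          ≤ ‖Y x 1‖ + |c| * ‖(A x : ℂ) ^ 2‖ * ‖Y x 0‖ := by
            refine (norm_sub_le _ _).trans_eq ?_
            rw [norm_mul, norm_mul, Complex.norm_real, Real.norm_eq_abs]
        _ ≤ ‖Y x‖ + |c| * N ^ 2 * ‖Y x‖ := by
            gcongr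
            exact hAN x
        _ ≤ (1 + (1 + |c|) * N ^ 2) * ‖Y x‖ := by
            nlinarith [mul_nonneg (sq_nonneg N) (norm_nonneg (Y x))]
    rw [Prod.norm_def]
    rcases max_choice ‖w.1‖ ‖w.2‖ with h | h <;> rw [h] <;> assumption

end Critical

/-! ### Floquet solutions and the spectrum -/

section WeylSequence

theorem exists_norm_le_of_quasiperiodic {f : ℝ → ℂ} {ρ : ℂ} (hρ : ‖ρ‖ = 1) (hf : Continuous f)
    (hp : ∀ x, f (x + 1) = ρ * f x) : ∃ M, ∀ x, ‖f x‖ ≤ M := by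
  obtain ⟨M, hM⟩ := exists_norm_le_of_periodic hf.norm fun x => by
    rw [hp x, norm_mul, hρ, one_mul]
  exact ⟨M, fun x => by simpa using hM x⟩

/-- A `C²` cutoff function that is `1` on `[-1, 1]` and vanishes outside `[-2, 2]`. -/
theorem exists_cutoff : ∃ χ χ' χ'' : ℝ → ℝ, (∀ x, HasDerivAt χ (χ' x) x) ∧
    (∀ x, HasDerivAt χ' (χ'' x) x) ∧ Continuous χ'' ∧ (∀ x, |x| ≤ 1 → χ x = 1) ∧
    (∀ x, 2 ≤ |x| → χ x = 0 ∧ χ' x = 0 ∧ χ'' x = 0) := by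
  let φ : ContDiffBump (0 : ℝ) := ⟨1, 3 / 2, one_pos, by norm_num⟩
  have hφ : ContDiff ℝ 2 φ := φ.contDiff
  have hφ' : ContDiff ℝ 1 (deriv φ) := ((contDiff_succ_iff_deriv (n := 1)).1 hφ).2.2
  refine ⟨φ, deriv φ, deriv (deriv φ),
    fun x => ((hφ.differentiable (by simp)) x).hasDerivAt,
    fun x => ((hφ'.differentiable (by simp)) x).hasDerivAt,
    hφ'.continuous_deriv le_rfl, fun x hx => ?_, fun x hx => ?_⟩
  · exact φ.one_of_mem_closedBall (by simpa [Real.dist_eq] using hx)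
  · have h0 : x ∉ tsupport φ := by
      rw [φ.tsupport_eq, Metric.mem_closedBall, Real.dist_eq, sub_zero]
      change ¬ |x| ≤ 3 / 2
      linarith
    have h1 : x ∉ tsupport (deriv φ) := fun h => h0 (tsupport_deriv_subset h)
    have h2 : x ∉ tsupport (deriv (deriv φ)) := fun h => h1 (tsupport_deriv_subset h)
    exact ⟨image_eq_zero_of_notMem_tsupport h0, image_eq_zero_of_notMem_tsupport h1,
      image_eq_zero_of_notMem_tsupport h2⟩

/-- The commutator of a cutoff at scale `R` with a second order operator is small in `L²`: it is
of size `R⁻¹` on an interval of length `4R`. -/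
theorem integral_cutoff_le {χ' χ'' : ℝ → ℝ} (hχ' : Continuous χ') (hχ'' : Continuous χ'')
    (h0 : ∀ x, 2 ≤ |x| → χ' x = 0 ∧ χ'' x = 0) {f₁ f₂ : ℝ → ℂ} {M : ℝ}
    (h1 : ∀ x, ‖f₁ x‖ ≤ M) (h2 : ∀ x, ‖f₂ x‖ ≤ M) :
    ∃ C : ℝ, ∀ R : ℝ, 1 ≤ R → ∀ r : ℝ → ℂ, MemLp r 2 volume →
      (∀ x, r x = ((R⁻¹ * χ' (x / R) : ℝ) : ℂ) * f₁ x
        + ((R⁻¹ * (R⁻¹ * χ'' (x / R)) : ℝ) : ℂ) * f₂ x) →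
      ∫ x, ‖r x‖ ^ 2 ≤ C / R := by
  have hb : ∀ {g : ℝ → ℝ}, Continuous g → (∀ x, 2 ≤ |x| → g x = 0) → ∃ D, 0 ≤ D ∧ ∀ x, |g x| ≤ D :=
    fun {g} hg hg0 => by
    obtain ⟨D, hD⟩ := (isCompact_Icc (a := (-2 : ℝ)) (b := 2)).exists_bound_of_continuousOn
      hg.continuousOn
    have hD0 : 0 ≤ D := (norm_nonneg _).trans (hD 0 (by constructor <;> norm_num))
    refine ⟨D, hD0, fun x => ?_⟩
    by_cases hx : |x| ≤ 2
    · exact hD x (abs_le.1 hx)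
    · rw [hg0 x (not_le.1 hx).le, abs_zero]; exact hD0
  obtain ⟨D₁, hD₁0, hD₁⟩ := hb hχ' fun x hx => (h0 x hx).1
  obtain ⟨D₂, hD₂0, hD₂⟩ := hb hχ'' fun x hx => (h0 x hx).2
  have hM : 0 ≤ M := (norm_nonneg _).trans (h1 0)
  refine ⟨4 * ((D₁ + D₂) * M) ^ 2, fun R hR r hr hrx => ?_⟩
  have hR0 : 0 < R := zero_lt_one.trans_le hR
  have hRi : R⁻¹ ≤ 1 := inv_le_one_of_one_le₀ hR
  set K : ℝ := R⁻¹ * ((D₁ + D₂) * M) with hK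
  have hK0 : 0 ≤ K := by positivity
  have hle : ∀ x, ‖r x‖ ^ 2 ≤ (Set.Icc (-(2 * R)) (2 * R)).indicator (fun _ => K ^ 2) x := by
    intro x
    by_cases hx : x ∈ Set.Icc (-(2 * R)) (2 * R)
    · rw [Set.indicator_of_mem hx, hrx]
      refine pow_le_pow_left₀ (norm_nonneg _) ?_ 2
      refine (norm_add_le _ _).trans ?_
      rw [norm_mul, norm_mul, Complex.norm_real, Complex.norm_real, Real.norm_eq_abs,
        Real.norm_eq_abs, abs_mul, abs_mul, abs_mul, abs_of_pos (inv_pos.2 hR0)]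
      have e1 : R⁻¹ * |χ' (x / R)| * ‖f₁ x‖ ≤ R⁻¹ * D₁ * M := by
        gcongr
        · exact hD₁ _
        · exact h1 x
      have e2 : R⁻¹ * (R⁻¹ * |χ'' (x / R)|) * ‖f₂ x‖ ≤ R⁻¹ * (1 * D₂) * M := by
        gcongr
        · exact hD₂ _
        · exact h2 x
      rw [hK]
      linarith
    · have hx2 : 2 ≤ |x / R| := by
        rw [abs_div, abs_of_pos hR0, le_div_iff₀ hR0]
        by_contra hlt
        exact hx (abs_le.1 (not_le.1 hlt).le)
      rw [Set.indicator_of_notMem hx, hrx, (h0 _ hx2).1, (h0 _ hx2).2]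
      simp
  have hint : Integrable ((Set.Icc (-(2 * R)) (2 * R)).indicator fun _ => K ^ 2) volume :=
    (integrable_indicator_iff measurableSet_Icc).2 (integrableOn_const (by simp))
  refine (integral_mono (integrable_norm_sq hr) hint hle).trans_eq ?_
  rw [integral_indicator measurableSet_Icc, setIntegral_const, Real.volume_real_Icc_of_le
    (by linarith), smul_eq_mul, hK]
  field_simp
  ring

/-- A function with a nonzero value keeps a fixed amount of `L²` mass under wide cutoffs. -/
theorem exists_pos_le_integral_cutoff {χ : ℝ → ℝ} (hχ : ∀ x, |x| ≤ 1 → χ x = 1) {f : ℝ → ℂ}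
    (hf : Continuous f) {x₀ : ℝ} (h0 : f x₀ ≠ 0) :
    ∃ m : ℝ, 0 < m ∧ ∃ R₀ : ℝ, ∀ R : ℝ, R₀ ≤ R →
      MemLp (fun x => ((χ (x / R) : ℝ) : ℂ) * f x) 2 volume →
      m ≤ ∫ x, ‖((χ (x / R) : ℝ) : ℂ) * f x‖ ^ 2 := by
  have hc : Continuous fun x => ‖f x‖ ^ 2 := hf.norm.pow 2
  refine ⟨∫ x in (x₀ - 1)..(x₀ + 1), ‖f x‖ ^ 2, ?_, |x₀| + 1, fun R hR hm => ?_⟩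
  · refine intervalIntegral.integral_pos (by linarith) hc.continuousOn
      (fun x _ => by positivity) ⟨x₀, by constructor <;> linarith, by positivity⟩
  · have hR0 : 0 < R := by linarith [abs_nonneg x₀]
    rw [intervalIntegral.integral_of_le (by linarith)]
    have e : ∫ x in Set.Ioc (x₀ - 1) (x₀ + 1), ‖f x‖ ^ 2
        = ∫ x in Set.Ioc (x₀ - 1) (x₀ + 1), ‖((χ (x / R) : ℝ) : ℂ) * f x‖ ^ 2 := by
      refine setIntegral_congr_fun measurableSet_Ioc fun x hx => ?_
      have h1 : |x / R| ≤ 1 := by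
        rw [abs_div, abs_of_pos hR0, div_le_one hR0]
        refine le_trans (abs_le.2 ⟨?_, ?_⟩) hR
        · linarith [hx.1, neg_abs_le x₀]
        · linarith [hx.2, le_abs_self x₀]
      simp [hχ _ h1]
    rw [e]
    exact setIntegral_le_integral (integrable_norm_sq hm) (ae_of_all _ fun x => by positivity)

/-- A nonzero quasiperiodic solution of the spectral problem, with multiplier on the unit circle,
yields a Weyl sequence of wide cutoffs. -/
theorem mem_stVenantSpectrum_of_quasiperiodic {ν F k c : ℝ} {T U p' : ℝ → ℝ} {z ρ : ℂ}
    {a b s a' b' s' : ℝ → ℂ} (hρ : ‖ρ‖ = 1)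
    (hp : ∀ x, HasDerivAt (fun x => 1 / T x ^ 2) (p' x) x) (hp' : Continuous p')
    (hpT : Function.Periodic (fun x => 1 / T x ^ 2) 1) (hpp : Function.Periodic p' 1)
    (ha : ∀ x, HasDerivAt a (a' x) x) (hb : ∀ x, HasDerivAt b (b' x) x)
    (hs : ∀ x, HasDerivAt s (s' x) x) (ha' : Continuous a') (hb' : Continuous b')
    (hs' : Continuous s') (hap : ∀ x, a (x + 1) = ρ * a x) (hbp : ∀ x, b (x + 1) = ρ * b x)
    (hbp' : ∀ x, b' (x + 1) = ρ * b' x) (hsp : ∀ x, s (x + 1) = ρ * s x)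
    (hflux : ∀ x, s x = ((k / F ^ 2 / T x ^ 3 : ℝ) : ℂ) * a x + (ν : ℂ) * (k : ℂ) ^ 2 *
      (((1 / T x ^ 2 : ℝ) : ℂ) * b' x - ((2 * deriv U x / T x ^ 3 : ℝ) : ℂ) * a x))
    (heq₁ : ∀ x, z * a x - (k : ℂ) * (c : ℂ) * a' x - (k : ℂ) * b' x = 0)
    (heq₂ : ∀ x, z * b x - (k : ℂ) * (c : ℂ) * b' x - s' x
        + ((U x ^ 2 : ℝ) : ℂ) * a x + ((2 * T x * U x : ℝ) : ℂ) * b x = 0)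
    (hne : ∃ x, a x ≠ 0 ∨ b x ≠ 0) : z ∈ stVenantSpectrum ν F k c T U := by
  obtain ⟨χ, χ', χ'', hχ, hχ', hχc'', hχ1, hχ0⟩ := exists_cutoff
  have hcont : ∀ {E : Type} [NormedAddCommGroup E] [NormedSpace ℝ E] {f f' : ℝ → E},
      (∀ x, HasDerivAt f (f' x) x) → Continuous f := fun hf =>
    continuous_iff_continuousAt.2 fun x => (hf x).continuousAt
  have hχc := hcont hχ
  have hχc' := hcont hχ'
  have hac := hcont ha
  have hbc := hcont hb
  have hsc := hcont hs
  set p : ℝ → ℂ := fun x => ((1 / T x ^ 2 : ℝ) : ℂ) with hpdef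
  have hpc : ∀ x, HasDerivAt p (p' x : ℂ) x := fun x => (hp x).ofReal_comp
  have hpcc : Continuous p := hcont hpc
  have hpcc' : Continuous fun x => (p' x : ℂ) := Complex.continuous_ofReal.comp hp'
  have hpp1 : ∀ x, p (x + 1) = p x := fun x => congrArg Complex.ofReal (hpT x)
  -- the residuals of a cutoff `X` are `X' f₁` and `X' f₂ + X'' f₃`
  set f₁ : ℝ → ℂ := fun x => -(k * c) * a x - k * b x with hf₁
  set f₂ : ℝ → ℂ := fun x => -(k * c) * b x - s x - ν * k ^ 2 * (p' x * b x + p x * b' x) with hf₂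
  set f₃ : ℝ → ℂ := fun x => -(ν * k ^ 2) * (p x * b x) with hf₃
  have hf₁c : Continuous f₁ := (hac.const_mul _).sub (hbc.const_mul _)
  have hf₂c : Continuous f₂ := ((hbc.const_mul _).sub hsc).sub
    (((hpcc'.mul hbc).add (hpcc.mul hb')).const_mul _)
  have hf₃c : Continuous f₃ := (hpcc.mul hbc).const_mul _
  obtain ⟨M₁, hM₁⟩ := exists_norm_le_of_quasiperiodic hρ hf₁c fun x => by
    simp only [hf₁, hap, hbp]; ring
  obtain ⟨M₂, hM₂⟩ := exists_norm_le_of_quasiperiodic hρ hf₂c fun x => by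
    simp only [hf₂, hsp, hbp, hbp', hpp1, hpp x]; ring
  obtain ⟨M₃, hM₃⟩ := exists_norm_le_of_quasiperiodic hρ hf₃c fun x => by
    simp only [hf₃, hbp, hpp1]; ring
  have hχ0' : ∀ x, 2 ≤ |x| → χ' x = 0 ∧ χ'' x = 0 := fun x hx => (hχ0 x hx).2
  obtain ⟨C₁, hC₁⟩ := integral_cutoff_le hχc' hχc'' hχ0' hM₁ (f₂ := fun _ => 0) (M := M₁)
    fun x => by rw [norm_zero]; exact (norm_nonneg _).trans (hM₁ 0)
  obtain ⟨C₂, hC₂⟩ := integral_cutoff_le hχc' hχc'' hχ0' (f₁ := f₂) (f₂ := f₃) (M := max M₂ M₃)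
    (fun x => (hM₂ x).trans (le_max_left _ _)) fun x => (hM₃ x).trans (le_max_right _ _)
  rintro ⟨-, C, hC⟩
  -- the cutoffs of `(a, b)` at scale `R`, as elements of the domain
  have key : ∀ R : ℝ, 1 ≤ R →
      MemLp (fun x => ((χ (x / R) : ℝ) : ℂ) * a x) 2 volume ∧
      MemLp (fun x => ((χ (x / R) : ℝ) : ℂ) * b x) 2 volume ∧
      ∫ x, ‖((χ (x / R) : ℝ) : ℂ) * a x‖ ^ 2 ≤ C ^ 2 * ((C₁ + C₂) / R) ∧
      ∫ x, ‖((χ (x / R) : ℝ) : ℂ) * b x‖ ^ 2 ≤ C ^ 2 * ((C₁ + C₂) / R) := by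
    intro R hR
    have hR0 : 0 < R := zero_lt_one.trans_le hR
    have hdR : ∀ x : ℝ, HasDerivAt (fun x => x / R) R⁻¹ x := fun x => by
      simpa [div_eq_mul_inv] using (hasDerivAt_id x).mul_const R⁻¹
    have hdc : Continuous fun x : ℝ => x / R := continuous_id.div_const R
    set X : ℝ → ℂ := fun x => ((χ (x / R) : ℝ) : ℂ) with hX
    set X' : ℝ → ℂ := fun x => ((R⁻¹ * χ' (x / R) : ℝ) : ℂ) with hX'
    set X'' : ℝ → ℂ := fun x => ((R⁻¹ * (R⁻¹ * χ'' (x / R)) : ℝ) : ℂ) with hX''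
    have hXd : ∀ x, HasDerivAt X (X' x) x := fun x =>
      (((hχ (x / R)).comp x (hdR x)).congr_deriv (mul_comm _ _)).ofReal_comp
    have hXd' : ∀ x, HasDerivAt X' (X'' x) x := fun x =>
      ((((hχ' (x / R)).comp x (hdR x)).congr_deriv (mul_comm _ _)).const_mul R⁻¹).ofReal_comp
    have hXc := hcont hXd
    have hXc' := hcont hXd'
    have hXc'' : Continuous X'' := Complex.continuous_ofReal.comp
      (((hχc''.comp hdc).const_mul _).const_mul _)
    have hout : ∀ x, x ∉ Set.Icc (-(2 * R)) (2 * R) → X x = 0 ∧ X' x = 0 ∧ X'' x = 0 := by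
      intro x hx
      have hx2 : 2 ≤ |x / R| := by
        rw [abs_div, abs_of_pos hR0, le_div_iff₀ hR0]
        by_contra hlt
        exact hx (abs_le.1 (not_le.1 hlt).le)
      obtain ⟨e0, e1, e2⟩ := hχ0 _ hx2
      simp [hX, hX', hX'', e0, e1, e2]
    have hmem : ∀ {f : ℝ → ℂ}, Continuous f →
        (∀ x, x ∉ Set.Icc (-(2 * R)) (2 * R) → f x = 0) → MemLp f 2 volume := fun hf h0 =>
      hf.memLp_of_hasCompactSupport (HasCompactSupport.intro isCompact_Icc h0)
    have hwa : MemLp (fun x => X x * a x) 2 volume := hmem (hXc.mul hac) fun x hx => by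
      simp [(hout x hx).1]
    have hwb : MemLp (fun x => X x * b x) 2 volume := hmem (hXc.mul hbc) fun x hx => by
      simp [(hout x hx).1]
    have hca' : Continuous fun x => X' x * a x + X x * a' x :=
      (hXc'.mul hac).add (hXc.mul ha')
    have hcb' : Continuous fun x => X' x * b x + X x * b' x :=
      (hXc'.mul hbc).add (hXc.mul hb')
    have hcs' : Continuous fun x => X' x * s x + X x * s' x + ν * k ^ 2 * (p' x * (X' x * b x)
        + p x * (X'' x * b x + X' x * b' x)) :=
      ((hXc'.mul hsc).add (hXc.mul hs')).add (((hpcc'.mul (hXc'.mul hbc)).add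
        (hpcc.mul ((hXc''.mul hbc).add (hXc'.mul hb')))).const_mul _)
    have hma' : MemLp (fun x => X' x * a x + X x * a' x) 2 volume := hmem hca' fun x hx => by
      simp [hout x hx]
    have hmb' : MemLp (fun x => X' x * b x + X x * b' x) 2 volume := hmem hcb' fun x hx => by
      simp [hout x hx]
    have hms' := hmem hcs' fun x hx => by simp [hout x hx]
    have hmr₁ : MemLp (fun x => X' x * f₁ x + X'' x * 0) 2 volume :=
      hmem ((hXc'.mul hf₁c).add (hXc''.mul continuous_const)) fun x hx => by simp [hout x hx]
    have hmr₂ : MemLp (fun x => X' x * f₂ x + X'' x * f₃ x) 2 volume :=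
      hmem ((hXc'.mul hf₂c).add (hXc''.mul hf₃c)) fun x hx => by simp [hout x hx]
    have hT : StVenantResolventEq ν F k c T U z (hwa.toLp _, hwb.toLp _)
        (hmr₁.toLp _, hmr₂.toLp _) := by
      refine ⟨hma'.toLp _, hmb'.toLp _, hms'.toLp _, ?_, ?_, ?_, ?_, ?_⟩
      · exact hasWeakDeriv_of_hasDerivAt (fun x => (hXd x).mul (ha x)) hca' hwa.coeFn_toLp
          hma'.coeFn_toLp
      · exact hasWeakDeriv_of_hasDerivAt (fun x => (hXd x).mul (hb x)) hcb' hwb.coeFn_toLp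
          hmb'.coeFn_toLp
      · refine hasWeakDeriv_of_hasDerivAt
          (G := fun x => X x * s x + ν * k ^ 2 * (p x * (X' x * b x)))
          (fun x => ((hXd x).mul (hs x)).add
            (((hpc x).mul ((hXd' x).mul (hb x))).const_mul _)) hcs' ?_ hms'.coeFn_toLp
        filter_upwards [hwa.coeFn_toLp, hmb'.coeFn_toLp] with x h1 h2
        rw [h1, h2, hflux x]
        ring
      · filter_upwards [hwa.coeFn_toLp, hma'.coeFn_toLp, hmb'.coeFn_toLp, hmr₁.coeFn_toLp]
          with x h1 h2 h3 h4
        rw [h1, h2, h3, h4]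
        simp only [hf₁]
        linear_combination X x * heq₁ x
      · filter_upwards [hwa.coeFn_toLp, hwb.coeFn_toLp, hmb'.coeFn_toLp, hms'.coeFn_toLp,
          hmr₂.coeFn_toLp] with x h1 h2 h3 h4 h5
        rw [h1, h2, h3, h4, h5]
        simp only [hf₂, hf₃]
        linear_combination X x * heq₂ x
    have hnorm := hC _ _ hT
    have hr₁ := hC₁ R hR _ hmr₁ fun x => rfl
    have hr₂ := hC₂ R hR _ hmr₂ fun x => rfl
    rw [← norm_toLp_sq hmr₁] at hr₁
    rw [← norm_toLp_sq hmr₂] at hr₂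
    set r₁ : L2R := hmr₁.toLp _
    set r₂ : L2R := hmr₂.toLp _
    have hr : ‖(r₁, r₂)‖ ^ 2 ≤ (C₁ + C₂) / R := by
      have : ‖(r₁, r₂)‖ ^ 2 ≤ ‖r₁‖ ^ 2 + ‖r₂‖ ^ 2 := by
        rw [Prod.norm_def]
        rcases max_choice ‖r₁‖ ‖r₂‖ with h | h <;>
          (simp only [h]; nlinarith [sq_nonneg ‖r₁‖, sq_nonneg ‖r₂‖])
      rw [add_div]
      linarith
    refine ⟨hwa, hwb, ?_, ?_⟩
    · rw [← norm_toLp_sq hwa]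
      calc ‖hwa.toLp _‖ ^ 2 ≤ (C * ‖(r₁, r₂)‖) ^ 2 :=
            pow_le_pow_left₀ (norm_nonneg _) ((norm_fst_le (hwa.toLp _, hwb.toLp _)).trans hnorm) 2
        _ ≤ C ^ 2 * ((C₁ + C₂) / R) := by
            rw [mul_pow]; gcongr
    · rw [← norm_toLp_sq hwb]
      calc ‖hwb.toLp _‖ ^ 2 ≤ (C * ‖(r₁, r₂)‖) ^ 2 :=
            pow_le_pow_left₀ (norm_nonneg _) ((norm_snd_le (hwa.toLp _, hwb.toLp _)).trans hnorm) 2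
        _ ≤ C ^ 2 * ((C₁ + C₂) / R) := by
            rw [mul_pow]; gcongr
  have hlim : Tendsto (fun R : ℝ => C ^ 2 * ((C₁ + C₂) / R)) atTop (𝓝 0) := by
    simpa using (tendsto_id.const_div_atTop (C₁ + C₂)).const_mul (C ^ 2)
  obtain ⟨x₀, hx₀ | hx₀⟩ := hne
  · obtain ⟨m, hm, R₀, hR₀⟩ := exists_pos_le_integral_cutoff hχ1 hac hx₀
    obtain ⟨R, h1, h2, h3⟩ := ((hlim.eventually_lt_const hm).and
      ((eventually_ge_atTop 1).and (eventually_ge_atTop R₀))).exists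
    have h4 := key R h2
    linarith [hR₀ R h3 h4.1, h4.2.2.1]
  · obtain ⟨m, hm, R₀, hR₀⟩ := exists_pos_le_integral_cutoff hχ1 hbc hx₀
    obtain ⟨R, h1, h2, h3⟩ := ((hlim.eventually_lt_const hm).and
      ((eventually_ge_atTop 1).and (eventually_ge_atTop R₀))).exists
    have h4 := key R h2
    linarith [hR₀ R h3 h4.2.1, h4.2.2.2]

end WeylSequence

/-! ### Rescaling to physical variables -/

section Rescaling

variable {A : ℝ → ℝ}

/-- A Floquet solution, with multiplier on the unit circle, of the rescaled spectral problem at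
finite Froude number gives a point of the `L²` spectrum about the wave. Here `X = F^(1/2)` and
`Y = F^(α/4)`, which makes all scaling factors monomials. -/
theorem mem_stVenantSpectrum_of_hasBloch (hA : IsWaveProfile A) {X Y ν c k q : ℝ} (hX : 0 < X)
    (hY : 0 < Y) (hν : 0 < ν) (hc : c ≠ 0) (hk : 0 < k) {Λ ρ : ℂ} (hρ : ‖ρ‖ = 1)
    (h : HasBloch (fullB₀ (((X * Y) ^ 3)⁻¹ : ℝ) ((X ^ 2)⁻¹ : ℝ) ν c k q (toBCF A)
      + Λ • fullB₁ (((X * Y) ^ 3)⁻¹ : ℝ) c k (toBCF A)) ρ) :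
    ((X * Y : ℝ) : ℂ)⁻¹ * Λ ∈ stVenantSpectrum ν (X ^ 2) (k * (X * Y ^ 5)) (c * (X ^ 2 * Y ^ 6)⁻¹)
      (fun x => Y ^ 4 * A x) (fun x => (Y ^ 2)⁻¹ * (q - c * (X ^ 2)⁻¹ * A x)) := by
  have hνc : (ν : ℂ) ≠ 0 := by exact_mod_cast hν.ne'
  have hcc : (c : ℂ) ≠ 0 := by exact_mod_cast hc
  have hkc : (k : ℂ) ≠ 0 := by exact_mod_cast hk.ne'
  have hXc : (X : ℂ) ≠ 0 := by exact_mod_cast hX.ne'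
  have hYc : (Y : ℂ) ≠ 0 := by exact_mod_cast hY.ne'
  have hA0 : ∀ x, (A x : ℂ) ≠ 0 := fun x => by exact_mod_cast (hA.2.2 x).ne'
  have hAc : Continuous fun x => (A x : ℂ) := Complex.continuous_ofReal.comp hA.continuous
  have hdc : Continuous fun x => ((deriv A x : ℝ) : ℂ) :=
    Complex.continuous_ofReal.comp hA.continuous_deriv
  have hdp : Function.Periodic (deriv A) 1 := hA.periodic_deriv
  have hAd : ∀ x, HasDerivAt (fun x => (A x : ℂ)) (deriv A x : ℝ) x := fun x =>
    (hA.hasDerivAt x).ofReal_comp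
  obtain ⟨Z, hZ0, hZ, hZρ⟩ := h
  rw [full_isSolution_iff hA hνc hcc hkc] at hZ
  push_cast at hZ
  set ε : ℂ := (((X : ℂ) * Y) ^ 3)⁻¹ with hε
  set δ : ℂ := ((X : ℂ) ^ 2)⁻¹ with hδ
  have hcont : ∀ {f f' : ℝ → ℂ}, (∀ x, HasDerivAt f (f' x) x) → Continuous f := fun hf =>
    continuous_iff_continuousAt.2 fun x => (hf x).continuousAt
  set v : ℝ → ℂ := fun x => Z x 0 with hv
  set g : ℝ → ℂ := fun x => Z x 1 with hg
  set P : ℝ → ℂ := fun x => Z x 2 with hP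
  set a : ℝ → ℂ := fun x => (A x : ℂ) ^ 2 * v x with ha
  set b : ℝ → ℂ := fun x => g x - c * a x with hb
  set v' : ℝ → ℂ := fun x => (ε * k * (A x : ℂ)⁻¹ * v x + ν * k * Λ * v x - P x
    + ε * k * c * b x) / (ν * k ^ 2 * c) with hv'
  have hbx : ∀ x, Z x 1 - c * (A x : ℂ) ^ 2 * Z x 0 = b x := fun x => by
    simp only [hb, ha, hv, hg]; ring
  have hvd : ∀ x, HasDerivAt v (v' x) x := fun x => (hZ x).1.congr_deriv (by
    rw [hbx])
  have hgd : ∀ x, HasDerivAt g (Λ / k * a x) x := fun x => (hZ x).2.1.congr_deriv (by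
    simp only [ha, hv]; ring)
  have hPd : ∀ x, HasDerivAt P ((q - c * δ * A x) ^ 2 * a x
      + (ε * Λ + 2 * δ * A x * (q - c * δ * A x)) * b x) x := fun x =>
    (hZ x).2.2.congr_deriv (by
      rw [hbx]; simp only [ha, hv]; ring)
  have hvc := hcont hvd
  have hgc := hcont hgd
  have hPc := hcont hPd
  have hac : Continuous a := (hAc.pow 2).mul hvc
  have hbc : Continuous b := hgc.sub (hac.const_mul _)
  have hvc' : Continuous v' := by
    refine ((((((hAc.inv₀ hA0).const_mul (ε * k)).mul hvc).add (hvc.const_mul _)).sub hPc).add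
      (hbc.const_mul _)).div_const _
  set a' : ℝ → ℂ := fun x => 2 * A x * (deriv A x : ℝ) * v x + (A x : ℂ) ^ 2 * v' x with ha'
  have had : ∀ x, HasDerivAt a (a' x) x := fun x =>
    (((hAd x).pow 2).mul (hvd x)).congr_deriv (by simp [ha'])
  have hac' : Continuous a' :=
    (((hAc.const_mul 2).mul hdc).mul hvc).add ((hAc.pow 2).mul hvc')
  set b' : ℝ → ℂ := fun x => Λ / k * a x - c * a' x with hb'
  have hbd : ∀ x, HasDerivAt b (b' x) x := fun x => (hgd x).sub ((had x).const_mul (c : ℂ))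
  have hbc' : Continuous b' := (hac.const_mul _).sub (hac'.const_mul _)
  set s' : ℝ → ℂ := fun x => (q - c * δ * A x) ^ 2 * a x
    + (ε * Λ + 2 * δ * A x * (q - c * δ * A x)) * b x - ε * k * c * b' x with hs'
  have hsd : ∀ x, HasDerivAt (fun x => P x - ε * k * c * b x) (s' x) x := fun x =>
    (hPd x).sub ((hbd x).const_mul (ε * k * c))
  have hUc : Continuous fun x => (q : ℂ) - c * δ * A x := continuous_const.sub (hAc.const_mul _)
  have hsc' : Continuous s' := by
    refine (((hUc.pow 2).mul hac).add ((continuous_const.add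
      ((hAc.const_mul (2 * δ)).mul hUc)).mul hbc)).sub (hbc'.const_mul _)
  have hA1 : ∀ x, A (x + 1) = A x := hA.2.1
  have hvp : ∀ x, v (x + 1) = ρ * v x := fun x => by simp [hv, hZρ x]
  have hgp : ∀ x, g (x + 1) = ρ * g x := fun x => by simp [hg, hZρ x]
  have hPp : ∀ x, P (x + 1) = ρ * P x := fun x => by simp [hP, hZρ x]
  have hap : ∀ x, a (x + 1) = ρ * a x := fun x => by simp only [ha, hA1, hvp]; ring
  have hbp : ∀ x, b (x + 1) = ρ * b x := fun x => by simp only [hb, hap, hgp]; ring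
  have hvp' : ∀ x, v' (x + 1) = ρ * v' x := fun x => by
    simp only [hv', hA1, hvp, hPp, hbp]; ring
  have hap' : ∀ x, a' (x + 1) = ρ * a' x := fun x => by
    simp only [ha', hA1, hdp x, hvp, hvp']; ring
  have hbp' : ∀ x, b' (x + 1) = ρ * b' x := fun x => by simp only [hb', hap, hap']; ring
  have hTd : ∀ x, HasDerivAt (fun x => 1 / (Y ^ 4 * A x) ^ 2)
      (-(2 * (Y ^ 4 * A x) * (Y ^ 4 * deriv A x)) / ((Y ^ 4 * A x) ^ 2) ^ 2) x := fun x => by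
    have h0 : (Y ^ 4 * A x) ^ 2 ≠ 0 := by
      have := hA.2.2 x
      positivity
    simp only [one_div]
    exact ((((hA.hasDerivAt x).const_mul (Y ^ 4)).pow 2).inv h0).congr_deriv (by simp)
  have hTc : Continuous fun x =>
      -(2 * (Y ^ 4 * A x) * (Y ^ 4 * deriv A x)) / ((Y ^ 4 * A x) ^ 2) ^ 2 := by
    have h1 := hA.continuous.const_mul (Y ^ 4)
    refine (((h1.const_mul 2).mul (hA.continuous_deriv.const_mul _)).neg).div
      ((h1.pow 2).pow 2) fun x => ?_
    have := hA.2.2 x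
    positivity
  have hUd : ∀ x, deriv (fun x => (Y ^ 2)⁻¹ * (q - c * (X ^ 2)⁻¹ * A x)) x
      = (Y ^ 2)⁻¹ * -(c * (X ^ 2)⁻¹ * deriv A x) := fun x =>
    ((((hA.hasDerivAt x).const_mul (c * (X ^ 2)⁻¹)).const_sub q).const_mul _).deriv
  refine mem_stVenantSpectrum_of_quasiperiodic hρ (a := a) (a' := a')
    (b := fun x => ((X ^ 2 * Y ^ 6 : ℝ) : ℂ)⁻¹ * b x)
    (b' := fun x => ((X ^ 2 * Y ^ 6 : ℝ) : ℂ)⁻¹ * b' x)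
    (s := fun x => ((Y ^ 4 : ℝ) : ℂ)⁻¹ * (P x - ε * k * c * b x))
    (s' := fun x => ((Y ^ 4 : ℝ) : ℂ)⁻¹ * s' x) hTd hTc (fun x => by simp only [hA1])
    (fun x => by simp only [hA1, hdp x]) had (fun x => (hbd x).const_mul _)
    (fun x => (hsd x).const_mul _) hac' (hbc'.const_mul _) (hsc'.const_mul _) hap
    (fun x => by simp only [hbp]; ring) (fun x => by simp only [hbp']; ring)
    (fun x => by simp only [hbp, hPp]; ring) (fun x => ?_) (fun x => ?_) (fun x => ?_) ?_
  · have h1 : P x = ε * k * (A x : ℂ)⁻¹ * v x + ν * k * Λ * v x + ε * k * c * b x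
        - ν * k ^ 2 * c * v' x := by
      simp only [hv']; field_simp; ring
    have := hA0 x
    rw [hUd, h1]
    simp only [hb', ha', ha, hε]
    push_cast
    field_simp
    ring
  · simp only [hb']
    push_cast
    field_simp
    ring
  · simp only [hs', hε, hδ]
    push_cast
    field_simp
    ring
  · -- `a = b = 0` gives `v = g = 0`, and then `v' = 0` gives `P = 0`
    by_contra! h0
    have hv0 : ∀ x, v x = 0 := fun x => by
      have h1 : (A x : ℂ) ^ 2 * v x = 0 := (h0 x).1
      exact (mul_eq_zero.1 h1).resolve_left (pow_ne_zero 2 (hA0 x))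
    have hb0 : ∀ x, b x = 0 := fun x => by
      have h1 := (h0 x).2
      refine (mul_eq_zero.1 h1).resolve_left (inv_ne_zero ?_)
      push_cast
      simp [hXc, hYc]
    have hg0 : ∀ x, g x = 0 := fun x => by
      have h1 : g x - c * a x = 0 := hb0 x
      rw [(h0 x).1] at h1
      simpa using h1
    have hv'0 : ∀ x, v' x = 0 := fun x => by
      have h1 := hvd x
      rw [show v = fun _ => 0 from funext hv0] at h1
      exact h1.unique (hasDerivAt_const x (0 : ℂ))
    refine hZ0 (funext fun x => funext fun i => ?_)
    have h2 := hv'0 x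
    simp only [hv', hv0, hb0, mul_zero, zero_sub, add_zero] at h2
    rw [div_eq_zero_iff, neg_eq_zero] at h2
    have h3 := h2.resolve_right (by simp [hνc, hcc, hkc])
    fin_cases i
    · exact hv0 x
    · exact hg0 x
    · exact h3

end Rescaling

/-! ### Instability at large Froude number -/

section Instability

theorem isWaveProfile_of_isRescaledProfile {ε δ ν c k q : ℝ} {A : ℝ → ℝ}
    (h : IsRescaledProfile ε δ ν c k q A) : IsWaveProfile A :=
  ⟨h.1, h.2.1, h.2.2.1⟩

/-- For `ε = δ = 0` the profile equation reads `(A'/A²)' = (1 - q² A) / (ck²ν)`, which has no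
periodic solution when `q = 0`. -/
theorem ne_zero_of_isRescaledProfile {ν c k q : ℝ} {A : ℝ → ℝ} (hν : ν ≠ 0) (hc : c ≠ 0)
    (hk : k ≠ 0) (h : IsRescaledProfile 0 0 ν c k q A) : q ≠ 0 := by
  rintro rfl
  have hA := isWaveProfile_of_isRescaledProfile h
  have hA0 : ∀ x, A x ≠ 0 := fun x => (hA.2.2 x).ne'
  have hd : ∀ x, HasDerivAt (deriv A) (deriv (deriv A) x) x := fun x =>
    ((hA.contDiff_deriv.differentiable (by simp)) x).hasDerivAt
  have hf : ∀ x, HasDerivAt (fun x => deriv A x / A x ^ 2 - 1 / (c * k ^ 2 * ν) * x) 0 x :=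
    fun x => by
    refine (((hd x).div ((hA.hasDerivAt x).pow 2) (pow_ne_zero 2 (hA0 x))).sub
      ((hasDerivAt_id x).const_mul _)).congr_deriv ?_
    have := hA0 x
    rw [h.2.2.2 x]
    simp
    field_simp
    ring
  have h1 := is_const_of_deriv_eq_zero (fun x => (hf x).differentiableAt)
    (fun x => (hf x).deriv) 1 0
  have h2 : A (0 + 1) = A 0 := hA.2.1 0
  have h3 : deriv A (0 + 1) = deriv A 0 := hA.periodic_deriv 0
  rw [zero_add] at h2 h3
  rw [h2, h3] at h1
  have h4 : 1 / (c * k ^ 2 * ν) ≠ 0 := by simp [hν, hc, hk]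
  apply h4
  linarith

/-- An unstable Floquet solution of the limiting full system persists, with the same multiplier,
for large Froude numbers, provided that `ρ` is not a multiplier for every `Λ`. -/
theorem eventually_unstable_of_hasBloch {α ν : ℝ} (hν : 0 < ν) {a : ℝ → ℝ → ℝ} {c k q : ℝ → ℝ}
    {A : ℝ → ℝ} {c' k' q' ε' : ℝ} (hc' : c' ≠ 0) (hk' : 0 < k')
    (hprofile : ∀ᶠ F in atTop, IsFroudeProfile α F ν (c F) (k F) (q F) (a F))
    (hA : IsWaveProfile A) (hc : Tendsto c atTop (𝓝 c')) (hk : Tendsto k atTop (𝓝 k'))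
    (hq : Tendsto q atTop (𝓝 q')) (ha : TendstoUniformly a A atTop)
    (hε : Tendsto (fun F : ℝ => F ^ (-(3 / 2) - 3 * α / 4)) atTop (𝓝 ε')) {ρ Λ Λ₁ : ℂ}
    (hρ : ‖ρ‖ = 1) (hΛ : 0 < Λ.re)
    (h : HasBloch (fullB₀ ε' 0 ν c' k' q' (toBCF A) + Λ • fullB₁ ε' c' k' (toBCF A)) ρ)
    (h₁ : ¬ HasBloch (fullB₀ ε' 0 ν c' k' q' (toBCF A) + Λ₁ • fullB₁ ε' c' k' (toBCF A)) ρ) :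
    ∀ᶠ F in atTop, StVenantSpectrallyUnstable ν F
      (k F * F ^ (1 / 2 + 5 * α / 4)) (c F * F ^ (-1 - 3 * α / 2))
      (fun x => F ^ α * a F x) (fun x => F ^ (-α / 2) * (q F - c F * F⁻¹ * a F x)) := by
  have hof : ∀ {f : ℝ → ℝ} {y : ℝ}, Tendsto f atTop (𝓝 y) →
      Tendsto (fun F => (f F : ℂ)) atTop (𝓝 (y : ℂ)) := fun hf =>
    (Complex.continuous_ofReal.tendsto _).comp hf
  have hwave : ∀ᶠ F in atTop, IsWaveProfile (a F) :=
    hprofile.mono fun F hF => isWaveProfile_of_isRescaledProfile hF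
  have hδ : Tendsto (fun F : ℝ => ((F⁻¹ : ℝ) : ℂ)) atTop (𝓝 0) := by
    simpa using hof tendsto_inv_atTop_zero
  obtain ⟨ht₀, ht₁⟩ := tendsto_fullB (ν := (ν : ℂ)) (hof hε) hδ (hof hc) (hof hk) (hof hq)
    (tendsto_toBCF (hwave.mono fun F hF => ⟨hF.continuous, hF.2.1⟩) ⟨hA.continuous, hA.2.1⟩ ha)
    hA.isUnit (by exact_mod_cast hν.ne') (by exact_mod_cast hc') (by exact_mod_cast hk'.ne')
  have key := HasBloch.eventually_exists ht₀ ht₁ (tendsto_const_nhds (x := ρ))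
    (hwave.mono fun F hF => fullB₀_periodic hF _ _ _ _ _ _)
    (hwave.mono fun F hF => fullB₁_periodic hF _ _ _)
    (fullB₀_periodic hA _ _ _ _ _ _) (fullB₁_periodic hA _ _ _) h h₁ hΛ
  filter_upwards [key, hwave, eventually_gt_atTop 0, hc.eventually_ne hc',
    hk.eventually_const_lt hk'] with F hF hAF hF0 hcF hkF
  obtain ⟨z, hz, hB⟩ := hF
  -- the ball of radius `Λ.re` about `Λ` lies in the open right half plane
  have hzre : 0 < z.re := by
    rw [Metric.mem_ball, Complex.dist_eq] at hz
    have h2 := (Complex.abs_re_le_norm (z - Λ)).trans_lt hz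
    rw [Complex.sub_re] at h2
    linarith [(abs_lt.1 h2).1]
  set X : ℝ := F ^ (1 / 2 : ℝ) with hX
  set Y : ℝ := F ^ (α / 4) with hY
  have hX0 : 0 < X := Real.rpow_pos_of_pos hF0 _
  have hY0 : 0 < Y := Real.rpow_pos_of_pos hF0 _
  have hpow : ∀ (β : ℝ) (n : ℕ), (F ^ β) ^ n = F ^ (β * n) := fun β n => by
    rw [Real.rpow_mul hF0.le, Real.rpow_natCast]
  have e₁ : X ^ 2 = F := by rw [hX, hpow]; norm_num
  have e₂ : F ^ (-(3 / 2) - 3 * α / 4) = ((X * Y) ^ 3)⁻¹ := by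
    rw [hX, hY, mul_pow, hpow, hpow, ← Real.rpow_add hF0, ← Real.rpow_neg hF0.le]
    congr 1; push_cast; ring
  have e₃ : F ^ (1 / 2 + 5 * α / 4) = X * Y ^ 5 := by
    rw [hX, hY, hpow, ← Real.rpow_add hF0]
    congr 1; push_cast; ring
  have e₄ : F ^ (-1 - 3 * α / 2) = (X ^ 2 * Y ^ 6)⁻¹ := by
    rw [hX, hY, hpow, hpow, ← Real.rpow_add hF0, ← Real.rpow_neg hF0.le]
    congr 1; push_cast; ring
  have e₅ : F ^ α = Y ^ 4 := by
    rw [hY, hpow]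
    congr 1; push_cast; ring
  have e₆ : F ^ (-α / 2) = (Y ^ 2)⁻¹ := by
    rw [hY, hpow, ← Real.rpow_neg hF0.le]
    congr 1; push_cast; ring
  rw [e₃, e₄, e₅, e₆]
  rw [e₂] at hB
  clear_value X Y
  subst e₁
  refine ⟨_, mem_stVenantSpectrum_of_hasBloch hAF hX0 hY0 hν hcF hkF hρ hB, ?_⟩
  rw [← Complex.ofReal_inv, Complex.re_ofReal_mul]
  positivity

/-- The multiplier `1` of an unstable Floquet solution of the reduced problem can be moved away
from `1`. -/
theorem exists_hasBloch_reduced_ne_one {A : ℝ → ℝ} (hA : IsWaveProfile A) {ν c k q : ℝ}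
    (hν : 0 < ν) (hc : c ≠ 0) (hk : 0 < k) (hq : q ≠ 0) {ρ Λ : ℂ} (hρ : ‖ρ‖ = 1) (hΛ : 0 < Λ.re)
    (h : HasBloch (reducedB₀ ν c k q (toBCF A) + Λ • reducedB₁ c k) ρ) :
    ∃ ρ' Λ' : ℂ, ‖ρ'‖ = 1 ∧ ρ' ≠ 1 ∧ 0 < Λ'.re ∧
      HasBloch (reducedB₀ ν c k q (toBCF A) + Λ' • reducedB₁ c k) ρ' := by
  by_cases h1 : ρ = 1
  · subst h1
    obtain ⟨Λ₁, hΛ₁⟩ := exists_not_hasBloch_reduced hA hν hc hk hq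
    have hd : HasDerivAt (fun ξ : ℝ => Complex.exp (ξ * Complex.I)) Complex.I 0 := by
      have := (((hasDerivAt_id (0 : ℝ)).ofReal_comp).mul_const Complex.I).cexp
      simpa using this
    have ht : Tendsto (fun ξ : ℝ => Complex.exp (ξ * Complex.I)) (𝓝[≠] 0) (𝓝 1) := by
      have := hd.continuousAt.tendsto.mono_left (nhdsWithin_le_nhds (s := {0}ᶜ))
      simpa using this
    have key := HasBloch.eventually_exists (tendsto_const_nhds (x := reducedB₀ ν c k q (toBCF A)))
      (tendsto_const_nhds (x := reducedB₁ c k)) ht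
      (Eventually.of_forall fun _ => reducedB₀_periodic hA _ _ _ _)
      (Eventually.of_forall fun _ => reducedB₁_periodic _ _)
      (reducedB₀_periodic hA _ _ _ _) (reducedB₁_periodic _ _) h (hΛ₁ 1 norm_one) hΛ
    obtain ⟨ξ, ⟨z, hz, hB⟩, hξ⟩ :=
      (key.and (hd.eventually_ne Complex.I_ne_zero (c := 1))).exists
    refine ⟨_, z, Complex.norm_exp_ofReal_mul_I ξ, hξ, ?_, hB⟩
    rw [Metric.mem_ball, Complex.dist_eq] at hz
    have h2 := (Complex.abs_re_le_norm (z - Λ)).trans_lt hz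
    rw [Complex.sub_re] at h2
    linarith [(abs_lt.1 h2).1]
  · exact ⟨ρ, Λ, hρ, h1, hΛ, h⟩

end Instability

end StVenant

end

open StVenant

/-- Here `a F`, `c F`, `k F`, `q F` are the rescaled profile, speed, wave number and discharge at
Froude number `F`; the corresponding wave of the St. Venant system is
`τ = F^α a`, `u = F^(-α/2) (q - c F⁻¹ a)`, of speed `c F^(-1-3α/2)` and wave number
`k F^(1/2+5α/4)`. -/
theorem mainTheorem4 (α ν : ℝ) (hα : -2 ≤ α) (hν : 0 < ν)
    (a : ℝ → ℝ → ℝ) (c k q : ℝ → ℝ)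
    (aInf : ℝ → ℝ) (cInf kInf qInf : ℝ) (hcInf : cInf ≠ 0) (hkInf : 0 < kInf)
    (hprofile : ∀ᶠ F in atTop, IsFroudeProfile α F ν (c F) (k F) (q F) (a F))
    (hlimit : IsLimitingProfile α ν cInf kInf qInf aInf)
    (hc : Tendsto c atTop (𝓝 cInf)) (hk : Tendsto k atTop (𝓝 kInf))
    (hq : Tendsto q atTop (𝓝 qInf)) (ha : TendstoUniformly a aInf atTop)
    (hunstable : ∃ Λ ∈ limitingSpectrum α ν cInf kInf qInf aInf, 0 < Λ.re) :
    ∀ᶠ F in atTop,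
      StVenantSpectrallyUnstable ν F
        (k F * F ^ (1 / 2 + 5 * α / 4)) (c F * F ^ (-1 - 3 * α / 2))
        (fun x => F ^ α * a F x)
        (fun x => F ^ (-α / 2) * (q F - c F * F⁻¹ * a F x)) := by
  rw [IsLimitingProfile] at hlimit
  have hA := isWaveProfile_of_isRescaledProfile hlimit
  obtain ⟨Λ, hmem, hΛ⟩ := hunstable
  rw [limitingSpectrum] at hmem
  by_cases h2 : α = -2
  · rw [if_pos h2] at hmem
    have hε : Tendsto (fun F : ℝ => F ^ (-(3 / 2) - 3 * α / 4)) atTop (𝓝 1) := by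
      have e : -(3 / 2) - 3 * α / 4 = 0 := by rw [h2]; norm_num
      simp [e]
    obtain ⟨ρ, hρ, hB⟩ : ∃ ρ : ℂ, ‖ρ‖ = 1 ∧
        HasBloch (fullB₀ 1 0 ν cInf kInf qInf (toBCF aInf) + Λ • fullB₁ 1 cInf kInf (toBCF aInf))
          ρ := by
      by_contra! hno
      exact hmem (hasBoundedInverse_criticalLimitEq hA hν hcInf hkInf hno)
    obtain ⟨Λ₁, hΛ₁⟩ := exists_not_hasBloch_critical hA (q := qInf) hν hcInf hkInf
    refine eventually_unstable_of_hasBloch hν hcInf hkInf hprofile hA hc hk hq ha hε hρ hΛ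
      (Λ₁ := Λ₁) ?_ ?_
    · rw [Complex.ofReal_one]; exact hB
    · rw [Complex.ofReal_one]; exact hΛ₁ ρ hρ
  · rw [if_neg h2] at hmem hlimit
    have hq0 := ne_zero_of_isRescaledProfile hν.ne' hcInf hkInf.ne' hlimit
    have hε : Tendsto (fun F : ℝ => F ^ (-(3 / 2) - 3 * α / 4)) atTop (𝓝 0) := by
      have hpos : 0 < 3 / 2 + 3 * α / 4 := by
        have : -2 < α := lt_of_le_of_ne hα (Ne.symm h2)
        linarith
      have e : -(3 / 2) - 3 * α / 4 = -(3 / 2 + 3 * α / 4) := by ring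
      rw [e]
      exact tendsto_rpow_neg_atTop hpos
    obtain ⟨ρ, hρ, hB⟩ : ∃ ρ : ℂ, ‖ρ‖ = 1 ∧
        HasBloch (reducedB₀ ν cInf kInf qInf (toBCF aInf) + Λ • reducedB₁ cInf kInf) ρ := by
      by_contra! hno
      exact hmem (hasBoundedInverse_hamiltonianLimitEq hA hν hcInf hkInf hno)
    -- the full system has the multiplier `1` for every `Λ`, so `ρ = 1` has to be avoided
    obtain ⟨ρ', Λ', hρ', hne, hΛ', hB'⟩ :=
      exists_hasBloch_reduced_ne_one hA hν hcInf hkInf hq0 hρ hΛ hB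
    obtain ⟨Λ₁, hΛ₁⟩ := exists_not_hasBloch_reduced hA hν hcInf hkInf hq0
    have hνc : (ν : ℂ) ≠ 0 := by exact_mod_cast hν.ne'
    have hcc : (cInf : ℂ) ≠ 0 := by exact_mod_cast hcInf
    have hkc : (kInf : ℂ) ≠ 0 := by exact_mod_cast hkInf.ne'
    refine eventually_unstable_of_hasBloch hν hcInf hkInf hprofile hA hc hk hq ha hε hρ' hΛ'
      (Λ₁ := Λ₁) ?_ ?_
    · rw [Complex.ofReal_zero]
      exact hB'.full_of_reduced hA hνc hcc hkc (by exact_mod_cast hq0)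
    · rw [Complex.ofReal_zero]
      exact fun hB₁ => hΛ₁ ρ' hρ' (hB₁.reduced_of_full hA hνc hcc hkc hne)
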